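/- Let $\mathcal{H}^1(\mathbb{R})$ be the real-variable Hardy space of real tempered distributions $f\in\mathcal{S}'(\mathbb{R})$ with $\sup_{t>0}|f*\chi_t|\in L^1(\mathbb{R})$, where $\chi\in C_c^\infty(\mathbb{R})$ is any fixed function with $\int_{\mathbb{R}}\chi\neq 0$ and $\chi_t(x)=t^{-1}\chi(x/t)$. Let $H$ be the Hilbert transform, i.e. the Fourier multiplier $\widehat{Hg}(\xi)=-i\,\mathrm{sgn}(\xi)\,\hat g(\xi)$, let $L^p(\mathbb{R})$ denote real-valued functions, and for $p\in\{1,2\}$ put $\mathcal{H}^p(\mathbb{R},\mathbb{C})=\{g+iHg : g,Hg\in L^p(\mathbb{R})\}$. Every $f\in\mathcal{H}^1(\mathbb{R})$ can be written as $f=\omega\gamma-H\omega\,H\gamma$ for some $\omega,\gamma\in L^2(\mathbb{R})$. However, there exists $f\in\mathcal{H}^1(\mathbb{R})$ that cannot be written as $f=\omega^2-(H\omega)^2$ for any $\omega\in L^2(\mathbb{R})$. Moreover (this is the complex form of the same result), $$\{\alpha^2:\alpha\in\mathcal{H}^2(\mathbb{R},\mathbb{C})\}\subsetneq\{\alpha\beta:\alpha,\beta\in\mathcal{H}^2(\mathbb{R},\mathbb{C})\}=\mathcal{H}^1(\mathbb{R},\mathbb{C}).$$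 -/

import Mathlib

open MeasureTheory SchwartzMap FourierTransform
open scoped ENNReal

noncomputable section

/-! ### The real-variable Hardy space `ℋ¹(ℝ)` -/

namespace RealHardy

/-- For `χ ∈ C_c^∞(ℝ)`, `t > 0` and `x ∈ ℝ`, the test function
`y ↦ χ_t (x - y) = t⁻¹ χ ((x - y) / t)`. -/
def kernel (χ : ℝ → ℂ) (hs : ContDiff ℝ (⊤ : ℕ∞) χ) (hc : HasCompactSupport χ)
    (t : Set.Ioi (0 : ℝ)) (x : ℝ) : 𝓢(ℝ, ℂ) :=
  HasCompactSupport.toSchwartzMap (f := fun y : ℝ => ((t : ℝ) : ℂ)⁻¹ * χ ((x - y) / (t : ℝ)))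
    (by
      have ht : (t : ℝ) ≠ 0 := ne_of_gt t.2
      have h1 : HasCompactSupport (fun y : ℝ => χ ((x - y) / (t : ℝ))) :=
        hc.comp_homeomorph ((Homeomorph.subLeft x).trans (Homeomorph.mulRight₀ (t : ℝ)⁻¹ (inv_ne_zero ht)))
      exact h1.mul_left)
    (contDiff_const.mul (hs.comp ((contDiff_const.sub contDiff_id).div_const _)))

theorem kernel_apply (χ : ℝ → ℂ) (hs : ContDiff ℝ (⊤ : ℕ∞) χ) (hc : HasCompactSupport χ)
    (t : Set.Ioi (0 : ℝ)) (x y : ℝ) :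
    kernel χ hs hc t x y = ((t : ℝ) : ℂ)⁻¹ * χ ((x - y) / (t : ℝ)) := rfl

/-- The convolution `(f * χ_t)(x) = ⟨f, χ_t (x - ·)⟩` of a tempered distribution with `χ_t`. -/
def conv (f : 𝓢'(ℝ, ℂ)) (χ : ℝ → ℂ) (hs : ContDiff ℝ (⊤ : ℕ∞) χ) (hc : HasCompactSupport χ)
    (t : Set.Ioi (0 : ℝ)) (x : ℝ) : ℂ :=
  f (kernel χ hs hc t x)

/-- The smooth maximal function `x ↦ sup_{t > 0} |(f * χ_t)(x)|`, with values in `[0, ∞]`. -/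
def maximal (f : 𝓢'(ℝ, ℂ)) (χ : ℝ → ℂ) (hs : ContDiff ℝ (⊤ : ℕ∞) χ) (hc : HasCompactSupport χ)
    (x : ℝ) : ℝ≥0∞ :=
  ⨆ t : Set.Ioi (0 : ℝ), ‖conv f χ hs hc t x‖ₑ

/-- A tempered distribution is real if it takes real values on real-valued test functions. -/
def IsReal (f : 𝓢'(ℝ, ℂ)) : Prop :=
  ∀ φ : 𝓢(ℝ, ℂ), (∀ x, (φ x).im = 0) → (f φ).im = 0

/-- The (real) Hardy space `ℋ¹(ℝ)`: the real tempered distributions whose smooth maximal function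
is in `L¹(ℝ)`. (The maximal function is a supremum of continuous functions of `x`, hence lower
semicontinuous, so membership in `L¹` is finiteness of its integral.) -/
def hardyOne (χ : ℝ → ℂ) (hs : ContDiff ℝ (⊤ : ℕ∞) χ) (hc : HasCompactSupport χ) : Set 𝓢'(ℝ, ℂ) :=
  {f | IsReal f ∧ ∫⁻ x, maximal f χ hs hc x < ∞}

/-- The tempered distribution `f` is (integration against) the integrable function `F`. -/
def IsFunction (f : 𝓢'(ℝ, ℂ)) (F : ℝ → ℝ) : Prop :=
  Integrable F ∧ ∀ φ : 𝓢(ℝ, ℂ), f φ = ∫ x, φ x * (F x : ℂ)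

/-! ### The Hilbert transform -/

/-- The Fourier multiplier `ξ ↦ -i sgn ξ` of the Hilbert transform. -/
def symbol (ξ : ℝ) : ℂ := -Complex.I * (Real.sign ξ : ℂ)

theorem memLp_symbol : MemLp symbol ∞ (volume : Measure ℝ) := by
  refine memLp_top_of_bound ?_ 1 (Filter.Eventually.of_forall fun ξ => ?_)
  · refine Measurable.aestronglyMeasurable ?_
    unfold symbol Real.sign
    refine measurable_const.mul (Complex.measurable_ofReal.comp ?_)
    exact Measurable.ite measurableSet_Iio measurable_const
      (Measurable.ite measurableSet_Ioi measurable_const measurable_const)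
  · rcases Real.sign_apply_eq ξ with h | h | h <;> simp [symbol, h]

/-- The Hilbert transform on `L²(ℝ, ℂ)`, with Fourier multiplier `-i sgn ξ`
(that is, the principal value convolution with `1 / (π x)`). -/
def hilbertComplex (f : Lp ℂ 2 (volume : Measure ℝ)) : Lp ℂ 2 (volume : Measure ℝ) :=
  𝓕⁻ (memLp_symbol.toLp symbol • 𝓕 f)

/-- The inclusion `L²(ℝ) ⊆ L²(ℝ, ℂ)`. -/
def toComplex (ω : Lp ℝ 2 (volume : Measure ℝ)) : Lp ℂ 2 (volume : Measure ℝ) :=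
  Complex.ofRealCLM.compLp ω

/-- The Hilbert transform on `L²(ℝ) = L²(ℝ, ℝ)`. -/
def hilbert (ω : Lp ℝ 2 (volume : Measure ℝ)) : Lp ℝ 2 (volume : Measure ℝ) :=
  Complex.reCLM.compLp (hilbertComplex (toComplex ω))

/-- Complex conjugation on `L²(ℝ, ℂ)`. -/
def conjL : Lp ℂ 2 (volume : Measure ℝ) →L[ℝ] Lp ℂ 2 (volume : Measure ℝ) :=
  (Complex.conjCLE : ℂ →L[ℝ] ℂ).compLpL 2 volume

/-- The reflection `f ↦ f (-·)` on `L²(ℝ, ℂ)`. -/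
def reflL : Lp ℂ 2 (volume : Measure ℝ) →ₗᵢ[ℂ] Lp ℂ 2 (volume : Measure ℝ) :=
  Lp.compMeasurePreservingₗᵢ ℂ (fun x : ℝ => -x) (Measure.measurePreserving_neg volume)

theorem coeFn_conjL (f : Lp ℂ 2 (volume : Measure ℝ)) :
    conjL f =ᵐ[volume] fun x => starRingEnd ℂ (f x) :=
  (Complex.conjCLE : ℂ →L[ℝ] ℂ).coeFn_compLp f

theorem coeFn_reflL (f : Lp ℂ 2 (volume : Measure ℝ)) :
    reflL f =ᵐ[volume] fun x => f (-x) :=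
  Lp.coeFn_compMeasurePreserving f (Measure.measurePreserving_neg volume)

theorem reflL_fourier (f : Lp ℂ 2 (volume : Measure ℝ)) : reflL (𝓕 f) = 𝓕⁻ f := by
  apply DenseRange.induction_on (p := fun f : Lp ℂ 2 (volume : Measure ℝ) => reflL (𝓕 f) = 𝓕⁻ f)
    (SchwartzMap.denseRange_toLpCLM (p := 2) ENNReal.ofNat_ne_top) f
  · exact isClosed_eq (reflL.continuous.comp (Lp.fourierTransformₗᵢ ℝ ℂ).continuous)
      (Lp.fourierTransformₗᵢ ℝ ℂ).symm.continuous
  intro φ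
  simp only [toLpCLM_apply, toLp_fourier_eq, toLp_fourierInv_eq]
  apply Lp.ext
  have h1 := (Measure.measurePreserving_neg (volume : Measure ℝ)).quasiMeasurePreserving.ae
    ((𝓕 φ).coeFn_toLp 2 volume)
  filter_upwards [coeFn_reflL ((𝓕 φ).toLp 2), h1, (𝓕⁻ φ).coeFn_toLp 2 volume] with x h1 h2 h3
  rw [h1, h2, h3, SchwartzMap.fourier_coe, SchwartzMap.fourierInv_coe,
    Real.fourierInv_eq_fourier_neg]

theorem reflL_reflL (f : Lp ℂ 2 (volume : Measure ℝ)) : reflL (reflL f) = f := by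
  apply Lp.ext
  have h1 := (Measure.measurePreserving_neg (volume : Measure ℝ)).quasiMeasurePreserving.ae
    (coeFn_reflL f)
  filter_upwards [coeFn_reflL (reflL f), h1] with x h1 h2
  rw [h1, h2, neg_neg]

theorem conjL_fourier (f : Lp ℂ 2 (volume : Measure ℝ)) : conjL (𝓕 f) = 𝓕⁻ (conjL f) := by
  apply DenseRange.induction_on
    (p := fun f : Lp ℂ 2 (volume : Measure ℝ) => conjL (𝓕 f) = 𝓕⁻ (conjL f))
    (SchwartzMap.denseRange_toLpCLM (p := 2) ENNReal.ofNat_ne_top) f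
  · exact isClosed_eq (conjL.continuous.comp (Lp.fourierTransformₗᵢ ℝ ℂ).continuous)
      ((Lp.fourierTransformₗᵢ ℝ ℂ).symm.continuous.comp conjL.continuous)
  intro φ
  let ψ : 𝓢(ℝ, ℂ) := SchwartzMap.postcompCLM (𝕜 := ℝ) (Complex.conjCLE : ℂ →L[ℝ] ℂ) φ
  have hψ : conjL (φ.toLp 2) = ψ.toLp 2 := by
    apply Lp.ext
    filter_upwards [coeFn_conjL (φ.toLp 2), φ.coeFn_toLp 2 volume, ψ.coeFn_toLp 2 volume]
      with x h1 h2 h3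
    rw [h1, h2, h3]; rfl
  simp only [toLpCLM_apply, toLp_fourier_eq, hψ, toLp_fourierInv_eq]
  apply Lp.ext
  filter_upwards [coeFn_conjL ((𝓕 φ).toLp 2), (𝓕 φ).coeFn_toLp 2 volume,
    (𝓕⁻ ψ).coeFn_toLp 2 volume] with x h1 h2 h3
  rw [h1, h2, h3, SchwartzMap.fourier_coe, SchwartzMap.fourierInv_coe,
    Real.fourier_eq', Real.fourierInv_eq', ← integral_conj]
  congr 1
  ext v
  have : ψ v = starRingEnd ℂ (φ v) := rfl
  simp [this, ← Complex.exp_conj, Complex.conj_ofNat]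

theorem conj_symbol (ξ : ℝ) : starRingEnd ℂ (symbol ξ) = symbol (-ξ) := by
  simp [symbol, Real.sign_neg]

theorem coeFn_symbol_smul (f : Lp ℂ 2 (volume : Measure ℝ)) :
    ((memLp_symbol.toLp symbol • f : Lp ℂ 2 (volume : Measure ℝ)) : ℝ → ℂ)
      =ᵐ[volume] fun ξ => symbol ξ * f ξ := by
  filter_upwards [Lp.coeFn_lpSMul (r := 2) (memLp_symbol.toLp symbol) f, memLp_symbol.coeFn_toLp]
    with ξ h1 h2
  rw [h1, Pi.smul_apply', h2, smul_eq_mul]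

theorem conjL_hilbertComplex (f : Lp ℂ 2 (volume : Measure ℝ)) :
    conjL (hilbertComplex f) = hilbertComplex (conjL f) := by
  have h0 : ∀ g : Lp ℂ 2 (volume : Measure ℝ), conjL (𝓕⁻ g) = 𝓕⁻ (reflL (conjL g)) := by
    intro g
    have h1 : conjL (reflL (𝓕 g)) = reflL (conjL (𝓕 g)) := by
      apply Lp.ext
      have h1 := (Measure.measurePreserving_neg (volume : Measure ℝ)).quasiMeasurePreserving.ae
        (coeFn_conjL (𝓕 g))
      filter_upwards [coeFn_conjL (reflL (𝓕 g)), coeFn_reflL (conjL (𝓕 g)), coeFn_reflL (𝓕 g), h1]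
        with x h1 h2 h3 h4
      rw [h1, h2, h3, h4]
    have h2 : ∀ k : Lp ℂ 2 (volume : Measure ℝ), reflL (𝓕⁻ k) = 𝓕 k := by
      intro k
      rw [← reflL_fourier, reflL_reflL]
    have h3 : 𝓕⁻ (reflL (conjL g)) = 𝓕 (conjL g) := by
      have h4 : reflL (conjL g) = 𝓕 (𝓕 (conjL g)) := by
        rw [← h2 (𝓕 (conjL g)), fourierInv_fourier_eq]
      rw [h4, fourierInv_fourier_eq]
    rw [h3, ← reflL_fourier, h1, conjL_fourier, h2]
  rw [hilbertComplex, h0, hilbertComplex]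
  congr 1
  have h5 : 𝓕 (conjL f) = reflL (conjL (𝓕 f)) := by
    rw [conjL_fourier, ← reflL_fourier, reflL_reflL]
  rw [h5]
  apply Lp.ext
  have a1 := (Measure.measurePreserving_neg (volume : Measure ℝ)).quasiMeasurePreserving.ae
    (coeFn_conjL (memLp_symbol.toLp symbol • 𝓕 f : Lp ℂ 2 (volume : Measure ℝ)))
  have a2 := (Measure.measurePreserving_neg (volume : Measure ℝ)).quasiMeasurePreserving.ae
    (coeFn_symbol_smul (𝓕 f))
  have a3 := (Measure.measurePreserving_neg (volume : Measure ℝ)).quasiMeasurePreserving.ae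
    (coeFn_conjL (𝓕 f))
  filter_upwards [coeFn_reflL (conjL (memLp_symbol.toLp symbol • 𝓕 f)), a1, a2, a3,
    coeFn_symbol_smul (reflL (conjL (𝓕 f))), coeFn_reflL (conjL (𝓕 f))] with x b1 b2 b3 b4 b5 b6
  rw [b1, b2, b3, b5, b6, b4, map_mul, conj_symbol, neg_neg]

/-- The Hilbert transform of a real function is real, so that nothing is lost in `hilbert`. -/
theorem toComplex_hilbert (ω : Lp ℝ 2 (volume : Measure ℝ)) :
    toComplex (hilbert ω) = hilbertComplex (toComplex ω) := by
  have h : conjL (toComplex ω) = toComplex ω := by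
    apply Lp.ext
    filter_upwards [coeFn_conjL (toComplex ω), Complex.ofRealCLM.coeFn_compLp ω] with x h1 h2
    rw [h1, toComplex, h2]
    simp
  have h' := conjL_hilbertComplex (toComplex ω)
  rw [h] at h'
  apply Lp.ext
  have h3 := coeFn_conjL (hilbertComplex (toComplex ω))
  rw [h'] at h3
  filter_upwards [h3, Complex.ofRealCLM.coeFn_compLp (hilbert ω),
    Complex.reCLM.coeFn_compLp (hilbertComplex (toComplex ω))] with x h3 h4 h5
  rw [toComplex, h4, hilbert, h5]
  exact Complex.conj_eq_iff_re.mp h3.symm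

/-- For `g, h ∈ L¹(ℝ)`: the function `h` is the Hilbert transform of `g`, that is,
`𝓕 h (ξ) = -i sgn ξ 𝓕 g (ξ)`. -/
def IsHilbertOne (g h : Lp ℝ 1 (volume : Measure ℝ)) : Prop :=
  ∀ ξ : ℝ, 𝓕 (fun x : ℝ => (h x : ℂ)) ξ = symbol ξ * 𝓕 (fun x : ℝ => (g x : ℂ)) ξ

/-! ### The Hardy spaces `ℋᵖ(ℝ, ℂ) = {g + i H g : g, H g ∈ Lᵖ(ℝ)}`, `p = 1, 2` -/

/-- The (a.e. class of the) complex function `g + i h`. -/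
def complexPair (g h : ℝ →ₘ[volume] ℝ) : ℝ →ₘ[volume] ℂ :=
  AEEqFun.comp₂ (fun a b : ℝ => (a : ℂ) + Complex.I * (b : ℂ)) (by fun_prop) g h

/-- `ℋ²(ℝ, ℂ) = {g + i H g : g ∈ L²(ℝ)}` (here `H g ∈ L²(ℝ)` automatically). -/
def hardyComplexTwo : Set (ℝ →ₘ[volume] ℂ) :=
  {α | ∃ g : Lp ℝ 2 (volume : Measure ℝ), α = complexPair g (hilbert g)}

/-- `ℋ¹(ℝ, ℂ) = {g + i H g : g, H g ∈ L¹(ℝ)}`. -/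
def hardyComplexOne : Set (ℝ →ₘ[volume] ℂ) :=
  {α | ∃ g h : Lp ℝ 1 (volume : Measure ℝ), IsHilbertOne g h ∧ α = complexPair g h}

end RealHardy

end

/-! The difficulty is the real factorization. A distribution `f` with integrable maximal function
must first be shown to be a function whose analytic extension is bounded in `L¹` on horizontal
lines; factorization of analytic functions then applies.

That `f` is a function: letting `t → 0` in the pairing of `f` with smoothed test functions gives `|∫
χ| |f φ| ≤ ∫ |φ| Mf`, so `f` is a bounded functional on a subspace of `L²(Mf dx)`, and Riesz
representation yields an integrable density (`exists_isFunction`).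

The maximal estimate follows Fefferman and Stein. A reproducing formula writes any smooth decaying
kernel through averages of `χ` at small scales, so that the tangential maximal function of order 2
for `χ` controls all such kernels (`Tang.norm_cv_le`). Applied to `χ'`, this bounds the oscillation
of `f * χ_t` at scale `t`, and the tangential maximal function is then dominated by the square of
the Hardy-Littlewood maximal function of `Mf ^ (1/2)` (`Tang.of_exists`). The `L²` maximal theorem
makes it integrable. Applied to Gaussians, the building blocks of the Poisson kernel, it bounds the
nontangential maximal function `N` of the Poisson integral (`ntMax_le_of_tang`).

The conjugate function is handled by the argument of Burkholder, Gundy and Silverstein. Cauchy's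
theorem for the square of the analytic extension on a Lipschitz graph over `{N ≤ l}` bounds the
imaginary part in `L²` by the real part, and the real part is bounded by `N` or by `l` on the graph.
Integration over `l` gives `lintegral_conj_le`.

On each line the extension is analytic and integrable, and it factors as `G K` with `|G|² = |K|²`
equal to its modulus. Inner-outer theory is replaced by Beurling's wandering vector for
multiplication by the Blaschke factor (`exists_wandering`, `exists_factorization`). The factors are
bounded in `L²` as the line descends to the real axis; weak limits `g`, `k` exist, Cauchy integrals
pass to the limit pointwise and are multiplicative on `ℋ²`, so `Re (g k) = f`
(`exists_re_factorization`). The same factorization applied on the real axis gives the complex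
statement.

For the negative part, `(z - i) / (z + i)⁴` has a simple zero at `i`, whereas a square vanishes
there to even order (`not_nonsquare_ae_eq_sq`). Its real part lies in the real Hardy space because
it decays quadratically and has an integrable primitive, and an element of `ℋ¹` is determined by its
real part, so the real version fails as well. -/

namespace RealHardy

/-! ### The Hardy–Littlewood maximal function on `ℝ` -/

/-- The centred Hardy–Littlewood maximal function of a nonnegative function on `ℝ`. -/
noncomputable def hlMax (h : ℝ → ℝ≥0∞) (x : ℝ) : ℝ≥0∞ :=
  ⨆ r : Set.Ioi (0 : ℝ), (∫⁻ y in Metric.ball x r, h y) / ENNReal.ofReal (2 * r)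

theorem lintegral_ball_le_hlMax (h : ℝ → ℝ≥0∞) (x : ℝ) {r : ℝ} (hr : 0 < r) :
    ∫⁻ y in Metric.ball x r, h y ≤ hlMax h x * ENNReal.ofReal (2 * r) := by
  have h1 : (∫⁻ y in Metric.ball x r, h y) / ENNReal.ofReal (2 * r) ≤ hlMax h x :=
    le_iSup (fun r : Set.Ioi (0 : ℝ) =>
      (∫⁻ y in Metric.ball x r, h y) / ENNReal.ofReal (2 * r)) ⟨r, hr⟩
  rwa [ENNReal.div_le_iff (by simpa using hr) ENNReal.ofReal_ne_top] at h1

/-- A slightly smaller concentric ball already carries more than `a`, and it stays inside the ball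
of radius `r` about any nearby centre. -/
theorem isOpen_lt_lintegral_ball (h : ℝ → ℝ≥0∞) (r : ℝ) (a : ℝ≥0∞) :
    IsOpen {x : ℝ | a < ∫⁻ y in Metric.ball x r, h y} := by
  rw [isOpen_iff_mem_nhds]
  intro x hx
  have hU : Metric.ball x r = ⋃ n : ℕ, Metric.ball x (r - 1 / (n + 1)) := by
    ext y
    simp only [Metric.mem_ball, Set.mem_iUnion]
    constructor
    · intro hy
      obtain ⟨n, hn⟩ := exists_nat_one_div_lt (sub_pos.2 hy)
      exact ⟨n, by linarith⟩
    · rintro ⟨n, hn⟩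
      have : (0 : ℝ) < 1 / (n + 1) := by positivity
      linarith
  have hmono : Monotone fun n : ℕ => Metric.ball x (r - 1 / ((n : ℝ) + 1)) := by
    intro m n hmn
    apply Metric.ball_subset_ball
    have := Nat.one_div_le_one_div (α := ℝ) hmn
    linarith
  have h1 := tendsto_measure_iUnion_atTop (μ := volume.withDensity h) hmono
  rw [← hU] at h1
  have hx' : a < volume.withDensity h (Metric.ball x r) := by
    rw [withDensity_apply _ measurableSet_ball]; exact hx
  obtain ⟨n, hn⟩ := ((tendsto_order.1 h1).1 a hx').exists
  have hpos : (0 : ℝ) < 1 / (n + 1) := by positivity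
  filter_upwards [Metric.ball_mem_nhds x hpos] with x' hx'
  refine lt_of_lt_of_le hn ?_
  simp only [Function.comp_apply]
  rw [withDensity_apply _ measurableSet_ball]
  apply lintegral_mono_set
  intro y hy
  rw [Metric.mem_ball] at *
  have := dist_triangle y x x'
  rw [dist_comm x x'] at this
  linarith

theorem isOpen_lt_hlMax (h : ℝ → ℝ≥0∞) (a : ℝ≥0∞) : IsOpen {x : ℝ | a < hlMax h x} := by
  have : {x : ℝ | a < hlMax h x} = ⋃ r : Set.Ioi (0 : ℝ),
      {x : ℝ | a * ENNReal.ofReal (2 * r) < ∫⁻ y in Metric.ball x r, h y} := by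
    ext x
    simp only [hlMax, Set.mem_ofPred_eq, Set.mem_iUnion, lt_iSup_iff]
    refine exists_congr fun r => ?_
    have hr : (0 : ℝ) < r := r.2
    rw [ENNReal.lt_div_iff_mul_lt (by left; simpa using hr) (by left; exact ENNReal.ofReal_ne_top)]
  rw [this]
  exact isOpen_iUnion fun r => isOpen_lt_lintegral_ball h r _

theorem measurable_hlMax (h : ℝ → ℝ≥0∞) : Measurable (hlMax h) :=
  measurable_of_Ioi fun a => (isOpen_lt_hlMax h a).measurableSet

theorem hlMax_add_const_le (h k : ℝ → ℝ≥0∞) (hk : Measurable k) (c : ℝ≥0∞)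
    (hh : ∀ y, h y ≤ k y + c) (x : ℝ) : hlMax h x ≤ hlMax k x + c := by
  refine iSup_le fun r => ?_
  have hr : (0 : ℝ) < r := r.2
  rw [ENNReal.div_le_iff (by simpa using hr) ENNReal.ofReal_ne_top]
  calc ∫⁻ y in Metric.ball x r, h y ≤ ∫⁻ y in Metric.ball x r, (k y + c) := lintegral_mono hh
    _ = (∫⁻ y in Metric.ball x r, k y) + c * ENNReal.ofReal (2 * r) := by
      rw [lintegral_add_left hk, setLIntegral_const, Real.volume_ball]
    _ ≤ _ := by
      rw [add_mul]
      gcongr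
      exact lintegral_ball_le_hlMax k x hr

/-- Vitali covering: each point of the level set has a ball on which the mean of `h` exceeds `a`. A
disjoint subfamily whose fourfold enlargements still cover gives the constant 4; any enlargement
beyond 3 would do. -/
theorem weak_type_hlMax (h : ℝ → ℝ≥0∞) {a : ℝ≥0∞} (ha : a ≠ 0) (ha' : a ≠ ∞) :
    a * volume {x | a < hlMax h x} ≤ 4 * ∫⁻ y, h y := by
  rcases eq_or_ne (∫⁻ y, h y) ∞ with htop | hfin
  · simp [htop]
  have hex : ∀ x : {x | a < hlMax h x}, ∃ r : ℝ, 0 < r ∧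
      a * ENNReal.ofReal (2 * r) < ∫⁻ y in Metric.ball (x : ℝ) r, h y := by
    rintro ⟨x, hx⟩
    obtain ⟨r, hr⟩ := lt_iSup_iff.1 (show a < hlMax h x from hx)
    have hr0 : (0 : ℝ) < r := r.2
    rw [ENNReal.lt_div_iff_mul_lt (by left; simpa using hr0)
      (by left; exact ENNReal.ofReal_ne_top)] at hr
    exact ⟨r, hr0, hr⟩
  choose r hr0 hr using hex
  -- The covering lemma needs bounded radii; they are bounded because `a` times the length of each
  -- ball is below the finite total integral.
  have hbd : ∀ x ∈ (Set.univ : Set {x | a < hlMax h x}),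
      r x ≤ ((∫⁻ y, h y) / a).toReal := by
    intro x _
    have h1 : a * ENNReal.ofReal (2 * r x) ≤ ∫⁻ y, h y :=
      (hr x).le.trans (setLIntegral_le_lintegral _ _)
    have h2 : ENNReal.ofReal (2 * r x) ≤ (∫⁻ y, h y) / a := by
      rw [ENNReal.le_div_iff_mul_le (Or.inl ha) (Or.inl ha'), mul_comm]; exact h1
    have h3 := ENNReal.toReal_mono (ENNReal.div_ne_top hfin ha) h2
    rw [ENNReal.toReal_ofReal (by have := hr0 x; positivity)] at h3
    have := hr0 x
    linarith
  obtain ⟨u, -, hdisj, hcov⟩ := Vitali.exists_disjoint_subfamily_covering_enlargement_ball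
    (Set.univ : Set {x | a < hlMax h x}) (fun x => (x : ℝ)) r _ hbd 4 (by norm_num)
  have hcount : u.Countable := hdisj.countable_of_isOpen (fun i _ => Metric.isOpen_ball)
    (fun i _ => ⟨i, Metric.mem_ball_self (hr0 i)⟩)
  have hsub : {x | a < hlMax h x} ⊆ ⋃ i ∈ u, Metric.ball (i : ℝ) (4 * r i) := by
    intro x hx
    obtain ⟨b, hb, hsub⟩ := hcov ⟨x, hx⟩ trivial
    exact Set.mem_biUnion hb (hsub (Metric.mem_ball_self (hr0 ⟨x, hx⟩)))
  have := hcount.to_subtype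
  calc a * volume {x | a < hlMax h x}
      ≤ a * ∑' i : u, volume (Metric.ball (i : ℝ) (4 * r i)) := by
        gcongr
        exact (measure_mono hsub).trans (measure_biUnion_le _ hcount _)
    _ = ∑' i : u, 4 * (a * ENNReal.ofReal (2 * r i)) := by
        rw [← ENNReal.tsum_mul_left]
        congr 1; ext i
        rw [Real.volume_ball, show 2 * (4 * r i) = 4 * (2 * r i) by ring,
          ENNReal.ofReal_mul (by norm_num), ENNReal.ofReal_ofNat]
        ring
    _ ≤ ∑' i : u, 4 * ∫⁻ y in Metric.ball (i : ℝ) (r i), h y := by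
        gcongr with i
        exact (hr i).le
    _ = 4 * ∫⁻ y in ⋃ i ∈ u, Metric.ball (i : ℝ) (r i), h y := by
        rw [ENNReal.tsum_mul_left, lintegral_biUnion hcount (fun i _ => measurableSet_ball) hdisj]
    _ ≤ 4 * ∫⁻ y, h y := by gcongr; exact Measure.restrict_le_self

theorem ae_hlMax_lt_top {h : ℝ → ℝ≥0∞} (hh : ∫⁻ y, h y ≠ ∞) : ∀ᵐ x, hlMax h x < ∞ := by
  rw [ae_iff]
  simp only [not_lt, top_le_iff]
  by_contra hne
  have key : ∀ n : ℕ, (n + 1 : ℝ≥0∞) * volume {x | hlMax h x = ∞} ≤ 4 * ∫⁻ y, h y := by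
    intro n
    refine le_trans ?_ (weak_type_hlMax h (a := n + 1) (by simp) (by simp))
    gcongr
    intro hx
    rw [hx]; simp [lt_top_iff_ne_top]
  have hfin : 4 * ∫⁻ y, h y < ∞ := ENNReal.mul_lt_top (by simp) hh.lt_top
  obtain ⟨n, hn⟩ := ENNReal.exists_nat_mul_gt hne hfin.ne
  exact absurd (hn.trans_le (le_trans (by gcongr; exact le_self_add) (key n))) (lt_irrefl _)

theorem sq_eq_lintegral_Ioi (a : ℝ≥0∞) :
    a ^ 2 = ∫⁻ l in Set.Ioi (0 : ℝ), ENNReal.ofReal (2 * l) *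
      Set.indicator {l | ENNReal.ofReal l < a} 1 l := by
  have base : ∀ b : ℝ, 0 ≤ b → ∫⁻ l in Set.Ioc (0 : ℝ) b, ENNReal.ofReal (2 * l)
      = ENNReal.ofReal b ^ 2 := by
    intro b hb
    rw [← ofReal_integral_eq_lintegral_ofReal, ← intervalIntegral.integral_of_le hb,
      intervalIntegral.integral_const_mul, integral_id, ← ENNReal.ofReal_pow hb]
    · congr 1; ring
    · exact ((continuous_const.mul continuous_id).integrableOn_Icc).mono_set Set.Ioc_subset_Icc_self
    · filter_upwards [ae_restrict_mem measurableSet_Ioc] with l hl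
      have := hl.1
      positivity
  have hmeas : MeasurableSet {l : ℝ | ENNReal.ofReal l < a} :=
    measurableSet_lt ENNReal.measurable_ofReal measurable_const
  have h1 : ∫⁻ l in Set.Ioi (0 : ℝ), ENNReal.ofReal (2 * l) *
      Set.indicator {l | ENNReal.ofReal l < a} 1 l
      = ∫⁻ l in Set.Ioi (0 : ℝ) ∩ {l | ENNReal.ofReal l < a}, ENNReal.ofReal (2 * l) := by
    rw [Set.inter_comm, ← Measure.restrict_restrict hmeas, ← lintegral_indicator hmeas]
    congr 1; ext l
    by_cases hl : l ∈ {l : ℝ | ENNReal.ofReal l < a} <;> simp [hl]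
  rw [h1]
  rcases eq_or_ne a ∞ with rfl | ha
  · symm
    rw [show (∞ : ℝ≥0∞) ^ 2 = ∞ by simp]
    refine ENNReal.eq_top_of_forall_nnreal_le fun r => ?_
    have hb := base (r + 1) (by positivity)
    calc (r : ℝ≥0∞) ≤ ENNReal.ofReal (r + 1) ^ 2 := by
          rw [← ENNReal.ofReal_pow (by positivity), ← ENNReal.ofReal_coe_nnreal]
          apply ENNReal.ofReal_le_ofReal
          have : (0 : ℝ) ≤ r := r.2
          nlinarith
      _ ≤ _ := by
          rw [← hb]
          apply lintegral_mono_set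
          intro l hl
          exact ⟨hl.1, by simp⟩
  · have hb := base a.toReal ENNReal.toReal_nonneg
    rw [ENNReal.ofReal_toReal ha] at hb
    rw [← hb]
    have : Set.Ioi (0 : ℝ) ∩ {l | ENNReal.ofReal l < a} = Set.Ioo 0 a.toReal := by
      ext l
      simp only [Set.mem_inter_iff, Set.mem_Ioi, Set.mem_ofPred_eq, Set.mem_Ioo]
      refine and_congr_right fun hl => ?_
      rw [ENNReal.ofReal_lt_iff_lt_toReal hl.le ha]
    rw [this]
    exact setLIntegral_congr Ioo_ae_eq_Ioc.symm

/-- Marcinkiewicz interpolation between the weak type bound and the trivial sup bound: at height `l`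
only the part of `h` above `l / 2` matters, and the layer-cake formula integrates the weak type
estimate over `l`. -/
theorem lintegral_hlMax_sq_le {h : ℝ → ℝ≥0∞} (hm : Measurable h) :
    ∫⁻ x, hlMax h x ^ 2 ≤ 32 * ∫⁻ x, h x ^ 2 := by
  have hlev : ∀ l : ℝ, 0 < l → ENNReal.ofReal (2 * l) * volume {x | ENNReal.ofReal l < hlMax h x}
      ≤ 16 * ∫⁻ y, h y * Set.indicator {l | ENNReal.ofReal l < 2 * h y} 1 l := by
    intro l hl
    -- Since `h ≤ k + l / 2`, the maximal function of `k` exceeds `l / 2` wherever that of `h`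
    -- exceeds `l`.
    set k : ℝ → ℝ≥0∞ := Set.indicator {y | ENNReal.ofReal l < 2 * h y} h with hk
    have hms : MeasurableSet {y | ENNReal.ofReal l < 2 * h y} :=
      measurableSet_lt measurable_const (hm.const_mul 2)
    have hsub : {x | ENNReal.ofReal l < hlMax h x} ⊆ {x | ENNReal.ofReal (l / 2) < hlMax k x} := by
      intro x hx
      have h1 := hlMax_add_const_le h k (hm.indicator hms) (ENNReal.ofReal (l / 2)) (fun y => by
        by_cases hy : ENNReal.ofReal l < 2 * h y
        · have : k y = h y := Set.indicator_of_mem (show y ∈ {y | _} from hy) _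
          rw [this]; exact le_self_add
        · rw [not_lt] at hy
          refine le_trans ?_ le_add_self
          rw [ENNReal.ofReal_div_of_pos two_pos, ENNReal.ofReal_ofNat,
            ENNReal.le_div_iff_mul_le (by simp) (by simp), mul_comm]
          exact hy) x
      simp only [Set.mem_ofPred_eq] at hx ⊢
      by_contra hcon
      rw [not_lt] at hcon
      have : hlMax h x ≤ ENNReal.ofReal l := by
        refine h1.trans ((add_le_add_left hcon _).trans ?_)
        rw [← ENNReal.ofReal_add (by positivity) (by positivity)]
        simp
      exact absurd hx (not_lt.2 this)
    calc ENNReal.ofReal (2 * l) * volume {x | ENNReal.ofReal l < hlMax h x}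
        ≤ 4 * (ENNReal.ofReal (l / 2) * volume {x | ENNReal.ofReal (l / 2) < hlMax k x}) := by
          rw [show 2 * l = 4 * (l / 2) by ring, ENNReal.ofReal_mul (by norm_num),
            ENNReal.ofReal_ofNat, mul_assoc]
          gcongr
      _ ≤ 4 * (4 * ∫⁻ y, k y) := by
          exact mul_le_mul_right (weak_type_hlMax k (by simpa using hl) ENNReal.ofReal_ne_top) _
      _ = _ := by
          rw [← mul_assoc]
          norm_num
          congr 1
          apply lintegral_congr
          intro y
          by_cases hy : ENNReal.ofReal l < 2 * h y <;> simp [hk, hy]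
  have hM := measurable_hlMax h
  have hm2 : Measurable (Function.uncurry fun (x l : ℝ) => ENNReal.ofReal (2 * l) *
      Set.indicator {l | ENNReal.ofReal l < hlMax h x} (1 : ℝ → ℝ≥0∞) l) := by
    refine (ENNReal.measurable_ofReal.comp (measurable_snd.const_mul 2)).mul ?_
    exact (measurable_one (α := ℝ≥0∞) (β := ℝ × ℝ)).indicator
      (measurableSet_lt (f := fun p : ℝ × ℝ => ENNReal.ofReal p.2) (g := fun p => hlMax h p.1)
        (ENNReal.measurable_ofReal.comp measurable_snd) (hM.comp measurable_fst))
  have hm3 : Measurable (Function.uncurry fun (l y : ℝ) => h y *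
      Set.indicator {l | ENNReal.ofReal l < 2 * h y} (1 : ℝ → ℝ≥0∞) l) := by
    refine (hm.comp measurable_snd).mul ?_
    exact (measurable_one (α := ℝ≥0∞) (β := ℝ × ℝ)).indicator
      (measurableSet_lt (f := fun p : ℝ × ℝ => ENNReal.ofReal p.1) (g := fun p => 2 * h p.2)
        (ENNReal.measurable_ofReal.comp measurable_fst) ((hm.const_mul 2).comp measurable_snd))
  calc ∫⁻ x, hlMax h x ^ 2
      = ∫⁻ x, ∫⁻ l in Set.Ioi (0 : ℝ), ENNReal.ofReal (2 * l) *
        Set.indicator {l | ENNReal.ofReal l < hlMax h x} 1 l := by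
        simp_rw [← sq_eq_lintegral_Ioi]
    _ = ∫⁻ l in Set.Ioi (0 : ℝ), ∫⁻ x, ENNReal.ofReal (2 * l) *
        Set.indicator {l | ENNReal.ofReal l < hlMax h x} 1 l :=
        lintegral_lintegral_swap hm2.aemeasurable
    _ ≤ ∫⁻ l in Set.Ioi (0 : ℝ),
          16 * ∫⁻ y, h y * Set.indicator {l | ENNReal.ofReal l < 2 * h y} 1 l := by
        apply setLIntegral_mono' measurableSet_Ioi
        intro l hl
        rw [lintegral_const_mul' _ _ ENNReal.ofReal_ne_top]
        refine le_trans (le_of_eq ?_) (hlev l hl)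
        congr 1
        rw [← lintegral_indicator_one (measurableSet_lt measurable_const hM)]
        apply lintegral_congr
        intro x
        by_cases hx : ENNReal.ofReal l < hlMax h x <;> simp [hx]
    _ = 16 * ∫⁻ y, ∫⁻ l in Set.Ioi (0 : ℝ),
          h y * Set.indicator {l | ENNReal.ofReal l < 2 * h y} 1 l := by
        rw [lintegral_const_mul' _ _ (by norm_num), lintegral_lintegral_swap hm3.aemeasurable]
    _ ≤ 16 * ∫⁻ y, h y * (2 * h y) := by
        gcongr with y
        rw [lintegral_const_mul _ ((measurable_one (α := ℝ≥0∞) (β := ℝ)).indicator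
          (measurableSet_lt (f := fun l : ℝ => ENNReal.ofReal l) ENNReal.measurable_ofReal
            measurable_const))]
        gcongr
        rw [lintegral_indicator_one (measurableSet_lt ENNReal.measurable_ofReal measurable_const),
          Measure.restrict_apply (measurableSet_lt ENNReal.measurable_ofReal measurable_const)]
        rcases eq_or_ne (2 * h y) ∞ with htop | hfin
        · rw [htop]; exact le_top
        · have : {l : ℝ | ENNReal.ofReal l < 2 * h y} ∩ Set.Ioi 0 ⊆ Set.Ioo 0 (2 * h y).toReal := by
            rintro l ⟨hl, hl0⟩
            exact ⟨hl0, (ENNReal.ofReal_lt_iff_lt_toReal (le_of_lt hl0) hfin).1 hl⟩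
          refine (measure_mono this).trans ?_
          rw [Real.volume_Ioo, sub_zero, ENNReal.ofReal_toReal hfin]
    _ = 32 * ∫⁻ x, h x ^ 2 := by
        rw [show (32 : ℝ≥0∞) = 16 * 2 by norm_num, mul_assoc,
          ← lintegral_const_mul' 2 _ (by norm_num)]
        congr 1
        apply lintegral_congr
        intro y; ring

end RealHardy

namespace RealHardy

/-! ### Tangential maximal functions -/

/-- The convolution `f * χ_t` of a function `f` with the dilate `χ_t = t⁻¹ χ (· / t)`. -/
noncomputable def cv (χ f : ℝ → ℂ) (t x : ℝ) : ℂ := ∫ y, (t : ℂ)⁻¹ * χ ((x - y) / t) * f y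

open BoundedContinuousFunction in
/-- Convolution with the dilate `χ_s` on bounded continuous functions. -/
noncomputable def avg (χ : ℝ → ℂ) (hχ : Integrable χ) (s : ℝ) : Module.End ℂ (ℝ →ᵇ ℂ) where
  toFun η := BoundedContinuousFunction.ofNormedAddCommGroup
    (fun y => ∫ w, χ w * η (y - s * w))
    (by
      refine continuous_of_dominated (bound := fun w => ‖χ w‖ * ‖η‖) ?_ ?_ ?_ ?_
      · intro y
        exact hχ.aestronglyMeasurable.mul
          (η.continuous.comp (by fun_prop : Continuous fun w => y - s * w)).aestronglyMeasurable
      · intro y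
        refine Filter.Eventually.of_forall fun w => ?_
        rw [norm_mul]
        gcongr
        exact η.norm_coe_le_norm _
      · exact hχ.norm.mul_const _
      · exact Filter.Eventually.of_forall fun w => by fun_prop)
    ((∫ w, ‖χ w‖) * ‖η‖)
    (by
      intro y
      rw [← integral_mul_const]
      refine norm_integral_le_of_norm_le (hχ.norm.mul_const _) ?_
      refine Filter.Eventually.of_forall fun w => ?_
      rw [norm_mul]
      gcongr
      exact η.norm_coe_le_norm _)
  map_add' η ξ := by
    ext y
    simp only [coe_ofNormedAddCommGroup, coe_add, Pi.add_apply, mul_add]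
    exact integral_add (hχ.mul_bdd (c := ‖η‖) (η.continuous.comp
        (by fun_prop : Continuous fun w => y - s * w)).aestronglyMeasurable
          (Filter.Eventually.of_forall fun w => η.norm_coe_le_norm _))
      (hχ.mul_bdd (c := ‖ξ‖) (ξ.continuous.comp
        (by fun_prop : Continuous fun w => y - s * w)).aestronglyMeasurable
          (Filter.Eventually.of_forall fun w => ξ.norm_coe_le_norm _))
  map_smul' c η := by
    ext y
    simp only [coe_ofNormedAddCommGroup, coe_smul, smul_eq_mul, RingHom.id_apply]
    rw [← integral_const_mul]
    congr 1; ext w; ring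

open BoundedContinuousFunction

theorem avg_apply (χ : ℝ → ℂ) (hχ : Integrable χ) (s : ℝ) (η : ℝ →ᵇ ℂ) (y : ℝ) :
    avg χ hχ s η y = ∫ w, χ w * η (y - s * w) := rfl

theorem integrable_mul_comp (χ : ℝ → ℂ) (hχ : Integrable χ) (s : ℝ) (η : ℝ →ᵇ ℂ) (y : ℝ) :
    Integrable fun w => χ w * η (y - s * w) :=
  hχ.mul_bdd (c := ‖η‖) (η.continuous.comp
    (by fun_prop : Continuous fun w => y - s * w)).aestronglyMeasurable
      (Filter.Eventually.of_forall fun w => η.norm_coe_le_norm _)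

/-- Fubini. Commutation is what allows the difference of two fourth powers to be factored in the
telescoping sum of `Tang.norm_cv_le`. -/
theorem commute_avg (χ : ℝ → ℂ) (hχ : Integrable χ) (a b : ℝ) :
    Commute (avg χ hχ a) (avg χ hχ b) := by
  rw [commute_iff_eq]
  ext η y
  simp only [Module.End.mul_apply, avg_apply, ← integral_const_mul]
  rw [integral_integral_swap]
  · congr 1; ext v
    congr 1; ext w
    rw [show y - a * w - b * v = y - b * v - a * w by ring]
    ring
  · have h1 : Integrable (fun p : ℝ × ℝ => (χ p.1 * χ p.2) * η (y - a * p.1 - b * p.2))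
        (volume.prod volume) := by
      refine (hχ.mul_prod hχ).mul_bdd (c := ‖η‖) ?_ ?_
      · exact (η.continuous.comp
          (by fun_prop : Continuous fun p : ℝ × ℝ => y - a * p.1 - b * p.2)).aestronglyMeasurable
      · exact Filter.Eventually.of_forall fun w => η.norm_coe_le_norm _
    refine h1.congr (Filter.Eventually.of_forall fun p => ?_)
    simp only [Function.uncurry]
    ring

/-- Decay of order `4` of a function and its derivatives up to order `n`. -/
def Decay4 : ℕ → ℝ → (ℝ →ᵇ ℂ) → Prop
  | 0, B, η => ∀ x, ‖η x‖ * (1 + |x|) ^ 4 ≤ B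
  | n + 1, B, η => (∀ x, ‖η x‖ * (1 + |x|) ^ 4 ≤ B) ∧
      ∃ η' : ℝ →ᵇ ℂ, (∀ x, HasDerivAt η (η' x) x) ∧ Decay4 n B η'

theorem Decay4.zero {n : ℕ} {B : ℝ} {η : ℝ →ᵇ ℂ} (h : Decay4 n B η) : Decay4 0 B η := by
  cases n with
  | zero => exact h
  | succ n => exact h.1

theorem Decay4.nonneg {n : ℕ} {B : ℝ} {η : ℝ →ᵇ ℂ} (h : Decay4 n B η) : 0 ≤ B :=
  le_trans (by positivity) (h.zero 0)

theorem Decay4.mono_order {n m : ℕ} {B : ℝ} {η : ℝ →ᵇ ℂ} (h : Decay4 n B η) (hm : m ≤ n) :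
    Decay4 m B η := by
  induction n generalizing m η with
  | zero => obtain rfl : m = 0 := by omega
            exact h
  | succ n ih =>
    cases m with
    | zero => exact h.1
    | succ m =>
      obtain ⟨h1, η', h2, h3⟩ := h
      exact ⟨h1, η', h2, ih h3 (by omega)⟩

theorem Decay4.mono {n : ℕ} {B B' : ℝ} {η : ℝ →ᵇ ℂ} (h : Decay4 n B η) (hB : B ≤ B') :
    Decay4 n B' η := by
  induction n generalizing η with
  | zero => exact fun x => (h x).trans hB
  | succ n ih =>
    obtain ⟨h1, η', h2, h3⟩ := h
    exact ⟨fun x => (h1 x).trans hB, η', h2, ih h3⟩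

theorem Decay4.add_zero {B B' : ℝ} {η ξ : ℝ →ᵇ ℂ} (h : Decay4 0 B η) (h' : Decay4 0 B' ξ) :
    Decay4 0 (B + B') (η + ξ) := by
  intro x
  have h1 := h x
  have h2 := h' x
  have h3 : ‖(η + ξ) x‖ ≤ ‖η x‖ + ‖ξ x‖ := norm_add_le _ _
  have h4 : (0 : ℝ) ≤ (1 + |x|) ^ 4 := by positivity
  nlinarith

theorem hasDerivAt_avg (χ : ℝ → ℂ) (hχ : Integrable χ) (s : ℝ) {η η' : ℝ →ᵇ ℂ}
    (h : ∀ x, HasDerivAt η (η' x) x) (x : ℝ) :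
    HasDerivAt (avg χ hχ s η) (avg χ hχ s η' x) x := by
  refine (hasDerivAt_integral_of_dominated_loc_of_deriv_le (s := Set.univ)
    (F := fun y w => χ w * η (y - s * w)) (F' := fun y w => χ w * η' (y - s * w))
    (bound := fun w => ‖χ w‖ * ‖η'‖) Filter.univ_mem ?_ ?_ ?_ ?_ ?_ ?_).2
  · exact Filter.Eventually.of_forall fun y => (integrable_mul_comp χ hχ s η y).aestronglyMeasurable
  · exact integrable_mul_comp χ hχ s η x
  · exact (integrable_mul_comp χ hχ s η' x).aestronglyMeasurable
  · refine Filter.Eventually.of_forall fun w y _ => ?_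
    rw [norm_mul]
    gcongr
    exact η'.norm_coe_le_norm _
  · exact hχ.norm.mul_const _
  · refine Filter.Eventually.of_forall fun w y _ => ?_
    have := ((h (y - s * w)).comp_sub_const y (s * w)).const_mul (χ w)
    exact this

theorem one_add_abs_le_mul (x z : ℝ) : 1 + |x| ≤ (1 + |x - z|) * (1 + |z|) := by
  have h1 : |x| ≤ |x - z| + |z| := by
    calc |x| = |(x - z) + z| := by ring_nf
      _ ≤ _ := abs_add_le _ _
  nlinarith [abs_nonneg (x - z), abs_nonneg z, mul_nonneg (abs_nonneg (x - z)) (abs_nonneg z)]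

/-- The weighted first moment controlling `η - χ_s * η`. -/
noncomputable def moment (χ : ℝ → ℂ) : ℝ := ∫ w, ‖χ w‖ * (|w| * (1 + |w|) ^ 4)

/-- As `χ` has mean one, `η - χ_s * η` is an average of increments of `η` over distances `s |w|`.
The mean value inequality gains the factor `s`, and the weight moves from `x` to the intermediate
point at the cost of `(1 + |w|) ^ 4`, absorbed by the moment. -/
theorem decay_sub_avg_zero (χ : ℝ → ℂ) (hχ : Integrable χ) (h1 : ∫ w, χ w = 1)
    (hm : Integrable fun w => ‖χ w‖ * (|w| * (1 + |w|) ^ 4)) {s : ℝ} (hs : 0 < s) (hs1 : s ≤ 1)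
    {B : ℝ} {η η' : ℝ →ᵇ ℂ} (h : ∀ x, HasDerivAt η (η' x) x) (h' : Decay4 0 B η') :
    Decay4 0 (moment χ * s * B) ((1 - avg χ hχ s) η) := by
  intro x
  have hB := h'.nonneg
  have hx : 0 < (1 + |x|) ^ 4 := by positivity
  rw [← le_div_iff₀ hx]
  have e1 : ((1 - avg χ hχ s) η) x = ∫ w, χ w * (η x - η (x - s * w)) := by
    rw [LinearMap.sub_apply, BoundedContinuousFunction.sub_apply, Module.End.one_apply, avg_apply]
    simp_rw [mul_sub]
    rw [integral_sub (hχ.mul_const _) (integrable_mul_comp χ hχ s η x), integral_mul_const, h1,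
      one_mul]
  rw [e1]
  have e2 : moment χ * s * B / (1 + |x|) ^ 4 =
      ∫ w, ‖χ w‖ * (|w| * (1 + |w|) ^ 4) * (s * B / (1 + |x|) ^ 4) := by
    rw [integral_mul_const, moment]; ring
  rw [e2]
  refine norm_integral_le_of_norm_le (hm.mul_const _) (Filter.Eventually.of_forall fun w => ?_)
  rw [norm_mul, mul_assoc]
  refine mul_le_mul_of_nonneg_left ?_ (norm_nonneg _)
  have hlip : ∀ q ∈ segment ℝ (x - s * w) x, ‖η' q‖ ≤ B * (1 + |w|) ^ 4 / (1 + |x|) ^ 4 := by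
    intro q hq
    have hd : |x - q| ≤ |w| := by
      have h3 : |q - x| ≤ |(x - s * w) - x| := by
        have := segment_subset_closedBall_right (x - s * w) x hq
        simpa [Real.dist_eq] using this
      rw [abs_sub_comm]
      refine h3.trans ?_
      rw [show x - s * w - x = - (s * w) by ring, abs_neg, abs_mul, abs_of_pos hs]
      nlinarith [abs_nonneg w]
    have h4 : 1 + |x| ≤ (1 + |q|) * (1 + |w|) := by
      have := one_add_abs_le_mul x (x - q)
      rw [sub_sub_cancel] at this
      refine this.trans ?_
      gcongr
    rw [le_div_iff₀ hx]
    have h5 : (1 + |x|) ^ 4 ≤ (1 + |q|) ^ 4 * (1 + |w|) ^ 4 := by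
      rw [← mul_pow]; gcongr
    calc ‖η' q‖ * (1 + |x|) ^ 4 ≤ ‖η' q‖ * ((1 + |q|) ^ 4 * (1 + |w|) ^ 4) := by gcongr
      _ = (‖η' q‖ * (1 + |q|) ^ 4) * (1 + |w|) ^ 4 := by ring
      _ ≤ B * (1 + |w|) ^ 4 := by gcongr; exact h' q
  have := (convex_segment (x - s * w) x).norm_image_sub_le_of_norm_hasDerivWithin_le
    (fun q hq => (h q).hasDerivWithinAt) hlip (left_mem_segment ℝ _ _) (right_mem_segment ℝ _ _)
  refine this.trans (le_of_eq ?_)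
  rw [sub_sub_cancel, Real.norm_eq_abs, abs_mul, abs_of_pos hs]
  ring

/-- Averaging commutes with differentiation, so the estimate of order zero applies to every
derivative. One derivative is spent for each factor `s`. -/
theorem decay_sub_avg (χ : ℝ → ℂ) (hχ : Integrable χ) (h1 : ∫ w, χ w = 1)
    (hm : Integrable fun w => ‖χ w‖ * (|w| * (1 + |w|) ^ 4)) {s : ℝ} (hs : 0 < s) (hs1 : s ≤ 1)
    {n : ℕ} {B : ℝ} {η : ℝ →ᵇ ℂ} (h : Decay4 (n + 1) B η) :
    Decay4 n (moment χ * s * B) ((1 - avg χ hχ s) η) := by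
  induction n generalizing η with
  | zero =>
    obtain ⟨-, η', h2, h3⟩ := h
    exact decay_sub_avg_zero χ hχ h1 hm hs hs1 h2 h3
  | succ n ih =>
    obtain ⟨-, η', h2, h3⟩ := h
    refine ⟨decay_sub_avg_zero χ hχ h1 hm hs hs1 h2 h3.zero, (1 - avg χ hχ s) η', fun x => ?_,
      ih h3⟩
    exact (h2 x).sub (hasDerivAt_avg χ hχ s h2 x)

theorem moment_nonneg (χ : ℝ → ℂ) : 0 ≤ moment χ :=
  integral_nonneg fun w => by positivity

theorem decay_sub_avg_pow (χ : ℝ → ℂ) (hχ : Integrable χ) (h1 : ∫ w, χ w = 1)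
    (hm : Integrable fun w => ‖χ w‖ * (|w| * (1 + |w|) ^ 4)) {s : ℝ} (hs : 0 < s) (hs1 : s ≤ 1)
    {n i : ℕ} {B : ℝ} {η : ℝ →ᵇ ℂ} (h : Decay4 (n + i) B η) :
    Decay4 n ((moment χ * s) ^ i * B) (((1 - avg χ hχ s) ^ i) η) := by
  induction i generalizing n with
  | zero => simpa using h
  | succ i ih =>
    rw [pow_succ' (moment χ * s), pow_succ' (1 - avg χ hχ s), Module.End.mul_apply, mul_assoc]
    exact decay_sub_avg χ hχ h1 hm hs hs1 (ih (n := n + 1) (by convert h using 1; ring))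

/-! ### Reproducing formula -/

theorem cv_integrable {η : ℝ → ℂ} (hη : Continuous η) {D : ℝ} (hD : ∀ x, ‖η x‖ ≤ D) {f : ℝ → ℂ}
    (hf : Integrable f) (t y : ℝ) :
    Integrable fun p => (t : ℂ)⁻¹ * η ((y - p) / t) * f p := by
  refine hf.bdd_mul (c := ‖(t : ℂ)⁻¹‖ * D) ?_ ?_
  · exact (by fun_prop : Continuous fun p => (t : ℂ)⁻¹ * η ((y - p) / t)).aestronglyMeasurable
  · refine Filter.Eventually.of_forall fun p => ?_
    rw [norm_mul]; gcongr; exact hD _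

/-- `η ↦ (f * η_t)(y)` as a linear functional. -/
noncomputable def cvL {f : ℝ → ℂ} (hf : Integrable f) (t y : ℝ) : (ℝ →ᵇ ℂ) →ₗ[ℂ] ℂ where
  toFun η := cv η f t y
  map_add' η ξ := by
    simp only [cv, coe_add, Pi.add_apply, mul_add, add_mul]
    exact integral_add (cv_integrable η.continuous η.norm_coe_le_norm hf t y)
      (cv_integrable ξ.continuous ξ.norm_coe_le_norm hf t y)
  map_smul' c η := by
    simp only [cv, coe_smul, smul_eq_mul, RingHom.id_apply]
    rw [← integral_const_mul]
    congr 1; ext w; ring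

theorem norm_cv_le {η : ℝ → ℂ} {D : ℝ} (hD : ∀ x, ‖η x‖ ≤ D) {f : ℝ → ℂ}
    (hf : Integrable f) {t : ℝ} (ht : 0 < t) (y : ℝ) : ‖cv η f t y‖ ≤ t⁻¹ * D * ∫ p, ‖f p‖ := by
  rw [← integral_const_mul]
  refine norm_integral_le_of_norm_le (hf.norm.const_mul _) (Filter.Eventually.of_forall fun p => ?_)
  rw [norm_mul, norm_mul, norm_inv, Complex.norm_real, Real.norm_of_nonneg ht.le]
  gcongr
  exact hD _

theorem Decay4.norm_le {B : ℝ} {η : ℝ →ᵇ ℂ} (h : Decay4 0 B η) (x : ℝ) : ‖η x‖ ≤ B := by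
  have h1 := h x
  have h2 : (1 : ℝ) ≤ (1 + |x|) ^ 4 := one_le_pow₀ (by linarith [abs_nonneg x])
  nlinarith [norm_nonneg (η x)]

theorem Decay4.norm_mul_sq_le {B : ℝ} {η : ℝ →ᵇ ℂ} (h : Decay4 0 B η) (x : ℝ) :
    ‖η x‖ * (1 + |x|) ^ 2 ≤ B * (1 + x ^ 2)⁻¹ := by
  have h1 := h x
  rw [← div_eq_mul_inv, le_div_iff₀ (by positivity)]
  refine le_trans ?_ h1
  have h2 : 1 + x ^ 2 ≤ (1 + |x|) ^ 2 := by nlinarith [abs_nonneg x, sq_abs x]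
  calc ‖η x‖ * (1 + |x|) ^ 2 * (1 + x ^ 2) ≤ ‖η x‖ * (1 + |x|) ^ 2 * (1 + |x|) ^ 2 := by gcongr
    _ = _ := by ring

theorem Decay4.integrable {B : ℝ} {η : ℝ →ᵇ ℂ} (h : Decay4 0 B η) : Integrable η := by
  refine (integrable_inv_one_add_sq.const_mul B).mono' η.continuous.aestronglyMeasurable
    (Filter.Eventually.of_forall fun x => ?_)
  have h1 := h.norm_mul_sq_le x
  have h2 : (1 : ℝ) ≤ (1 + |x|) ^ 2 := one_le_pow₀ (by linarith [abs_nonneg x])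
  nlinarith [norm_nonneg (η x)]

/-- Associativity of convolution together with `(χ_s)_t = χ_{st}`: testing against an averaged
kernel only involves `f * χ` at the finer scale `s t`. -/
theorem cv_avg (χ : ℝ → ℂ) (hχ : Integrable χ) (hχc : Continuous χ) {K : ℝ} (hK : ∀ x, ‖χ x‖ ≤ K)
    {f : ℝ → ℂ} (hf : Integrable f) {η : ℝ →ᵇ ℂ} (hη : Integrable η) {s t : ℝ} (hs : 0 < s)
    (ht : 0 < t) (y : ℝ) :
    cv (avg χ hχ s η) f t y = ∫ z, η z * cv χ f (s * t) (y - t * z) := by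
  have e1 : ∀ q, avg χ hχ s η q = ∫ z, (s : ℂ)⁻¹ * χ ((q - z) / s) * η z := by
    intro q
    rw [avg_apply]
    have := Measure.integral_comp_mul_left (fun w => χ (w / s) * η (q - w)) s
    simp only [mul_div_cancel_left₀ _ hs.ne'] at this
    rw [this, ← integral_sub_left_eq_self _ volume q, ← integral_smul]
    congr 1; ext z
    rw [abs_of_pos (inv_pos.2 hs), sub_sub_cancel, Complex.real_smul]
    push_cast; ring
  simp only [cv, e1, ← integral_const_mul, ← integral_mul_const]
  rw [integral_integral_swap]
  · congr 1; ext z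
    congr 1; ext p
    have hne : (s : ℂ) ≠ 0 := by exact_mod_cast hs.ne'
    have hne' : (t : ℂ) ≠ 0 := by exact_mod_cast ht.ne'
    rw [show ((y - p) / t - z) / s = (y - t * z - p) / (s * t) by field_simp; ring]
    push_cast
    rw [mul_inv]
    ring
  · have h1 : Integrable (fun p : ℝ × ℝ => (f p.1 * η p.2) *
        ((t : ℂ)⁻¹ * (s : ℂ)⁻¹ * χ (((y - p.1) / t - p.2) / s))) (volume.prod volume) := by
      refine (hf.mul_prod hη).mul_bdd (c := ‖(t : ℂ)⁻¹ * (s : ℂ)⁻¹‖ * K) ?_ ?_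
      · exact (by fun_prop : Continuous fun p : ℝ × ℝ =>
          (t : ℂ)⁻¹ * (s : ℂ)⁻¹ * χ (((y - p.1) / t - p.2) / s)).aestronglyMeasurable
      · refine Filter.Eventually.of_forall fun p => ?_
        rw [norm_mul]; gcongr; exact hK _
    refine h1.congr (Filter.Eventually.of_forall fun p => ?_)
    simp only [Function.uncurry]
    ring

/-- The tangential maximal function of order `2` of `f` at `x` is at most `B`. -/
def Tang (χ f : ℝ → ℂ) (x B : ℝ) : Prop :=
  ∀ t : ℝ, 0 < t → ∀ y, ‖cv χ f t y‖ ≤ B * (1 + |x - y| / t) ^ 2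

theorem Tang.nonneg {χ f : ℝ → ℂ} {x B : ℝ} (h : Tang χ f x B) : 0 ≤ B := by
  have := h 1 one_pos x
  simp only [sub_self, abs_zero, zero_div, add_zero, one_pow, mul_one] at this
  exact (norm_nonneg _).trans this

/-- The hypothesis is used at scale `s t`, where the quadratic tangential weight grows by at most
`s⁻²`. The remaining weight `(1 + |z|) ^ 2` is integrated against `η`, which decays to order 4, and
this produces the factor `π`. -/
theorem Tang.norm_cv_avg_le {χ : ℝ → ℂ} {hχ : Integrable χ} (hχc : Continuous χ) {K : ℝ}
    (hK : ∀ x, ‖χ x‖ ≤ K) {f : ℝ → ℂ} (hf : Integrable f) {x B : ℝ} (h : Tang χ f x B)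
    {D : ℝ} {η : ℝ →ᵇ ℂ} (hη : Decay4 0 D η) {s t : ℝ} (hs : 0 < s) (hs1 : s ≤ 1) (ht : 0 < t)
    (y : ℝ) :
    ‖cv (avg χ hχ s η) f t y‖ ≤ Real.pi * D * (s⁻¹) ^ 2 * (B * (1 + |x - y| / t) ^ 2) := by
  rw [cv_avg χ hχ hχc hK hf hη.integrable hs ht y]
  have hB := h.nonneg
  have e : Real.pi * D * (s⁻¹) ^ 2 * (B * (1 + |x - y| / t) ^ 2)
      = ∫ z : ℝ, D * (1 + z ^ 2)⁻¹ * ((s⁻¹) ^ 2 * (B * (1 + |x - y| / t) ^ 2)) := by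
    rw [integral_mul_const, integral_const_mul, integral_univ_inv_one_add_sq]; ring
  rw [e]
  refine norm_integral_le_of_norm_le ((integrable_inv_one_add_sq.const_mul D).mul_const _)
    (Filter.Eventually.of_forall fun z => ?_)
  rw [norm_mul]
  have h1 := h (s * t) (by positivity) (y - t * z)
  have h2 : 1 + |x - (y - t * z)| / (s * t) ≤ s⁻¹ * (1 + |x - y| / t) * (1 + |z|) := by
    have h3 : |x - (y - t * z)| ≤ |x - y| + t * |z| := by
      calc |x - (y - t * z)| = |(x - y) + t * z| := by ring_nf
        _ ≤ _ := by refine (abs_add_le _ _).trans ?_; rw [abs_mul, abs_of_pos ht]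
    have h4 : 1 ≤ s⁻¹ := (one_le_inv₀ hs).2 hs1
    have h5 : |x - (y - t * z)| / (s * t) ≤ s⁻¹ * (|x - y| / t + |z|) := by
      rw [div_le_iff₀ (by positivity)]
      refine h3.trans (le_of_eq ?_)
      field_simp
    have h6 : 0 ≤ |x - y| / t * |z| := by positivity
    have h7 : 0 ≤ s⁻¹ := by positivity
    nlinarith
  calc ‖η z‖ * ‖cv χ f (s * t) (y - t * z)‖
      ≤ ‖η z‖ * (B * (s⁻¹ * (1 + |x - y| / t) * (1 + |z|)) ^ 2) := by
        gcongr
        refine h1.trans ?_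
        gcongr
    _ = (‖η z‖ * (1 + |z|) ^ 2) * ((s⁻¹) ^ 2 * (B * (1 + |x - y| / t) ^ 2)) := by ring
    _ ≤ _ := mul_le_mul_of_nonneg_right (hη.norm_mul_sq_le z) (by positivity)

end RealHardy

/-! ### Control of general kernels by the tangential maximal function. -/

namespace RealHardy

open BoundedContinuousFunction Filter Topology

/-- Let `A k` average at scale `s k = 2⁻ᵏ` and `T k = 1 - A k`. Then `Φ` is `(1 - T 0 ^ 4) Φ` plus
the telescoping sum of `(T k ^ 4 - T (k + 1) ^ 4) Φ`, and each piece contains a factor `A`. In the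
sum, three further factors `T` gain `s k ^ 3` while `A` costs `s k ^ (-2)`, so the series converges
geometrically. This is where weight 2 and three derivatives fit together. -/
theorem Tang.norm_cv_le {χ : ℝ → ℂ} (hχ : Integrable χ) (hχc : Continuous χ) (h1 : ∫ w, χ w = 1)
    (hm : Integrable fun w => ‖χ w‖ * (|w| * (1 + |w|) ^ 4)) {K : ℝ}
    (hK : ∀ x, ‖χ x‖ ≤ K) {f : ℝ → ℂ} (hf : Integrable f) {x B : ℝ} (h : Tang χ f x B)
    {D : ℝ} {Φ : ℝ →ᵇ ℂ} (hΦ : Decay4 3 D Φ) {t : ℝ} (ht : 0 < t) (y : ℝ) :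
    ‖cv Φ f t y‖ ≤ 44 * Real.pi * (1 + moment χ) ^ 3 * D * (B * (1 + |x - y| / t) ^ 2) := by
  set c := moment χ with hc
  have hc0 : 0 ≤ c := moment_nonneg χ
  have hD := hΦ.nonneg
  set X := B * (1 + |x - y| / t) ^ 2 with hX
  have hX0 : 0 ≤ X := by have := h.nonneg; positivity
  set ℓ := cvL hf t y with hℓ
  set s : ℕ → ℝ := fun k => (2⁻¹ : ℝ) ^ k with hs
  have hs0 : ∀ k, 0 < s k := fun k => by positivity
  have hs1 : ∀ k, s k ≤ 1 := fun k => pow_le_one₀ (by norm_num) (by norm_num)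
  have hss : ∀ k, s (k + 1) = s k / 2 := fun k => by simp only [hs, pow_succ]; ring
  set A : ℕ → Module.End ℂ (ℝ →ᵇ ℂ) := fun k => avg χ hχ (s k) with hA
  set T : ℕ → Module.End ℂ (ℝ →ᵇ ℂ) := fun k => 1 - A k with hT
  have hest : ∀ k (η : ℝ →ᵇ ℂ) (E : ℝ), Decay4 0 E η →
      ‖ℓ (A k η)‖ ≤ Real.pi * E * ((s k)⁻¹) ^ 2 * X := fun k η E hE =>
    h.norm_cv_avg_le hχc hK hf hE (hs0 k) (hs1 k) ht y
  have hpow : ∀ k n i (η : ℝ →ᵇ ℂ) (E : ℝ), Decay4 (n + i) E η →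
      Decay4 n ((c * s k) ^ i * E) ((T k ^ i) η) := fun k n i η E hE =>
    decay_sub_avg_pow χ hχ h1 hm (hs0 k) (hs1 k) hE
  -- the first term
  have hfirst : ‖ℓ Φ - ℓ ((T 0 ^ 4) Φ)‖ ≤ 4 * Real.pi * (1 + c) ^ 3 * D * X := by
    have e : Φ - (T 0 ^ 4) Φ = A 0 Φ + A 0 ((T 0 ^ 1) Φ) + A 0 ((T 0 ^ 2) Φ)
        + A 0 ((T 0 ^ 3) Φ) := by
      have : (1 : Module.End ℂ (ℝ →ᵇ ℂ)) - T 0 ^ 4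
          = A 0 * (1 + T 0 ^ 1 + T 0 ^ 2 + T 0 ^ 3) := by
        have : A 0 = 1 - T 0 := by simp [hT]
        rw [this, ← mul_neg_geom_sum (T 0) 4]
        simp [Finset.sum_range_succ]
      have h2 := congrArg (fun L => L Φ) this
      simpa [mul_add] using h2
    rw [← map_sub, e, map_add, map_add, map_add]
    have key : ∀ i ≤ 3, ‖ℓ (A 0 ((T 0 ^ i) Φ))‖ ≤ Real.pi * ((1 + c) ^ 3 * D) * X := by
      intro i hi
      have h2 := hest 0 _ _ (hpow 0 0 i Φ D (hΦ.mono_order (by omega)))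
      refine h2.trans ?_
      simp only [hs, pow_zero, inv_one, one_pow, mul_one]
      have : c ^ i ≤ (1 + c) ^ 3 :=
        (pow_le_pow_left₀ hc0 (by linarith) i).trans (pow_le_pow_right₀ (by linarith) hi)
      gcongr
    have k0 := key 0 (by norm_num)
    rw [pow_zero, Module.End.one_apply] at k0
    have := key 1 (by norm_num)
    have := key 2 (by norm_num)
    have := key 3 (by norm_num)
    refine (norm_add_le _ _).trans ((add_le_add_left ((norm_add_le _ _).trans
      (add_le_add_left (norm_add_le _ _) _)) _).trans ?_)
    linarith
  -- the telescoping terms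
  have htel : ∀ k, ‖ℓ ((T k ^ 4) Φ) - ℓ ((T (k + 1) ^ 4) Φ)‖ ≤ 20 * Real.pi * (1 + c) ^ 3 * D * X * s k := by
    intro k
    set η : ℝ →ᵇ ℂ := ∑ i ∈ Finset.range 4, (T k ^ i * T (k + 1) ^ (4 - 1 - i)) Φ with hη
    have hcomm : Commute (T k) (T (k + 1)) := by
      have := commute_avg χ hχ (s k) (s (k + 1))
      exact ((Commute.one_left _).sub_left ((Commute.one_right _).sub_right this))
    -- For commuting operators a difference of fourth powers is `T k - T (k + 1) = A (k + 1) - A k`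
    -- applied to a sum of mixed products of total degree 3.
    have e : (T k ^ 4) Φ - (T (k + 1) ^ 4) Φ = A (k + 1) η - A k η := by
      have h2 := congrArg (fun L => L Φ) (hcomm.mul_geom_sum₂ 4)
      simp only [LinearMap.sub_apply, Module.End.mul_apply] at h2
      rw [← h2, LinearMap.sum_apply, ← hη]
      simp only [hT, LinearMap.sub_apply, Module.End.one_apply]
      abel
    have hterm : ∀ i ≤ 3, Decay4 0 ((c * s k) ^ 3 * D) ((T k ^ i * T (k + 1) ^ (4 - 1 - i)) Φ) := by
      intro i hi
      have h2 := hpow (k + 1) i (4 - 1 - i) Φ D (hΦ.mono_order (by omega))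
      have h3 := hpow k 0 i _ _ (h2.mono_order (by omega))
      rw [Module.End.mul_apply]
      refine h3.mono ?_
      have : (c * s (k + 1)) ^ (4 - 1 - i) ≤ (c * s k) ^ (4 - 1 - i) := by
        apply pow_le_pow_left₀ (by have := hs0 (k + 1); positivity)
        rw [hss]; have := hs0 k; nlinarith
      calc (c * s k) ^ i * ((c * s (k + 1)) ^ (4 - 1 - i) * D)
          ≤ (c * s k) ^ i * ((c * s k) ^ (4 - 1 - i) * D) := by
            have := hs0 k
            gcongr
        _ = (c * s k) ^ 3 * D := by
            rw [← mul_assoc, ← pow_add]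
            congr 2; omega
    have hη' : Decay4 0 (4 * ((c * s k) ^ 3 * D)) η := by
      rw [hη, Finset.sum_range_succ, Finset.sum_range_succ, Finset.sum_range_succ,
        Finset.sum_range_one]
      refine ((((hterm 0 (by norm_num)).add_zero (hterm 1 (by norm_num))).add_zero
        (hterm 2 (by norm_num))).add_zero (hterm 3 (by norm_num))).mono (le_of_eq (by ring))
    rw [← map_sub, e, map_sub]
    -- The four mixed products contribute 4; halving the scale in the first term multiplies it by 4,
    -- so the total is 16 + 4 = 20.
    refine (norm_sub_le _ _).trans ((add_le_add (hest _ _ _ hη') (hest _ _ _ hη')).trans ?_)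
    have hsk := hs0 k
    have : Real.pi * (4 * ((c * s k) ^ 3 * D)) * (s (k + 1))⁻¹ ^ 2 * X +
        Real.pi * (4 * ((c * s k) ^ 3 * D)) * (s k)⁻¹ ^ 2 * X
        = 20 * Real.pi * c ^ 3 * D * X * s k := by
      rw [hss]; field_simp; ring
    rw [this]
    gcongr
    linarith
  -- the remainder
  have hlast : Tendsto (fun k => ℓ ((T k ^ 4) Φ)) atTop (𝓝 0) := by
    rw [tendsto_zero_iff_norm_tendsto_zero]
    have hlim : Tendsto s atTop (𝓝 0) :=
      tendsto_pow_atTop_nhds_zero_of_lt_one (by norm_num) (by norm_num)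
    have hlim2 : Tendsto (fun k => t⁻¹ * ((c * s k) ^ 3 * D) * (∫ p, ‖f p‖) +
        Real.pi * c ^ 3 * D * X * s k) atTop (𝓝 0) := by
      have : Tendsto (fun k => t⁻¹ * ((c * s k) ^ 3 * D) * (∫ p, ‖f p‖) +
        Real.pi * c ^ 3 * D * X * s k) atTop (𝓝 (t⁻¹ * ((c * 0) ^ 3 * D) * (∫ p, ‖f p‖) +
        Real.pi * c ^ 3 * D * X * 0)) := by
        refine Tendsto.add (Tendsto.mul_const _ (Tendsto.const_mul _ (Tendsto.mul_const _
          ((hlim.const_mul c).pow 3)))) (hlim.const_mul _)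
      simpa using this
    refine squeeze_zero (fun k => norm_nonneg _) (fun k => ?_) hlim2
    have h3 := hpow k 0 3 Φ D hΦ
    -- Only three derivatives are available, so the fourth `T` is expanded: the first term is small
    -- in sup norm, of order `s k ^ 3`, and the second is of order `s k ^ 3 * s k ^ (-2)`.
    have e : (T k ^ 4) Φ = (T k ^ 3) Φ - A k ((T k ^ 3) Φ) := by
      rw [pow_succ', Module.End.mul_apply]
      simp [hT]
    rw [e, map_sub]
    refine (norm_sub_le _ _).trans (add_le_add ?_ ?_)
    · exact RealHardy.norm_cv_le h3.norm_le hf ht y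
    · refine (hest k _ _ h3).trans (le_of_eq ?_)
      have hsk := hs0 k
      field_simp
  have hsum : ∀ n, ‖ℓ ((T 0 ^ 4) Φ) - ℓ ((T n ^ 4) Φ)‖ ≤
      20 * Real.pi * (1 + c) ^ 3 * D * X * (2 - 2 * s n) := by
    intro n
    induction n with
    | zero => simp [hs]
    | succ n ih =>
      have := htel n
      have h2 : ‖ℓ ((T 0 ^ 4) Φ) - ℓ ((T (n + 1) ^ 4) Φ)‖ ≤ ‖ℓ ((T 0 ^ 4) Φ) - ℓ ((T n ^ 4) Φ)‖
          + ‖ℓ ((T n ^ 4) Φ) - ℓ ((T (n + 1) ^ 4) Φ)‖ := norm_sub_le_norm_sub_add_norm_sub _ _ _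
      refine h2.trans ((add_le_add ih this).trans (le_of_eq ?_))
      rw [hss]; ring
  have hfin : ‖ℓ ((T 0 ^ 4) Φ) - 0‖ ≤ 40 * Real.pi * (1 + c) ^ 3 * D * X := by
    refine le_of_tendsto ((tendsto_const_nhds.sub hlast).norm) (Eventually.of_forall fun n => ?_)
    refine (hsum n).trans ?_
    have : 0 ≤ Real.pi * (1 + c) ^ 3 * D * X * s n := by have := hs0 n; positivity
    nlinarith
  rw [sub_zero] at hfin
  calc ‖ℓ Φ‖ = ‖(ℓ Φ - ℓ ((T 0 ^ 4) Φ)) + ℓ ((T 0 ^ 4) Φ)‖ := by rw [sub_add_cancel]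
    _ ≤ 4 * Real.pi * (1 + c) ^ 3 * D * X + 40 * Real.pi * (1 + c) ^ 3 * D * X :=
        (norm_add_le _ _).trans (add_le_add hfirst hfin)
    _ = _ := by ring

end RealHardy

/-! ### Kernels with decay, and the Fefferman-Stein comparison of maximal functions. -/

namespace RealHardy

open BoundedContinuousFunction Filter Topology

theorem exists_decay4_schwartz (n : ℕ) (g : 𝓢(ℝ, ℂ)) :
    ∃ D, Decay4 n D g.toBoundedContinuousFunction := by
  have hz : ∀ g : 𝓢(ℝ, ℂ), ∃ D, Decay4 0 D g.toBoundedContinuousFunction := by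
    intro g
    refine ⟨2 ^ 4 * (Finset.Iic (4, 0)).sup (fun m => SchwartzMap.seminorm ℝ m.1 m.2) g,
      fun x => ?_⟩
    have := one_add_le_sup_seminorm_apply (𝕜 := ℝ) (m := (4, 0)) (k := 4) (n := 0) le_rfl le_rfl g x
    rw [norm_iteratedFDeriv_zero, Real.norm_eq_abs, mul_comm] at this
    exact this
  induction n generalizing g with
  | zero => exact hz g
  | succ n ih =>
    obtain ⟨D, hD⟩ := hz g
    obtain ⟨D', hD'⟩ := ih (derivCLM ℝ ℂ g)
    refine ⟨max D D', fun x => (hD x).trans (le_max_left _ _),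
      (derivCLM ℝ ℂ g).toBoundedContinuousFunction, fun x => ?_, hD'.mono (le_max_right _ _)⟩
    exact g.hasDerivAt x

theorem exists_poly_gauss_bound (P : Polynomial ℝ) :
    ∃ C, ∀ x : ℝ, |P.eval x * Real.exp (-x ^ 2)| * (1 + |x|) ^ 4 ≤ C := by
  have hP : ∃ C, ∃ n : ℕ, 0 ≤ C ∧ ∀ x : ℝ, |P.eval x| ≤ C * (1 + |x|) ^ n := by
    induction P using Polynomial.induction_on' with
    | add p q hp hq =>
      obtain ⟨C, n, hC, h⟩ := hp
      obtain ⟨C', n', hC', h'⟩ := hq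
      refine ⟨C + C', max n n', by positivity, fun x => ?_⟩
      have hx : 1 ≤ 1 + |x| := by linarith [abs_nonneg x]
      rw [Polynomial.eval_add, add_mul]
      refine (abs_add_le _ _).trans (add_le_add ((h x).trans ?_) ((h' x).trans ?_))
      · gcongr; exact le_max_left _ _
      · gcongr; exact le_max_right _ _
    | monomial n a =>
      refine ⟨|a|, n, abs_nonneg _, fun x => ?_⟩
      rw [Polynomial.eval_monomial, abs_mul, abs_pow]
      gcongr
      linarith
  obtain ⟨C, n, hC, h⟩ := hP
  refine ⟨C * (2 ^ (n + 4) * ((n + 4).factorial * Real.exp 1)), fun x => ?_⟩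
  have hx : 1 ≤ 1 + |x| := by linarith [abs_nonneg x]
  have h1 : (1 + |x|) ^ (n + 4) ≤ 2 ^ (n + 4) * (1 + x ^ 2) ^ (n + 4) := by
    rw [← mul_pow]
    apply pow_le_pow_left₀ (by positivity)
    nlinarith [sq_nonneg (|x| - 1), sq_abs x]
  have h2 : (1 + x ^ 2) ^ (n + 4) ≤ (n + 4).factorial * Real.exp (1 + x ^ 2) := by
    have := Real.pow_div_factorial_le_exp (1 + x ^ 2) (by positivity) (n + 4)
    rw [div_le_iff₀ (by positivity)] at this
    linarith
  rw [abs_mul, abs_of_pos (Real.exp_pos _)]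
  calc |P.eval x| * Real.exp (-x ^ 2) * (1 + |x|) ^ 4
      ≤ (C * (1 + |x|) ^ n) * Real.exp (-x ^ 2) * (1 + |x|) ^ 4 := by gcongr; exact h x
    _ = C * ((1 + |x|) ^ (n + 4) * Real.exp (-x ^ 2)) := by ring
    _ ≤ C * ((2 ^ (n + 4) * ((n + 4).factorial * Real.exp (1 + x ^ 2))) * Real.exp (-x ^ 2)) := by
        gcongr
        exact h1.trans (by gcongr)
    _ = _ := by
        rw [mul_assoc, mul_assoc ((n + 4).factorial : ℝ), ← Real.exp_add]
        ring_nf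

/-- Only the pure Gaussian is used later; polynomial factors are admitted because differentiation
turns `P` into `P' - 2 X P`, which makes the induction close. -/
theorem exists_decay4_poly_gauss (n : ℕ) (P : Polynomial ℝ) :
    ∃ (D : ℝ) (η : ℝ →ᵇ ℂ), (∀ x, η x = ((P.eval x * Real.exp (-x ^ 2) : ℝ) : ℂ)) ∧
      Decay4 n D η := by
  have hz : ∀ P : Polynomial ℝ, ∃ (D : ℝ) (η : ℝ →ᵇ ℂ),
      (∀ x, η x = ((P.eval x * Real.exp (-x ^ 2) : ℝ) : ℂ)) ∧ Decay4 0 D η := by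
    intro P
    obtain ⟨C, hC⟩ := exists_poly_gauss_bound P
    have hC' : ∀ x : ℝ, ‖((P.eval x * Real.exp (-x ^ 2) : ℝ) : ℂ)‖ ≤ C := by
      intro x
      rw [Complex.norm_real, Real.norm_eq_abs]
      have h2 : (1 : ℝ) ≤ (1 + |x|) ^ 4 := one_le_pow₀ (by linarith [abs_nonneg x])
      have := hC x
      nlinarith [abs_nonneg (P.eval x * Real.exp (-x ^ 2))]
    refine ⟨C, BoundedContinuousFunction.ofNormedAddCommGroup
      (fun x => ((P.eval x * Real.exp (-x ^ 2) : ℝ) : ℂ)) (by fun_prop) C hC', fun x => rfl,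
      fun x => ?_⟩
    have := hC x
    rwa [← Real.norm_eq_abs, ← Complex.norm_real] at this
  induction n generalizing P with
  | zero => exact hz P
  | succ n ih =>
    obtain ⟨D, η, h1, h2⟩ := hz P
    obtain ⟨D', η', h1', h2'⟩ := ih (P.derivative - 2 * Polynomial.X * P)
    refine ⟨max D D', η, h1, fun x => (h2 x).trans (le_max_left _ _), η', fun x => ?_,
      h2'.mono (le_max_right _ _)⟩
    have e : (η : ℝ → ℂ) = fun x => ((P.eval x * Real.exp (-x ^ 2) : ℝ) : ℂ) := funext h1
    rw [e, h1']
    refine HasDerivAt.ofReal_comp ?_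
    have h3 := (P.hasDerivAt x).mul (((hasDerivAt_id x).pow 2).neg.exp)
    refine h3.congr_deriv ?_
    simp
    ring

/-! ### From the vertical to the tangential maximal function -/

/-- The vertical maximal function of `f` with respect to `χ`. -/
noncomputable def vmax (χ f : ℝ → ℂ) (x : ℝ) : ℝ≥0∞ := ⨆ t : Set.Ioi (0 : ℝ), ‖cv χ f t x‖ₑ

theorem hasDerivAt_cv {χ χ' : ℝ →ᵇ ℂ} (h : ∀ x, HasDerivAt χ (χ' x) x) {f : ℝ → ℂ}
    (hf : Integrable f) {t : ℝ} (y : ℝ) :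
    HasDerivAt (fun y => cv χ f t y) ((t : ℂ)⁻¹ * cv χ' f t y) y := by
  have e : (t : ℂ)⁻¹ * cv χ' f t y
      = ∫ p, (t : ℂ)⁻¹ * ((t : ℂ)⁻¹ * χ' ((y - p) / t)) * f p := by
    rw [cv, ← integral_const_mul]; congr 1; ext p; ring
  rw [e]
  refine (hasDerivAt_integral_of_dominated_loc_of_deriv_le (s := Set.univ)
    (F := fun y p => (t : ℂ)⁻¹ * χ ((y - p) / t) * f p)
    (F' := fun y p => (t : ℂ)⁻¹ * ((t : ℂ)⁻¹ * χ' ((y - p) / t)) * f p)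
    (bound := fun p => ‖(t : ℂ)⁻¹‖ * (‖(t : ℂ)⁻¹‖ * ‖χ'‖) * ‖f p‖) Filter.univ_mem ?_ ?_ ?_ ?_ ?_ ?_).2
  · exact Eventually.of_forall fun y =>
      (cv_integrable χ.continuous χ.norm_coe_le_norm hf t y).aestronglyMeasurable
  · exact cv_integrable χ.continuous χ.norm_coe_le_norm hf t y
  · exact (by fun_prop : Continuous fun p => (t : ℂ)⁻¹ * ((t : ℂ)⁻¹ * χ' ((y - p) / t))
      ).aestronglyMeasurable.mul hf.aestronglyMeasurable
  · refine Eventually.of_forall fun p y _ => ?_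
    rw [norm_mul, norm_mul, norm_mul]
    gcongr
    exact χ'.norm_coe_le_norm _
  · exact hf.norm.const_mul _
  · refine Eventually.of_forall fun p y _ => ?_
    have h2 : HasDerivAt (fun y : ℝ => (y - p) / t) (1 / t) y :=
      ((hasDerivAt_id y).sub_const p).div_const t
    have h3 := (h ((y - p) / t)).scomp y h2
    refine ((h3.const_mul (t : ℂ)⁻¹).mul_const (f p)).congr_deriv ?_
    rw [Complex.real_smul]; push_cast; ring

/-- The space derivative of `f * χ_t` is `t⁻¹ f * (χ')_t`, which `Tang.norm_cv_le` bounds by `B`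
again. So `f * χ_t` changes by at most half of the allowed size on a ball of radius `δ t`, and what
exceeds that half bounds the vertical maximal function from below on the whole ball. Averaging its
square root there brings in `hlMax`. -/
theorem Tang.improve {χ : ℝ → ℂ} (hs : ContDiff ℝ (⊤ : ℕ∞) χ) (hc : HasCompactSupport χ)
    (h1 : ∫ w, χ w = 1) : ∃ C : ℝ, 0 ≤ C ∧ ∀ (f : ℝ → ℂ), Integrable f → ∀ x B m : ℝ, 0 ≤ m →
      Tang χ f x B → hlMax (fun y => vmax χ f y ^ (1 / 2 : ℝ)) x ≤ ENNReal.ofReal m →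
      Tang χ f x (B / 2 + C * m ^ 2) := by
  set g : 𝓢(ℝ, ℂ) := hc.toSchwartzMap hs with hg
  set χb := g.toBoundedContinuousFunction
  set χb' := (derivCLM ℝ ℂ g).toBoundedContinuousFunction
  have hder : ∀ x, HasDerivAt χb (χb' x) x := fun x => g.hasDerivAt x
  obtain ⟨D, hD⟩ := exists_decay4_schwartz 3 (derivCLM ℝ ℂ g)
  have hχc : Continuous χ := hs.continuous
  have hχ : Integrable χ := hχc.integrable_of_hasCompactSupport hc
  have hm : Integrable fun w => ‖χ w‖ * (|w| * (1 + |w|) ^ 4) :=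
    (by fun_prop : Continuous fun w => ‖χ w‖ * (|w| * (1 + |w|) ^ 4)).integrable_of_hasCompactSupport
      hc.norm.mul_right
  set C₁ := 44 * Real.pi * (1 + moment χ) ^ 3 * D with hC₁
  have hC₁0 : 0 ≤ C₁ := by have := hD.nonneg; have := moment_nonneg χ; positivity
  -- Small enough that `4 δ C₁ ≤ 1 / 2`, where the 4 comes from doubling the tangential weight `X`
  -- before squaring it.
  set δ : ℝ := (8 * C₁ + 8)⁻¹ with hδ
  have hδ0 : 0 < δ := by positivity
  have hδ1 : δ ≤ 1 := inv_le_one_of_one_le₀ (by linarith)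
  have hδC : 4 * δ * C₁ ≤ 1 / 2 := by
    rw [hδ, ← div_eq_mul_inv, div_mul_eq_mul_div, div_le_iff₀ (by positivity)]; linarith
  refine ⟨(δ⁻¹ + 1) ^ 2, by positivity, fun f hf x B m hm0 hT hmax t ht y => ?_⟩
  set X := 1 + |x - y| / t with hX
  have hX1 : 1 ≤ X := by have : 0 ≤ |x - y| / t := by positivity
                         linarith
  have hB := hT.nonneg
  have hosc : ∀ y' ∈ Metric.ball y (δ * t), ‖cv χ f t y‖ - B / 2 * X ^ 2 ≤ ‖cv χ f t y'‖ := by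
    intro y' hy'
    have hbd : ∀ q ∈ Metric.closedBall y (δ * t),
        ‖(t : ℂ)⁻¹ * cv χb' f t q‖ ≤ t⁻¹ * (C₁ * (B * (4 * X ^ 2))) := by
      intro q hq
      have h3 := hT.norm_cv_le hχ hχc h1 hm χb.norm_coe_le_norm hf hD ht q
      rw [norm_mul, norm_inv, Complex.norm_real, Real.norm_of_nonneg ht.le]
      refine mul_le_mul_of_nonneg_left (h3.trans ?_) (by positivity)
      refine mul_le_mul_of_nonneg_left (mul_le_mul_of_nonneg_left ?_ hB) hC₁0
      have h4 : 1 + |x - q| / t ≤ 2 * X := by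
        have h5 : |x - q| ≤ |x - y| + δ * t := by
          rw [Metric.mem_closedBall, dist_comm, Real.dist_eq] at hq
          exact (abs_sub_le x y q).trans (by linarith)
        have h6 : |x - q| / t ≤ |x - y| / t + δ := by
          rw [div_le_iff₀ ht, add_mul, div_mul_cancel₀ _ ht.ne']; exact h5
        linarith
      calc (1 + |x - q| / t) ^ 2 ≤ (2 * X) ^ 2 := pow_le_pow_left₀ (by positivity) h4 2
        _ = _ := by ring
    have h7 := (convex_closedBall y (δ * t)).norm_image_sub_le_of_norm_hasDerivWithin_le
      (fun q _ => (hasDerivAt_cv hder hf (t := t) q).hasDerivWithinAt) hbd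
      (Metric.ball_subset_closedBall hy') (Metric.mem_closedBall_self (by positivity))
    have h8 : ‖y - y'‖ ≤ δ * t := by
      rw [Metric.mem_ball, dist_comm, Real.dist_eq] at hy'
      exact hy'.le
    have h9 : ‖cv χ f t y - cv χ f t y'‖ ≤ B / 2 * X ^ 2 := by
      refine h7.trans ?_
      calc t⁻¹ * (C₁ * (B * (4 * X ^ 2))) * ‖y - y'‖
          ≤ t⁻¹ * (C₁ * (B * (4 * X ^ 2))) * (δ * t) := by gcongr
        _ = (4 * δ * C₁) * (B * X ^ 2) := by field_simp
        _ ≤ 1 / 2 * (B * X ^ 2) := by gcongr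
        _ = _ := by ring
    have h10 := norm_sub_norm_le (cv χ f t y) (cv χ f t y')
    linarith
  rcases le_or_gt (‖cv χ f t y‖ - B / 2 * X ^ 2) 0 with hneg | hpos
  · have : 0 ≤ (δ⁻¹ + 1) ^ 2 * m ^ 2 * X ^ 2 := by positivity
    linarith
  set a := ‖cv χ f t y‖ - B / 2 * X ^ 2 with ha
  -- The ball about `y` is enlarged to one centred at `x`; the ratio of radii is the origin of the
  -- weight `X`.
  have hball : ENNReal.ofReal (Real.sqrt a) * ENNReal.ofReal (2 * (δ * t)) ≤
      ENNReal.ofReal m * ENNReal.ofReal (2 * (|x - y| + δ * t)) := by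
    calc ENNReal.ofReal (Real.sqrt a) * ENNReal.ofReal (2 * (δ * t))
        = ∫⁻ _ in Metric.ball y (δ * t), ENNReal.ofReal (Real.sqrt a) := by
          rw [setLIntegral_const, Real.volume_ball]
      _ ≤ ∫⁻ y' in Metric.ball y (δ * t), vmax χ f y' ^ (1 / 2 : ℝ) := by
          refine setLIntegral_mono' measurableSet_ball fun y' hy' => ?_
          have h11 : ENNReal.ofReal a ≤ vmax χ f y' := by
            refine le_trans ?_ (le_iSup (fun t : Set.Ioi (0 : ℝ) => ‖cv χ f t y'‖ₑ) ⟨t, ht⟩)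
            rw [← ofReal_norm]
            exact ENNReal.ofReal_le_ofReal (hosc y' hy')
          rw [Real.sqrt_eq_rpow, ← ENNReal.ofReal_rpow_of_pos hpos]
          gcongr
      _ ≤ ∫⁻ y' in Metric.ball x (|x - y| + δ * t), vmax χ f y' ^ (1 / 2 : ℝ) := by
          apply lintegral_mono_set
          apply Metric.ball_subset_ball'
          rw [dist_comm, Real.dist_eq]; linarith
      _ ≤ hlMax (fun y => vmax χ f y ^ (1 / 2 : ℝ)) x * ENNReal.ofReal (2 * (|x - y| + δ * t)) :=
          lintegral_ball_le_hlMax _ _ (by positivity)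
      _ ≤ _ := by gcongr
  rw [← ENNReal.ofReal_mul (by positivity), ← ENNReal.ofReal_mul hm0,
    ENNReal.ofReal_le_ofReal_iff (by positivity)] at hball
  have h12 : Real.sqrt a ≤ (δ⁻¹ + 1) * m * X := by
    have h13 : Real.sqrt a * (δ * t) ≤ m * (|x - y| + δ * t) := by linarith
    have h14 : Real.sqrt a ≤ m * (δ⁻¹ * (|x - y| / t) + 1) := by
      rw [← mul_le_mul_iff_left₀ (by positivity : 0 < δ * t)]
      refine h13.trans (le_of_eq ?_)
      field_simp
    refine h14.trans ?_
    have h15 : 0 ≤ |x - y| / t := by positivity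
    have h16 : δ⁻¹ * (|x - y| / t) + 1 ≤ (δ⁻¹ + 1) * X := by
      have : 0 ≤ δ⁻¹ := by positivity
      nlinarith
    calc m * (δ⁻¹ * (|x - y| / t) + 1) ≤ m * ((δ⁻¹ + 1) * X) := by gcongr
      _ = _ := by ring
  have h17 : a ≤ ((δ⁻¹ + 1) * m * X) ^ 2 := by
    rw [← Real.sq_sqrt hpos.le]
    exact pow_le_pow_left₀ (Real.sqrt_nonneg _) h12 2
  calc ‖cv χ f t y‖ = a + B / 2 * X ^ 2 := by rw [ha]; ring
    _ ≤ ((δ⁻¹ + 1) * m * X) ^ 2 + B / 2 * X ^ 2 := by linarith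
    _ = _ := by ring

/-- Iterating `B ↦ B / 2 + C m²` from any finite starting value converges to `2 C m²`, so the a
priori bound leaves no trace in the constant. -/
theorem Tang.of_exists {χ : ℝ → ℂ} (hs : ContDiff ℝ (⊤ : ℕ∞) χ) (hc : HasCompactSupport χ)
    (h1 : ∫ w, χ w = 1) : ∃ C : ℝ, 0 ≤ C ∧ ∀ (f : ℝ → ℂ), Integrable f → ∀ x m : ℝ, 0 ≤ m →
      (∃ B, Tang χ f x B) → hlMax (fun y => vmax χ f y ^ (1 / 2 : ℝ)) x ≤ ENNReal.ofReal m →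
      Tang χ f x (C * m ^ 2) := by
  obtain ⟨C, hC, h⟩ := Tang.improve hs hc h1
  refine ⟨2 * C, by positivity, fun f hf x m hm0 ⟨B, hB⟩ hm => ?_⟩
  have key : ∀ n : ℕ, Tang χ f x (B * (1 / 2) ^ n + 2 * C * m ^ 2) := by
    intro n
    induction n with
    | zero =>
      intro t ht y
      refine (hB t ht y).trans ?_
      gcongr
      rw [pow_zero, mul_one]
      have : 0 ≤ 2 * C * m ^ 2 := by positivity
      linarith
    | succ n ih =>
      have := h f hf x _ m hm0 ih hm
      convert this using 1
      ring
  intro t ht y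
  have hlim : Tendsto (fun n : ℕ => (B * (1 / 2) ^ n + 2 * C * m ^ 2) * (1 + |x - y| / t) ^ 2) atTop
      (𝓝 ((B * 0 + 2 * C * m ^ 2) * (1 + |x - y| / t) ^ 2)) :=
    (((tendsto_pow_atTop_nhds_zero_of_lt_one (by norm_num) (by norm_num)).const_mul B).add_const
      _).mul_const _
  rw [mul_zero, zero_add] at hlim
  exact ge_of_tendsto hlim (Eventually.of_forall fun n => key n t ht y)

/-- The qualitative finiteness that starts the iteration of `Tang.of_exists`. The kernel at `(t, y)`
lives in the ball of radius `|x - y| + R t` about `x`, on which the mean of `|f|` is bounded. -/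
theorem exists_tang_of_hlMax_lt_top {χ : ℝ → ℂ} (hχc : Continuous χ) (hc : HasCompactSupport χ)
    {f : ℝ → ℂ} (hf : Integrable f) {x : ℝ} (hx : hlMax (fun y => ‖f y‖ₑ) x < ∞) :
    ∃ B, Tang χ f x B := by
  obtain ⟨R, hR0, hR⟩ : ∃ R : ℝ, 0 < R ∧ ∀ w, R ≤ |w| → χ w = 0 := by
    obtain ⟨R, hR⟩ := hc.isCompact.isBounded.subset_ball 0
    refine ⟨max R 1, by positivity, fun w hw => ?_⟩
    by_contra hne
    have := hR (subset_tsupport _ hne)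
    rw [Metric.mem_ball, dist_zero_right, Real.norm_eq_abs] at this
    have := le_max_left R 1
    linarith
  obtain ⟨K, hK⟩ := hc.exists_bound_of_continuous hχc
  have hK0 : 0 ≤ K := (norm_nonneg _).trans (hK 0)
  set m := (hlMax (fun y => ‖f y‖ₑ) x).toReal with hm
  have hm' : ENNReal.ofReal m = hlMax (fun y => ‖f y‖ₑ) x := ENNReal.ofReal_toReal hx.ne
  refine ⟨K * (m * (2 * (1 + R))), fun t ht y => ?_⟩
  set X := 1 + |x - y| / t with hX
  have hX1 : 1 ≤ X := by have : 0 ≤ |x - y| / t := by positivity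
                         linarith
  have hm0 : 0 ≤ m := ENNReal.toReal_nonneg
  have h1 : ∫ p in Metric.ball x (|x - y| + R * t), ‖f p‖ ≤ m * (2 * (|x - y| + R * t)) := by
    have h2 := lintegral_ball_le_hlMax (fun y => ‖f y‖ₑ) x (r := |x - y| + R * t) (by positivity)
    rw [← hm', ← ENNReal.ofReal_mul hm0, ← ofReal_integral_norm_eq_lintegral_enorm
      hf.integrableOn, ENNReal.ofReal_le_ofReal_iff (by positivity)] at h2
    exact h2
  have h3 : ‖cv χ f t y‖ ≤ ∫ p in Metric.ball x (|x - y| + R * t), t⁻¹ * K * ‖f p‖ := by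
    rw [cv, ← setIntegral_eq_integral_of_forall_compl_eq_zero
      (s := Metric.ball x (|x - y| + R * t))]
    · refine norm_integral_le_of_norm_le (hf.norm.integrableOn.const_mul _)
        (Eventually.of_forall fun p => ?_)
      rw [norm_mul, norm_mul, norm_inv, Complex.norm_real, Real.norm_of_nonneg ht.le]
      gcongr
      exact hK _
    · intro p hp
      rw [Metric.mem_ball, not_lt, Real.dist_eq] at hp
      rw [hR, mul_zero, zero_mul]
      rw [abs_div, abs_of_pos ht, le_div_iff₀ ht]
      have := abs_sub_le p y x
      rw [abs_sub_comm p y, abs_sub_comm y x] at this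
      linarith
  rw [integral_const_mul] at h3
  have h4 : |x - y| + R * t ≤ t * ((1 + R) * X) := by
    have h5 : |x - y| = t * (X - 1) := by rw [hX]; field_simp; ring
    rw [h5]; nlinarith [mul_pos ht hR0, mul_nonneg (mul_pos ht hR0).le (sub_nonneg.2 hX1)]
  calc ‖cv χ f t y‖ ≤ t⁻¹ * K * (m * (2 * (t * ((1 + R) * X)))) := by
        refine h3.trans ?_
        gcongr
        refine h1.trans ?_
        gcongr
    _ = K * (m * (2 * (1 + R))) * X := by field_simp
    _ ≤ K * (m * (2 * (1 + R))) * X ^ 2 := by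
        have : X ≤ X ^ 2 := by nlinarith
        gcongr

end RealHardy

namespace RealHardy

open BoundedContinuousFunction Filter Topology

/-! ### The analytic extension of a real integrable function -/

/-- The Cauchy integral `∫ F(t) / (t - z) dt`. -/
noncomputable def cauchyInt (F : ℝ → ℂ) (z : ℂ) : ℂ := ∫ t, F t / (t - z)

/-- The analytic function in the upper half-plane with real part the Poisson integral of `f`. -/
noncomputable def analyticExt (f : ℝ → ℝ) (z : ℂ) : ℂ :=
  (Real.pi * Complex.I)⁻¹ * cauchyInt (fun t => (f t : ℂ)) z

theorem abs_im_le_norm_sub (t : ℝ) (z : ℂ) : |z.im| ≤ ‖(t : ℂ) - z‖ := by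
  have := Complex.abs_im_le_norm ((t : ℂ) - z)
  simpa using this

theorem ofReal_sub_ne_zero {z : ℂ} (hz : z.im ≠ 0) (t : ℝ) : (t : ℂ) - z ≠ 0 := by
  intro h
  have := abs_im_le_norm_sub t z
  rw [h, norm_zero] at this
  exact hz (abs_nonpos_iff.1 this)

theorem continuous_inv_ofReal_sub {z : ℂ} (hz : z.im ≠ 0) :
    Continuous fun t : ℝ => ((t : ℂ) - z)⁻¹ :=
  Continuous.inv₀ (by fun_prop) (ofReal_sub_ne_zero hz)

theorem norm_inv_ofReal_sub_le {z : ℂ} (hz : z.im ≠ 0) (t : ℝ) :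
    ‖((t : ℂ) - z)⁻¹‖ ≤ |z.im|⁻¹ := by
  rw [norm_inv]
  exact inv_anti₀ (abs_pos.2 hz) (abs_im_le_norm_sub t z)

theorem integrable_div_ofReal_sub {F : ℝ → ℂ} (hF : Integrable F) {z : ℂ} (hz : z.im ≠ 0) :
    Integrable fun t => F t / (t - z) := by
  simp_rw [div_eq_mul_inv]
  exact hF.mul_bdd (c := |z.im|⁻¹) (continuous_inv_ofReal_sub hz).aestronglyMeasurable
    (Eventually.of_forall fun t => norm_inv_ofReal_sub_le hz t)

theorem continuousAt_cauchyInt {F : ℝ → ℂ} (hF : Integrable F) {z : ℂ} (hz : z.im ≠ 0) :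
    ContinuousAt (cauchyInt F) z := by
  have hU : ∀ᶠ w : ℂ in 𝓝 z, |z.im| / 2 < |w.im| := by
    have : ContinuousAt (fun w : ℂ => |w.im|) z := by fun_prop
    exact this.eventually (lt_mem_nhds (by have := abs_pos.2 hz; linarith))
  have hz2 : 0 < |z.im| / 2 := by have := abs_pos.2 hz; positivity
  refine continuousAt_of_dominated (bound := fun t => ‖F t‖ * (|z.im| / 2)⁻¹) ?_ ?_ ?_ ?_
  · filter_upwards [hU] with w hw
    exact (integrable_div_ofReal_sub hF (by intro h; rw [h, abs_zero] at hw; linarith)).aestronglyMeasurable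
  · filter_upwards [hU] with w hw
    refine Eventually.of_forall fun t => ?_
    rw [norm_div, div_eq_mul_inv]
    gcongr
    exact hw.le.trans (abs_im_le_norm_sub t w)
  · exact hF.norm.mul_const _
  · refine Eventually.of_forall fun t => ?_
    exact ContinuousAt.div continuousAt_const (by fun_prop) (ofReal_sub_ne_zero hz t)

theorem continuousAt_analyticExt {f : ℝ → ℝ} (hf : Integrable f) {z : ℂ} (hz : z.im ≠ 0) :
    ContinuousAt (analyticExt f) z :=
  (continuousAt_cauchyInt hf.ofReal hz).const_mul _

theorem analyticExt_re {f : ℝ → ℝ} (hf : Integrable f) (x : ℝ) {y : ℝ} (hy : 0 < y) :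
    (analyticExt f (x + y * Complex.I)).re = Real.pi⁻¹ * ∫ t, f t * (y / ((x - t) ^ 2 + y ^ 2)) := by
  have hz : (x + y * Complex.I : ℂ).im ≠ 0 := by simpa using hy.ne'
  have hint := integrable_div_ofReal_sub hf.ofReal hz
  have e1 : (analyticExt f (x + y * Complex.I)).re
      = Real.pi⁻¹ * (cauchyInt (fun t => (f t : ℂ)) (x + y * Complex.I)).im := by
    rw [analyticExt, mul_inv, Complex.inv_I, ← Complex.ofReal_inv, mul_assoc, Complex.re_ofReal_mul]
    simp
  have e2 : ∀ t : ℝ, ((f t : ℂ) / (t - (x + y * Complex.I))).im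
      = f t * (y / ((x - t) ^ 2 + y ^ 2)) := by
    intro t
    rw [Complex.div_im]
    have h1 : Complex.normSq ((t : ℂ) - (x + y * Complex.I)) = (x - t) ^ 2 + y ^ 2 := by
      rw [Complex.normSq_apply]; simp; ring
    rw [h1]
    simp
    ring
  rw [e1, cauchyInt]
  congr 1
  have := integral_im hint
  exact this.symm.trans (integral_congr_ae (Eventually.of_forall e2))

theorem integral_two_mul_exp_neg {A : ℝ} (hA : 0 < A) :
    IntegrableOn (fun p : ℝ => 2 * p * Real.exp (-(p ^ 2 * A))) (Set.Ioi 0) ∧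
    ∫ p in Set.Ioi (0 : ℝ), 2 * p * Real.exp (-(p ^ 2 * A)) = A⁻¹ := by
  have hd : ∀ p ∈ Set.Ici (0 : ℝ), HasDerivAt (fun p => -A⁻¹ * Real.exp (-(p ^ 2 * A)))
      (2 * p * Real.exp (-(p ^ 2 * A))) p := by
    intro p _
    have := (((((hasDerivAt_id p).pow 2).mul_const A).neg.exp).const_mul (-A⁻¹))
    refine this.congr_deriv ?_
    simp
    field_simp
  have hlim : Tendsto (fun p : ℝ => -A⁻¹ * Real.exp (-(p ^ 2 * A))) atTop (𝓝 (-A⁻¹ * 0)) := by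
    refine Tendsto.const_mul _ (Real.tendsto_exp_atBot.comp ?_)
    exact tendsto_neg_atTop_atBot.comp ((tendsto_pow_atTop two_ne_zero).atTop_mul_const hA)
  have hpos : ∀ p ∈ Set.Ioi (0 : ℝ), 0 ≤ 2 * p * Real.exp (-(p ^ 2 * A)) := by
    intro p hp
    have : 0 < p := hp
    positivity
  refine ⟨integrableOn_Ioi_deriv_of_nonneg' hd hpos hlim, ?_⟩
  rw [integral_Ioi_of_hasDerivAt_of_nonneg' hd hpos hlim]
  simp

/-- Subordination, from `A⁻¹ = ∫ 2 p exp (-p² A) dp` with `A = (x - t)² + y²`. The Poisson kernel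
decays only quadratically and escapes `Tang.norm_cv_le`; the Gaussians in its place satisfy
`Decay4`. -/
theorem poisson_eq_integral_gauss {f : ℝ → ℝ} (hf : Integrable f) (x : ℝ) {y : ℝ} (hy : 0 < y) :
    ((∫ t, f t * (y / ((x - t) ^ 2 + y ^ 2)) : ℝ) : ℂ)
      = ∫ p in Set.Ioi (0 : ℝ), ((2 * y * Real.exp (-(p * y) ^ 2) : ℝ) : ℂ) *
          cv (fun w => (Real.exp (-w ^ 2) : ℂ)) (fun t => (f t : ℂ)) p⁻¹ x := by
  have e1 : ∀ p ∈ Set.Ioi (0 : ℝ), ((2 * y * Real.exp (-(p * y) ^ 2) : ℝ) : ℂ) *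
      cv (fun w => (Real.exp (-w ^ 2) : ℂ)) (fun t => (f t : ℂ)) p⁻¹ x
      = ((∫ t, f t * (y * (2 * p * Real.exp (-(p ^ 2 * ((x - t) ^ 2 + y ^ 2))))) : ℝ) : ℂ) := by
    intro p hp
    rw [cv, ← integral_const_mul, ← integral_complex_ofReal]
    congr 1; ext t
    have : Real.exp (-(p ^ 2 * ((x - t) ^ 2 + y ^ 2)))
        = Real.exp (-(p * y) ^ 2) * Real.exp (-((x - t) / p⁻¹) ^ 2) := by
      rw [← Real.exp_add]; congr 1; rw [div_inv_eq_mul]; ring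
    rw [this]
    push_cast
    rw [inv_inv]
    ring
  rw [setIntegral_congr_fun measurableSet_Ioi e1, integral_complex_ofReal]
  congr 1
  rw [integral_integral_swap]
  · congr 1; ext t
    rw [integral_const_mul, integral_const_mul, (integral_two_mul_exp_neg (by positivity)).2,
      div_eq_mul_inv]
  · have h1 := (hf.norm).mul_prod ((integral_two_mul_exp_neg (A := y ^ 2) (by positivity)).1.const_mul y)
    have h2 := h1.swap
    refine h2.mono ?_ ?_
    · have hm : AEStronglyMeasurable (fun p : ℝ × ℝ => f p.2)
          ((volume.restrict (Set.Ioi (0 : ℝ))).prod volume) :=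
        hf.aestronglyMeasurable.comp_snd
      exact hm.mul (by fun_prop : Continuous fun q : ℝ × ℝ =>
        (y * (2 * q.1 * Real.exp (-(q.1 ^ 2 * ((x - q.2) ^ 2 + y ^ 2)))))).aestronglyMeasurable
    · refine Eventually.of_forall fun q => ?_
      simp only [Function.uncurry, Function.comp, Prod.fst_swap, Prod.snd_swap, norm_mul, norm_norm]
      gcongr
      simp only [Real.norm_eq_abs, Real.abs_exp]
      gcongr
      nlinarith [sq_nonneg (x - q.2)]

/-- The nontangential maximal function of the Poisson integral of `f`. -/
noncomputable def ntMax (f : ℝ → ℝ) (x : ℝ) : ℝ≥0∞ :=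
  ⨆ p : {p : ℝ × ℝ // |p.1 - x| < p.2}, ‖(analyticExt f (p.1.1 + p.1.2 * Complex.I)).re‖ₑ

theorem le_ntMax (f : ℝ → ℝ) {x a b : ℝ} (h : |a - x| < b) :
    ‖(analyticExt f (a + b * Complex.I)).re‖ₑ ≤ ntMax f x :=
  le_iSup (fun p : {p : ℝ × ℝ // |p.1 - x| < p.2} =>
    ‖(analyticExt f (p.1.1 + p.1.2 * Complex.I)).re‖ₑ) ⟨(a, b), h⟩

theorem isOpen_lt_ntMax (f : ℝ → ℝ) (c : ℝ≥0∞) : IsOpen {x | c < ntMax f x} := by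
  have : {x | c < ntMax f x} = ⋃ p ∈ {p : ℝ × ℝ | c < ‖(analyticExt f (p.1 + p.2 * Complex.I)).re‖ₑ},
      {x | |p.1 - x| < p.2} := by
    ext x
    simp only [ntMax, Set.mem_ofPred_eq, lt_iSup_iff, Set.mem_iUnion, exists_prop, Subtype.exists]
    exact exists_congr fun p => ⟨fun ⟨h, h'⟩ => ⟨h', h⟩, fun ⟨h, h'⟩ => ⟨h', h⟩⟩
  rw [this]
  exact isOpen_biUnion fun p _ => isOpen_lt (by fun_prop) continuous_const

theorem measurable_ntMax (f : ℝ → ℝ) : Measurable (ntMax f) :=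
  measurable_of_Ioi fun a => (isOpen_lt_ntMax f a).measurableSet

/-- In the cone the tangential weight at scale `p⁻¹` is at most `(1 + p y) ^ 2`; the factor `exp
(-(p y)²)` of the subordination formula absorbs it and leaves an integrable function of `p y`. -/
theorem ntMax_le_of_tang {χ : ℝ → ℂ} (hs : ContDiff ℝ (⊤ : ℕ∞) χ) (hc : HasCompactSupport χ)
    (h1 : ∫ w, χ w = 1) : ∃ C : ℝ, 0 ≤ C ∧ ∀ (f : ℝ → ℝ), Integrable f → ∀ x B : ℝ,
      Tang χ (fun t => (f t : ℂ)) x B → ntMax f x ≤ ENNReal.ofReal (C * B) := by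
  have hχc : Continuous χ := hs.continuous
  have hχ : Integrable χ := hχc.integrable_of_hasCompactSupport hc
  have hm : Integrable fun w => ‖χ w‖ * (|w| * (1 + |w|) ^ 4) :=
    (by fun_prop : Continuous fun w => ‖χ w‖ * (|w| * (1 + |w|) ^ 4)).integrable_of_hasCompactSupport
      hc.norm.mul_right
  obtain ⟨K, hK⟩ := hc.exists_bound_of_continuous hχc
  obtain ⟨D, Φ, hΦ, hD⟩ := exists_decay4_poly_gauss 3 1
  simp only [Polynomial.eval_one, one_mul] at hΦ
  have hΦ' : (Φ : ℝ → ℂ) = fun w => (Real.exp (-w ^ 2) : ℂ) := by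
    ext w; rw [hΦ]
  set C₁ := 44 * Real.pi * (1 + moment χ) ^ 3 * D with hC₁
  have hD0 := hD.nonneg
  have hC₁0 : 0 ≤ C₁ := by have := moment_nonneg χ; positivity
  refine ⟨2 * C₁ * D, by positivity, fun f hf x₀ B hT => iSup_le ?_⟩
  rintro ⟨⟨x, y⟩, hxy⟩
  simp only at hxy ⊢
  have hy : 0 < y := (abs_nonneg _).trans_lt hxy
  have hB := hT.nonneg
  rw [← ofReal_norm]
  apply ENNReal.ofReal_le_ofReal
  rw [analyticExt_re hf x hy, ← Complex.norm_real, Complex.ofReal_mul,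
    poisson_eq_integral_gauss hf x hy, norm_mul]
  have hbd : ∀ p ∈ Set.Ioi (0 : ℝ), ‖((2 * y * Real.exp (-(p * y) ^ 2) : ℝ) : ℂ) *
          cv (fun w => (Real.exp (-w ^ 2) : ℂ)) (fun t => (f t : ℂ)) p⁻¹ x‖
      ≤ (2 * C₁ * B * D * y) * (1 + (y * p) ^ 2)⁻¹ := by
    intro p hp
    have hp0 : 0 < p := hp
    have h2 := hT.norm_cv_le hχ hχc h1 hm hK hf.ofReal hD (inv_pos.2 hp0) x
    rw [hΦ'] at h2
    have h3 := hD.zero.norm_mul_sq_le (p * y)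
    rw [hΦ, Complex.norm_real, Real.norm_eq_abs, Real.abs_exp, abs_of_pos (by positivity)] at h3
    have h4 : 1 + |x₀ - x| / p⁻¹ ≤ 1 + p * y := by
      rw [div_inv_eq_mul, abs_sub_comm]; nlinarith
    rw [norm_mul, Complex.norm_real, Real.norm_of_nonneg (by positivity)]
    calc 2 * y * Real.exp (-(p * y) ^ 2) *
          ‖cv (fun w => (Real.exp (-w ^ 2) : ℂ)) (fun t => (f t : ℂ)) p⁻¹ x‖
        ≤ 2 * y * Real.exp (-(p * y) ^ 2) * (C₁ * (B * (1 + p * y) ^ 2)) := by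
          gcongr
          refine h2.trans ?_
          gcongr
      _ = 2 * C₁ * B * y * (Real.exp (-(p * y) ^ 2) * (1 + p * y) ^ 2) := by ring
      _ ≤ 2 * C₁ * B * y * (D * (1 + (p * y) ^ 2)⁻¹) := by gcongr
      _ = _ := by rw [mul_comm p y]; ring
  have hint : Integrable fun p : ℝ => (2 * C₁ * B * D * y) * (1 + (y * p) ^ 2)⁻¹ :=
    (integrable_inv_one_add_sq.comp_mul_left' hy.ne').const_mul _
  have h5 := norm_integral_le_of_norm_le hint.integrableOn
    ((ae_restrict_iff' measurableSet_Ioi).2 (Eventually.of_forall hbd))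
  have h6 : ∫ p in Set.Ioi (0 : ℝ), (2 * C₁ * B * D * y) * (1 + (y * p) ^ 2)⁻¹
      ≤ 2 * C₁ * B * D * Real.pi := by
    refine (setIntegral_le_integral hint (Eventually.of_forall fun p => by positivity)).trans ?_
    rw [integral_const_mul, Measure.integral_comp_mul_left (fun q : ℝ => (1 + q ^ 2)⁻¹) y,
      integral_univ_inv_one_add_sq, abs_of_pos (inv_pos.2 hy), smul_eq_mul]
    apply le_of_eq
    field_simp
  rw [Complex.norm_real, Real.norm_of_nonneg (by positivity)]
  calc Real.pi⁻¹ * _ ≤ Real.pi⁻¹ * (2 * C₁ * B * D * Real.pi) := by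
        gcongr
        exact h5.trans h6
    _ = 2 * C₁ * D * B := by field_simp

end RealHardy

namespace RealHardy

open Filter Topology

/-! ### Cauchy's theorem above a Lipschitz graph -/

section Graph

variable {φ φ' : ℝ → ℝ} {η : ℝ}

theorem graph_im (φ : ℝ → ℝ) (x : ℝ) : ((x : ℂ) + φ x * Complex.I).im = φ x := by simp

theorem norm_inv_sub_graph_sq_le (hη : 0 < η) (hφη : ∀ x, η ≤ φ x) (t x : ℝ) :
    ‖((t : ℂ) - (x + φ x * Complex.I))⁻¹‖ ^ 2 ≤ (η ^ 2 + (x - t) ^ 2)⁻¹ := by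
  rw [norm_inv, inv_pow]
  apply inv_anti₀ (by positivity)
  rw [← Complex.normSq_eq_norm_sq, Complex.normSq_apply]
  have : η ^ 2 ≤ φ x ^ 2 := pow_le_pow_left₀ hη.le (hφη x) 2
  simp
  nlinarith

theorem integrable_inv_sq_add_sq (hη : 0 < η) (t : ℝ) :
    Integrable (fun x : ℝ => (η ^ 2 + (x - t) ^ 2)⁻¹) ∧
    ∫ x : ℝ, (η ^ 2 + (x - t) ^ 2)⁻¹ = Real.pi / η := by
  have e : (fun x : ℝ => (η ^ 2 + (x - t) ^ 2)⁻¹)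
      = fun x => (fun x => (η ^ 2)⁻¹ * (1 + (η⁻¹ * x) ^ 2)⁻¹) (x - t) := by
    ext x
    field_simp
  have h1 : Integrable fun x : ℝ => (η ^ 2)⁻¹ * (1 + (η⁻¹ * x) ^ 2)⁻¹ :=
    (integrable_inv_one_add_sq.comp_mul_left' (inv_pos.2 hη).ne').const_mul _
  rw [e]
  refine ⟨h1.comp_sub_right t, ?_⟩
  rw [integral_sub_right_eq_self (fun x : ℝ => (η ^ 2)⁻¹ * (1 + (η⁻¹ * x) ^ 2)⁻¹) t,
    integral_const_mul, Measure.integral_comp_mul_left (fun q : ℝ => (1 + q ^ 2)⁻¹),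
    integral_univ_inv_one_add_sq, inv_inv, abs_of_pos hη, smul_eq_mul]
  field_simp

theorem norm_graph_kernel_le (hη : 0 < η) (hφη : ∀ x, η ≤ φ x) (hφ'1 : ∀ x, |φ' x| ≤ 1)
    (t s x : ℝ) :
    ‖(1 + φ' x * Complex.I) / ((t - (x + φ x * Complex.I)) * (s - (x + φ x * Complex.I)))‖
      ≤ (η ^ 2 + (x - t) ^ 2)⁻¹ + (η ^ 2 + (x - s) ^ 2)⁻¹ := by
  have h1 := norm_inv_sub_graph_sq_le hη hφη t x
  have h2 := norm_inv_sub_graph_sq_le hη hφη s x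
  have h3 : ‖(1 + φ' x * Complex.I : ℂ)‖ ≤ 2 := by
    refine (norm_add_le _ _).trans ?_
    rw [norm_one, norm_mul, Complex.norm_I, mul_one, Complex.norm_real, Real.norm_eq_abs]
    linarith [hφ'1 x]
  rw [div_eq_mul_inv, mul_inv, norm_mul, norm_mul]
  set a := ‖((t : ℂ) - (x + φ x * Complex.I))⁻¹‖
  set b := ‖((s : ℂ) - (x + φ x * Complex.I))⁻¹‖
  have ha : 0 ≤ a := norm_nonneg _
  have hb : 0 ≤ b := norm_nonneg _
  calc _ ≤ 2 * (a * b) := by gcongr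
    _ ≤ a ^ 2 + b ^ 2 := by nlinarith [sq_nonneg (a - b)]
    _ ≤ _ := add_le_add h1 h2

theorem continuous_graph_kernel (hη : 0 < η) (hφη : ∀ x, η ≤ φ x) (hφ : Continuous φ)
    (hφ' : Continuous φ') : Continuous fun q : (ℝ × ℝ) × ℝ =>
      (1 + φ' q.2 * Complex.I) /
        ((q.1.1 - (q.2 + φ q.2 * Complex.I)) * (q.1.2 - (q.2 + φ q.2 * Complex.I))) := by
  refine Continuous.div (by fun_prop) (by fun_prop) fun q => mul_ne_zero ?_ ?_
  all_goals
    apply ofReal_sub_ne_zero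
    rw [graph_im]
    exact (hη.trans_le (hφη _)).ne'

/-- Cauchy's theorem through an explicit primitive: along the graph `γ` the integrand is the
derivative of `(t - s)⁻¹ log ((t - γ) / (s - γ))`, and the quotient tends to 1 at both ends. -/
theorem integral_graph_kernel_eq_zero (hη : 0 < η) (hφη : ∀ x, η ≤ φ x)
    (hφ : ∀ x, HasDerivAt φ (φ' x) x) (hφ' : Continuous φ') (hφ'1 : ∀ x, |φ' x| ≤ 1)
    {t s : ℝ} (hts : t ≠ s) :
    ∫ x : ℝ, (1 + φ' x * Complex.I) /
      ((t - (x + φ x * Complex.I)) * (s - (x + φ x * Complex.I))) = 0 := by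
  set γ : ℝ → ℂ := fun x => x + φ x * Complex.I with hγ
  have hφc : Continuous φ := continuous_iff_continuousAt.2 fun x => (hφ x).continuousAt
  have hγd : ∀ x, HasDerivAt γ (1 + φ' x * Complex.I) x := fun x =>
    (Complex.ofRealCLM.hasDerivAt (x := x)).add (((hφ x).ofReal_comp).mul_const Complex.I)
  have hne : ∀ (a x : ℝ), (a : ℂ) - γ x ≠ 0 := fun a x => ofReal_sub_ne_zero (by
    rw [hγ, graph_im]; exact (hη.trans_le (hφη _)).ne') a
  have hts' : (t : ℂ) - s ≠ 0 := by
    rw [sub_ne_zero]; exact_mod_cast hts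
  set L : ℝ → ℂ := fun x => ((t : ℂ) - s)⁻¹ * Complex.log ((t - γ x) / (s - γ x)) with hL
  -- Numerator and denominator have the same imaginary part `-φ x < 0`, so their quotient cannot be
  -- a nonpositive real number.
  have hslit : ∀ x, (t - γ x) / (s - γ x) ∈ Complex.slitPlane := by
    intro x
    by_contra hcon
    rw [Complex.mem_slitPlane_iff_not_le_zero, not_not, Complex.le_def] at hcon
    obtain ⟨hre, him⟩ := hcon
    set r := (t - γ x) / (s - γ x) with hr
    have hr' : r = (r.re : ℂ) := Complex.ext (by simp) (by simpa using him)
    have h1 : t - γ x = (r.re : ℂ) * (s - γ x) := by rw [← hr', hr, div_mul_cancel₀ _ (hne s x)]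
    have h2 := congrArg Complex.im h1
    rw [Complex.im_ofReal_mul] at h2
    simp [hγ] at h2
    have h3 := hη.trans_le (hφη x)
    have : r.re ≤ 0 := by simpa using hre
    nlinarith
  have hLd : ∀ x, HasDerivAt L ((1 + φ' x * Complex.I) / ((t - γ x) * (s - γ x))) x := by
    intro x
    have h1 : HasDerivAt (fun x => ((t : ℂ) - γ x) / (s - γ x))
        ((-(1 + φ' x * Complex.I) * (s - γ x) - (t - γ x) * (-(1 + φ' x * Complex.I)))
          / (s - γ x) ^ 2) x :=
      ((hγd x).const_sub (t : ℂ)).div ((hγd x).const_sub (s : ℂ)) (hne s x)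
    refine ((h1.clog_real (hslit x)).const_mul _).congr_deriv ?_
    have := hne s x
    have := hne t x
    field_simp
    ring
  have hint : Integrable fun x => (1 + φ' x * Complex.I) / ((t - γ x) * (s - γ x)) := by
    refine ((integrable_inv_sq_add_sq hη t).1.add (integrable_inv_sq_add_sq hη s).1).mono' ?_
      (Eventually.of_forall fun x => norm_graph_kernel_le hη hφη hφ'1 t s x)
    exact ((continuous_graph_kernel hη hφη hφc hφ').comp
      (by fun_prop : Continuous fun x : ℝ => ((t, s), x))).aestronglyMeasurable
  have hlim : ∀ l : Filter ℝ, Tendsto (fun x : ℝ => |x|) l atTop → Tendsto L l (𝓝 0) := by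
    intro l hl
    have h1 : Tendsto (fun x => (t - γ x) / (s - γ x)) l (𝓝 1) := by
      have h2 : Tendsto (fun x => (s - γ x)⁻¹) l (𝓝 0) := by
        apply tendsto_inv₀_cobounded.comp
        rw [← tendsto_norm_atTop_iff_cobounded]
        refine tendsto_atTop_mono (f := fun x => |x| - |s|) (fun x => ?_)
          (tendsto_atTop_add_const_right _ _ hl)
        have h3 := Complex.abs_re_le_norm (s - γ x)
        have h4 : ((s : ℂ) - γ x).re = s - x := by simp [hγ]
        rw [h4, abs_sub_comm] at h3
        exact (abs_sub_abs_le_abs_sub x s).trans h3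
      have h5 : (fun x => (t - γ x) / (s - γ x)) = fun x => 1 + ((t : ℂ) - s) * (s - γ x)⁻¹ := by
        ext x
        have := hne s x
        field_simp
        ring
      rw [h5]
      simpa using (h2.const_mul ((t : ℂ) - s)).const_add 1
    have h6 := (h1.clog Complex.one_mem_slitPlane).const_mul ((t : ℂ) - s)⁻¹
    simpa using h6
  rw [integral_of_hasDerivAt_of_tendsto hLd hint (hlim _ tendsto_abs_atBot_atTop)
    (hlim _ tendsto_abs_atTop_atTop), sub_zero]

theorem integrable_graph (hη : 0 < η) (hφη : ∀ x, η ≤ φ x)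
    (hφ : Continuous φ) (hφ' : Continuous φ') (hφ'1 : ∀ x, |φ' x| ≤ 1)
    {f : ℝ → ℂ} (hf : Integrable f) :
    Integrable (fun q : (ℝ × ℝ) × ℝ => (f q.1.1 * f q.1.2) * ((1 + φ' q.2 * Complex.I) /
        ((q.1.1 - (q.2 + φ q.2 * Complex.I)) * (q.1.2 - (q.2 + φ q.2 * Complex.I)))))
      ((volume.prod volume).prod volume) := by
  have hff := hf.mul_prod hf
  have hmeas : AEStronglyMeasurable (fun q : (ℝ × ℝ) × ℝ => (f q.1.1 * f q.1.2) *
      ((1 + φ' q.2 * Complex.I) / ((q.1.1 - (q.2 + φ q.2 * Complex.I)) *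
        (q.1.2 - (q.2 + φ q.2 * Complex.I))))) ((volume.prod volume).prod volume) :=
    hff.aestronglyMeasurable.comp_fst.mul
      (continuous_graph_kernel hη hφη hφ hφ').aestronglyMeasurable
  have hk : ∀ p : ℝ × ℝ, Integrable fun x => (1 + φ' x * Complex.I) /
      ((p.1 - (x + φ x * Complex.I)) * (p.2 - (x + φ x * Complex.I))) := by
    intro p
    refine ((integrable_inv_sq_add_sq hη p.1).1.add (integrable_inv_sq_add_sq hη p.2).1).mono' ?_
      (Eventually.of_forall fun x => norm_graph_kernel_le hη hφη hφ'1 p.1 p.2 x)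
    exact ((continuous_graph_kernel hη hφη hφ hφ').comp
      (by fun_prop : Continuous fun x : ℝ => (p, x))).aestronglyMeasurable
  rw [integrable_prod_iff hmeas]
  refine ⟨Eventually.of_forall fun p => (hk p).const_mul (f p.1 * f p.2), ?_⟩
  refine (hff.norm.mul_const (2 * (Real.pi / η))).mono' hmeas.norm.integral_prod_right' ?_
  refine Eventually.of_forall fun p => ?_
  rw [Real.norm_of_nonneg (integral_nonneg fun x => norm_nonneg _)]
  simp only [norm_mul]
  rw [integral_const_mul]
  gcongr
  calc _ ≤ ∫ x, ((η ^ 2 + (x - p.1) ^ 2)⁻¹ + (η ^ 2 + (x - p.2) ^ 2)⁻¹) := by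
        refine integral_mono (hk p).norm
          ((integrable_inv_sq_add_sq hη p.1).1.add (integrable_inv_sq_add_sq hη p.2).1)
          fun x => norm_graph_kernel_le hη hφη hφ'1 p.1 p.2 x
    _ = _ := by
        rw [integral_add (integrable_inv_sq_add_sq hη p.1).1 (integrable_inv_sq_add_sq hη p.2).1,
          (integrable_inv_sq_add_sq hη p.1).2, (integrable_inv_sq_add_sq hη p.2).2]
        ring

theorem graph_inner_eq (f : ℝ → ℂ) (x : ℝ) :
    ∫ p : ℝ × ℝ, (f p.1 * f p.2) * ((1 + φ' x * Complex.I) /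
        ((p.1 - (x + φ x * Complex.I)) * (p.2 - (x + φ x * Complex.I)))) ∂(volume.prod volume)
      = (cauchyInt f (x + φ x * Complex.I)) ^ 2 * (1 + φ' x * Complex.I) := by
  rw [sq, cauchyInt, ← integral_prod_mul, ← integral_mul_const]
  congr 1; ext p
  rw [div_mul_div_comm]
  ring

/-- The square is a double integral in `(t, s)`. After Fubini the integral along the graph vanishes
for `t ≠ s`, and the diagonal is null. No decay of the Cauchy integral at infinity has to be
estimated. -/
theorem cauchyInt_graph_sq (hη : 0 < η) (hφη : ∀ x, η ≤ φ x)
    (hφ : ∀ x, HasDerivAt φ (φ' x) x) (hφ' : Continuous φ') (hφ'1 : ∀ x, |φ' x| ≤ 1)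
    {f : ℝ → ℂ} (hf : Integrable f) :
    Integrable (fun x : ℝ => (cauchyInt f (x + φ x * Complex.I)) ^ 2 * (1 + φ' x * Complex.I)) ∧
    ∫ x : ℝ, (cauchyInt f (x + φ x * Complex.I)) ^ 2 * (1 + φ' x * Complex.I) = 0 := by
  have hφc : Continuous φ := continuous_iff_continuousAt.2 fun x => (hφ x).continuousAt
  have hI := integrable_graph hη hφη hφc hφ' hφ'1 hf
  simp_rw [← graph_inner_eq]
  refine ⟨hI.integral_prod_right, ?_⟩
  rw [← integral_prod_symm _ hI, integral_prod _ hI]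
  have h2 : Integrable (fun p : ℝ × ℝ => ∫ x, (f p.1 * f p.2) * ((1 + φ' x * Complex.I) /
        ((p.1 - (x + φ x * Complex.I)) * (p.2 - (x + φ x * Complex.I))))) (volume.prod volume) :=
    hI.integral_prod_left
  rw [integral_prod _ h2]
  rw [integral_eq_zero_of_ae]
  refine Eventually.of_forall fun t => ?_
  refine integral_eq_zero_of_ae ?_
  filter_upwards [compl_mem_ae_iff.2 (measure_singleton t)] with s hs
  rw [integral_const_mul, integral_graph_kernel_eq_zero hη hφη hφ hφ' hφ'1 (Ne.symm hs)]
  simp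

theorem continuous_analyticExt_graph {f : ℝ → ℝ} (hf : Integrable f) (hη : 0 < η)
    (hφη : ∀ x, η ≤ φ x) (hφ : Continuous φ) :
    Continuous fun x : ℝ => analyticExt f (x + φ x * Complex.I) := by
  refine continuous_iff_continuousAt.2 fun x => ?_
  refine ContinuousAt.comp (f := fun x : ℝ => (x + φ x * Complex.I : ℂ)) (g := analyticExt f)
    (continuousAt_analyticExt hf ?_) (by fun_prop)
  rw [graph_im]; exact (hη.trans_le (hφη x)).ne'

/-- With `F = u + i v` on the graph, the real part of `∫ F² (1 + i φ') = 0` reads `∫ (u² - v² - 2 u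
v φ') = 0`. As `|φ'| ≤ 1`, Young's inequality bounds `v²` in the mean by `3 u² + v² / 2`, whence the
6. Integrability follows from `|F|² ≤ |F² (1 + i φ')|`. -/
theorem integral_im_sq_graph_le (hη : 0 < η) (hφη : ∀ x, η ≤ φ x)
    (hφ : ∀ x, HasDerivAt φ (φ' x) x) (hφ' : Continuous φ') (hφ'1 : ∀ x, |φ' x| ≤ 1)
    {f : ℝ → ℝ} (hf : Integrable f) :
    Integrable (fun x : ℝ => (analyticExt f (x + φ x * Complex.I)).im ^ 2) ∧
    Integrable (fun x : ℝ => (analyticExt f (x + φ x * Complex.I)).re ^ 2) ∧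
    ∫ x : ℝ, (analyticExt f (x + φ x * Complex.I)).im ^ 2
      ≤ 6 * ∫ x : ℝ, (analyticExt f (x + φ x * Complex.I)).re ^ 2 := by
  have hφc : Continuous φ := continuous_iff_continuousAt.2 fun x => (hφ x).continuousAt
  obtain ⟨h1, h2⟩ := cauchyInt_graph_sq hη hφη hφ hφ' hφ'1 (f := fun t => (f t : ℂ)) hf.ofReal
  set F : ℝ → ℂ := fun x => analyticExt f (x + φ x * Complex.I) with hF
  have hFc : Continuous F := continuous_analyticExt_graph hf hη hφη hφc
  have e : ∀ x, F x ^ 2 * (1 + φ' x * Complex.I) = ((Real.pi * Complex.I : ℂ)⁻¹) ^ 2 *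
      ((cauchyInt (fun t => (f t : ℂ)) (x + φ x * Complex.I)) ^ 2 * (1 + φ' x * Complex.I)) := by
    intro x; simp only [hF, analyticExt]; ring
  have h1' : Integrable fun x => F x ^ 2 * (1 + φ' x * Complex.I) := by
    simp_rw [e]; exact h1.const_mul _
  have h2' : ∫ x, F x ^ 2 * (1 + φ' x * Complex.I) = 0 := by
    simp_rw [e]; rw [integral_const_mul, h2, mul_zero]
  have hre : ∀ x, (F x ^ 2 * (1 + φ' x * Complex.I)).re
      = (F x).re ^ 2 - (F x).im ^ 2 - 2 * ((F x).re * (F x).im * φ' x) := by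
    intro x; simp [sq]; ring
  have hnorm : Integrable fun x => ‖F x‖ ^ 2 := by
    refine h1'.norm.mono' (by fun_prop) (Eventually.of_forall fun x => ?_)
    rw [Real.norm_of_nonneg (by positivity), norm_mul, norm_pow]
    have h3 : 1 ≤ ‖(1 + φ' x * Complex.I : ℂ)‖ := by
      have := Complex.re_le_norm (1 + φ' x * Complex.I : ℂ)
      simpa using this
    nlinarith [sq_nonneg ‖F x‖]
  have hi : Integrable fun x => (F x).im ^ 2 := by
    refine hnorm.mono' (by fun_prop) (Eventually.of_forall fun x => ?_)
    rw [Real.norm_of_nonneg (by positivity), ← sq_abs]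
    exact pow_le_pow_left₀ (abs_nonneg _) (Complex.abs_im_le_norm _) 2
  have hr : Integrable fun x => (F x).re ^ 2 := by
    refine hnorm.mono' (by fun_prop) (Eventually.of_forall fun x => ?_)
    rw [Real.norm_of_nonneg (by positivity), ← sq_abs]
    exact pow_le_pow_left₀ (abs_nonneg _) (Complex.abs_re_le_norm _) 2
  refine ⟨hi, hr, ?_⟩
  have h3 : ∫ x, (F x ^ 2 * (1 + φ' x * Complex.I)).re = 0 := by
    have := integral_re h1'
    rw [h2'] at this
    simpa using this
  have h4 : Integrable fun x => (F x ^ 2 * (1 + φ' x * Complex.I)).re := h1'.re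
  have h8 : Integrable fun x => 3 * (F x).re ^ 2 + 1 / 2 * (F x).im ^ 2 :=
    (hr.const_mul 3).add (hi.const_mul (1 / 2))
  have h5 : ∫ x, (F x).im ^ 2 ≤ ∫ x, (3 * (F x).re ^ 2 + 1 / 2 * (F x).im ^ 2
      - (F x ^ 2 * (1 + φ' x * Complex.I)).re) := by
    refine integral_mono hi (h8.sub h4) fun x => ?_
    simp only [hre]
    have h6 := abs_le.1 (hφ'1 x)
    have h7 : -(2 * (F x).re ^ 2 + 1 / 2 * (F x).im ^ 2) ≤ 2 * ((F x).re * (F x).im * φ' x) := by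
      nlinarith [sq_nonneg (2 * (F x).re * φ' x + (F x).im), sq_nonneg ((F x).re),
        mul_nonneg (sq_nonneg (F x).re) (mul_nonneg (sub_nonneg.2 h6.2) (by linarith : 0 ≤ φ' x + 1))]
    linarith
  rw [integral_sub h8 h4,
    integral_add (hr.const_mul 3) (hi.const_mul (1 / 2)), integral_const_mul, integral_const_mul,
    h3] at h5
  linarith

end Graph

end RealHardy

namespace RealHardy

open Filter Topology

/-! ### The good-`λ` inequality for the conjugate function -/

/-- The forward mean of the distance to `E` over `[x, x + δ]` is `C¹`, has slope at most 1, and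
differs from the distance by at most `δ`; adding `δ + η` puts it above. -/
theorem exists_smooth_majorant (E : Set ℝ) {δ η : ℝ} (hδ : 0 < δ) :
    ∃ φ φ' : ℝ → ℝ, (∀ x, HasDerivAt φ (φ' x) x) ∧ Continuous φ' ∧ (∀ x, |φ' x| ≤ 1) ∧
      (∀ x, Metric.infDist x E + η ≤ φ x) ∧ ∀ x, φ x ≤ Metric.infDist x E + 2 * δ + η := by
  set ψ : ℝ → ℝ := fun x => Metric.infDist x E with hψ
  have hψc : Continuous ψ := Metric.continuous_infDist_pt E
  have hlip : ∀ x y, |ψ x - ψ y| ≤ |x - y| := fun x y => by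
    have := (Metric.lipschitz_infDist_pt E).dist_le_mul x y
    simpa [Real.dist_eq] using this
  set Ψ : ℝ → ℝ := fun x => ∫ u in (0 : ℝ)..x, ψ u with hΨ
  have hΨd : ∀ x, HasDerivAt Ψ (ψ x) x := fun x =>
    intervalIntegral.integral_hasDerivAt_right (hψc.intervalIntegrable _ _)
      (hψc.stronglyMeasurableAtFilter _ _) hψc.continuousAt
  have hav : ∀ x, |Ψ (x + δ) - Ψ x - δ * ψ x| ≤ δ * δ := by
    intro x
    have h1 : Ψ (x + δ) - Ψ x = ∫ u in x..(x + δ), ψ u :=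
      intervalIntegral.integral_interval_sub_left (hψc.intervalIntegrable _ _)
        (hψc.intervalIntegrable _ _)
    have h2 : δ * ψ x = ∫ _ in x..(x + δ), ψ x := by
      rw [intervalIntegral.integral_const]; simp
    rw [h1, h2, ← intervalIntegral.integral_sub (hψc.intervalIntegrable _ _)
      (continuous_const.intervalIntegrable _ _)]
    have h3 := intervalIntegral.norm_integral_le_of_norm_le_const (a := x) (b := x + δ)
      (f := fun u => ψ u - ψ x) (C := δ) (fun u hu => by
        rw [Set.uIoc_of_le (by linarith)] at hu
        refine (hlip u x).trans ?_
        rw [abs_of_pos (by linarith [hu.1])]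
        linarith [hu.2])
    rw [add_sub_cancel_left, abs_of_pos hδ] at h3
    exact h3
  refine ⟨fun x => δ⁻¹ * (Ψ (x + δ) - Ψ x) + δ + η, fun x => δ⁻¹ * (ψ (x + δ) - ψ x), fun x => ?_,
    by fun_prop, fun x => ?_, fun x => ?_, fun x => ?_⟩
  · exact (((((hΨd (x + δ)).comp_add_const x δ).sub (hΨd x)).const_mul δ⁻¹).add_const δ).add_const η
  · have := hlip (x + δ) x
    rw [add_sub_cancel_left, abs_of_pos hδ] at this
    rw [abs_mul, abs_of_pos (inv_pos.2 hδ), inv_mul_le_iff₀ hδ]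
    linarith
  · have h4 := (abs_le.1 (hav x)).1
    have h5 : ψ x - δ ≤ δ⁻¹ * (Ψ (x + δ) - Ψ x) := by
      rw [le_inv_mul_iff₀ hδ]; nlinarith
    have : Metric.infDist x E = ψ x := rfl
    linarith
  · have h4 := (abs_le.1 (hav x)).2
    have h5 : δ⁻¹ * (Ψ (x + δ) - Ψ x) ≤ ψ x + δ := by
      rw [inv_mul_le_iff₀ hδ]; nlinarith
    have : Metric.infDist x E = ψ x := rfl
    linarith

/-- The `L²` comparison is applied on graphs descending to height `η` above the good set. Off that
set, every graph point lies in the cone of a good point, so the real part is at most `l` there.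
Fatou's lemma transfers the bound to the horizontal line over the good set. -/
theorem lintegral_conj_sq_good_le {f : ℝ → ℝ} (hf : Integrable f) {η : ℝ} (hη : 0 < η)
    {l : ℝ≥0∞} (hne : {x | ntMax f x ≤ l}.Nonempty) :
    ∫⁻ x in {x | ntMax f x ≤ l}, ‖(analyticExt f (x + η * Complex.I)).im‖ₑ ^ 2
      ≤ 6 * ((∫⁻ x in {x | ntMax f x ≤ l}, ntMax f x ^ 2) + l ^ 2 * volume {x | l < ntMax f x}) := by
  set E : Set ℝ := {x | ntMax f x ≤ l} with hE
  have hEc : Eᶜ = {x | l < ntMax f x} := by ext x; simp [hE]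
  have hclosed : IsClosed E := by
    rw [← isOpen_compl_iff, hEc]; exact isOpen_lt_ntMax f l
  have hm := hclosed.measurableSet
  have hδ : ∀ n : ℕ, (0 : ℝ) < 1 / (n + 1) := fun n => by positivity
  choose φ φ' hd hc h1 hlow hup using fun n : ℕ => exists_smooth_majorant E (η := η) (hδ n)
  have hφη : ∀ n x, η ≤ φ n x := fun n x => by
    have := hlow n x
    have : 0 ≤ Metric.infDist x E := Metric.infDist_nonneg
    linarith [hlow n x]
  have hφc : ∀ n, Continuous (φ n) := fun n =>
    continuous_iff_continuousAt.2 fun x => (hd n x).continuousAt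
  have hu : ∀ n x, ‖(analyticExt f (x + φ n x * Complex.I)).re‖ₑ ^ 2
      ≤ E.indicator (fun x => ntMax f x ^ 2) x + Eᶜ.indicator (fun _ => l ^ 2) x := by
    intro n x
    by_cases hx : x ∈ E
    · rw [Set.indicator_of_mem hx, Set.indicator_of_notMem (by simpa using hx), add_zero]
      gcongr
      apply le_ntMax
      rw [sub_self, abs_zero]
      exact hη.trans_le (hφη n x)
    · rw [Set.indicator_of_notMem hx, Set.indicator_of_mem (by simpa using hx), zero_add]
      gcongr
      -- The point above `x` lies strictly inside the cone at the nearest good point, because the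
      -- graph exceeds the distance by at least `η > 0`.
      obtain ⟨x₀, hx₀, hdist⟩ := hclosed.exists_infDist_eq_dist hne x
      refine le_trans (le_ntMax f (x := x₀) ?_) hx₀
      rw [← Real.dist_eq, ← hdist]
      linarith [hlow n x]
  have hbound : ∀ n, ∫⁻ x, ‖(analyticExt f (x + φ n x * Complex.I)).im‖ₑ ^ 2
      ≤ 6 * ((∫⁻ x in E, ntMax f x ^ 2) + l ^ 2 * volume {x | l < ntMax f x}) := by
    intro n
    obtain ⟨hi, hr, hle⟩ := integral_im_sq_graph_le hη (hφη n) (hd n) (hc n) (h1 n) hf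
    have conv : ∀ g : ℝ → ℝ, Integrable (fun x => g x ^ 2) →
        ∫⁻ x, ‖g x‖ₑ ^ 2 = ENNReal.ofReal (∫ x, g x ^ 2) := by
      intro g hg
      rw [ofReal_integral_eq_lintegral_ofReal hg (Eventually.of_forall fun x => by positivity)]
      congr 1; ext x
      rw [← ofReal_norm, ← ENNReal.ofReal_pow (norm_nonneg _), Real.norm_eq_abs, sq_abs]
    rw [conv _ hi]
    calc ENNReal.ofReal (∫ x : ℝ, (analyticExt f (x + φ n x * Complex.I)).im ^ 2)
        ≤ 6 * ENNReal.ofReal (∫ x : ℝ, (analyticExt f (x + φ n x * Complex.I)).re ^ 2) := by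
          rw [← ENNReal.ofReal_ofNat 6, ← ENNReal.ofReal_mul (by norm_num)]
          exact ENNReal.ofReal_le_ofReal hle
      _ = 6 * ∫⁻ x, ‖(analyticExt f (x + φ n x * Complex.I)).re‖ₑ ^ 2 := by rw [conv _ hr]
      _ ≤ 6 * ∫⁻ x, (E.indicator (fun x => ntMax f x ^ 2) x + Eᶜ.indicator (fun _ => l ^ 2) x) := by
          gcongr with x
          exact hu n x
      _ = _ := by
          rw [lintegral_add_left (((measurable_ntMax f).pow_const 2).indicator hm),
            lintegral_indicator hm, lintegral_indicator hm.compl, setLIntegral_const, hEc]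
  have hlimit : ∀ x ∈ E, ‖(analyticExt f (x + η * Complex.I)).im‖ₑ ^ 2
      = liminf (fun n => ‖(analyticExt f (x + φ n x * Complex.I)).im‖ₑ ^ 2) atTop := by
    intro x hx
    have hx0 : Metric.infDist x E = 0 := Metric.infDist_zero_of_mem hx
    have hφ : Tendsto (fun n => φ n x) atTop (𝓝 η) := by
      refine tendsto_of_tendsto_of_tendsto_of_le_of_le (g := fun _ => η)
        (h := fun n : ℕ => 2 * (1 / ((n : ℝ) + 1)) + η) tendsto_const_nhds ?_ (fun n => hφη n x)
        (fun n => ?_)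
      · simpa using (tendsto_one_div_add_atTop_nhds_zero_nat (𝕜 := ℝ).const_mul 2).add_const η
      · have := hup n x
        rw [hx0] at this
        linarith
    have hcont : ContinuousAt (analyticExt f) (x + η * Complex.I) :=
      continuousAt_analyticExt hf (by simpa using hη.ne')
    have h3 : Tendsto (fun n => (x + φ n x * Complex.I : ℂ)) atTop (𝓝 (x + η * Complex.I)) :=
      (((Complex.continuous_ofReal.tendsto η).comp hφ).mul_const _).const_add _
    have h4 := (Complex.continuous_im.tendsto _).comp (hcont.tendsto.comp h3)
    have h5 := ((ENNReal.continuous_pow 2).tendsto _).comp ((continuous_enorm.tendsto _).comp h4)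
    exact h5.liminf_eq.symm
  calc ∫⁻ x in E, ‖(analyticExt f (x + η * Complex.I)).im‖ₑ ^ 2
      = ∫⁻ x in E, liminf (fun n => ‖(analyticExt f (x + φ n x * Complex.I)).im‖ₑ ^ 2) atTop :=
        setLIntegral_congr_fun hm hlimit
    _ ≤ liminf (fun n => ∫⁻ x in E, ‖(analyticExt f (x + φ n x * Complex.I)).im‖ₑ ^ 2) atTop := by
        refine lintegral_liminf_le fun n => ?_
        have := continuous_analyticExt_graph hf hη (hφη n) (hφc n)
        exact (Complex.measurable_im.comp this.measurable).enorm.pow_const 2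
    _ ≤ _ := by
        refine liminf_le_of_frequently_le' (Frequently.of_forall fun n => ?_)
        exact (setLIntegral_le_lintegral _ _).trans (hbound n)

theorem lintegral_indicator_lt_Ioi (a : ℝ≥0∞) :
    ∫⁻ l in Set.Ioi (0 : ℝ), Set.indicator {l | ENNReal.ofReal l < a} 1 l = a := by
  have hms : MeasurableSet {l : ℝ | ENNReal.ofReal l < a} :=
    measurableSet_lt ENNReal.measurable_ofReal measurable_const
  rw [lintegral_indicator_one hms, Measure.restrict_apply hms]
  rcases eq_or_ne a ∞ with rfl | ha
  · have : {l : ℝ | ENNReal.ofReal l < ∞} ∩ Set.Ioi 0 = Set.Ioi 0 := by ext; simp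
    rw [this, Real.volume_Ioi]
  · have : {l : ℝ | ENNReal.ofReal l < a} ∩ Set.Ioi 0 = Set.Ioo 0 a.toReal := by
      ext l
      simp only [Set.mem_inter_iff, Set.mem_Ioi, Set.mem_ofPred_eq, Set.mem_Ioo]
      rw [and_comm]
      refine and_congr_right fun hl => ?_
      rw [ENNReal.ofReal_lt_iff_lt_toReal hl.le ha]
    rw [this, Real.volume_Ioo, sub_zero, ENNReal.ofReal_toReal ha]

theorem lintegral_inv_sq_tail_le (a : ℝ≥0∞) :
    ∫⁻ l in Set.Ioi (0 : ℝ), (ENNReal.ofReal l ^ 2)⁻¹ *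
      (a ^ 2 * Set.indicator {l | a ≤ ENNReal.ofReal l} 1 l) ≤ a := by
  rcases eq_or_ne a ∞ with rfl | ha
  · exact le_top
  rcases eq_or_ne a 0 with rfl | ha0
  · simp
  have hpos : 0 < a.toReal := ENNReal.toReal_pos ha0 ha
  have e : ∀ l ∈ Set.Ioi (0 : ℝ), (ENNReal.ofReal l ^ 2)⁻¹ *
      (a ^ 2 * Set.indicator {l | a ≤ ENNReal.ofReal l} 1 l)
      = a ^ 2 * Set.indicator (Set.Ici a.toReal) (fun l => ENNReal.ofReal (l ^ (-2 : ℝ))) l := by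
    intro l hl
    have hl0 : (0 : ℝ) < l := hl
    by_cases h : a ≤ ENNReal.ofReal l
    · have h' : l ∈ Set.Ici a.toReal := (ENNReal.le_ofReal_iff_toReal_le ha hl0.le).1 h
      rw [Set.indicator_of_mem h', Set.indicator_of_mem (show l ∈ {l : ℝ | a ≤ ENNReal.ofReal l} from h), Pi.one_apply,
        mul_one, mul_comm, Real.rpow_neg hl0.le, ENNReal.ofReal_inv_of_pos (by positivity),
        ← ENNReal.ofReal_pow hl0.le]
      norm_num
    · have h' : l ∉ Set.Ici a.toReal := fun hc => h ((ENNReal.le_ofReal_iff_toReal_le ha hl0.le).2 hc)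
      rw [Set.indicator_of_notMem h', Set.indicator_of_notMem (show l ∉ {l : ℝ | a ≤ ENNReal.ofReal l} from h)]
      simp
  rw [setLIntegral_congr_fun measurableSet_Ioi e,
    lintegral_const_mul' _ _ (by simp [ha])]
  have h1 : ∫⁻ l in Set.Ioi (0 : ℝ),
      Set.indicator (Set.Ici a.toReal) (fun l => ENNReal.ofReal (l ^ (-2 : ℝ))) l
      ≤ ∫⁻ l in Set.Ioi a.toReal, ENNReal.ofReal (l ^ (-2 : ℝ)) := by
    rw [setLIntegral_congr (Ioi_ae_eq_Ici (a := a.toReal)), ← lintegral_indicator measurableSet_Ici]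
    exact setLIntegral_le_lintegral _ _
  have h2 : ∫⁻ l in Set.Ioi a.toReal, ENNReal.ofReal (l ^ (-2 : ℝ)) = a⁻¹ := by
    rw [← ofReal_integral_eq_lintegral_ofReal (integrableOn_Ioi_rpow_of_lt (by norm_num) hpos),
      integral_Ioi_rpow_of_lt (by norm_num) hpos]
    · rw [show (-2 : ℝ) + 1 = -1 by norm_num, neg_div_neg_eq, div_one, Real.rpow_neg_one,
        ENNReal.ofReal_inv_of_pos hpos, ENNReal.ofReal_toReal ha]
    · filter_upwards [ae_restrict_mem measurableSet_Ioi] with l hl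
      have : 0 < l := hpos.trans hl
      positivity
  calc _ ≤ a ^ 2 * a⁻¹ := by gcongr; exact h1.trans h2.le
    _ = a := by rw [sq, mul_assoc, ENNReal.mul_inv_cancel ha0 ha, mul_one]

/-- With `N = ntMax f`, Chebyshev on the good set gives `|{|v| > l}| ≤ 7 |{N > l}| + 6 l⁻² ∫_{N ≤ l}
N²`. Integrating over `l`, each term contributes a multiple of `∫ N`, the second because `a² ∫_a^∞
l⁻² dl = a`; thus 13 = 7 + 6. -/
theorem lintegral_conj_le {f : ℝ → ℝ} (hf : Integrable f) (hfin : ∫⁻ x, ntMax f x ≠ ∞)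
    {η : ℝ} (hη : 0 < η) :
    ∫⁻ x : ℝ, ‖(analyticExt f (x + η * Complex.I)).im‖ₑ ≤ 13 * ∫⁻ x, ntMax f x := by
  set v : ℝ → ℝ := fun x => (analyticExt f (x + η * Complex.I)).im with hv
  have hvc : Continuous v :=
    Complex.continuous_im.comp (continuous_analyticExt_graph hf hη (fun _ => le_rfl) continuous_const)
  have hN := measurable_ntMax f
  have hm1 : Measurable (Function.uncurry fun (x l : ℝ) =>
      Set.indicator {l | ENNReal.ofReal l < ‖v x‖ₑ} (1 : ℝ → ℝ≥0∞) l) :=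
    (measurable_one (α := ℝ≥0∞) (β := ℝ × ℝ)).indicator
      (measurableSet_lt (f := fun p : ℝ × ℝ => ENNReal.ofReal p.2) (g := fun p => ‖v p.1‖ₑ)
        (ENNReal.measurable_ofReal.comp measurable_snd)
        (hvc.measurable.enorm.comp measurable_fst))
  have hm2 : Measurable (Function.uncurry fun (l x : ℝ) =>
      Set.indicator {l | ENNReal.ofReal l < ntMax f x} (1 : ℝ → ℝ≥0∞) l) :=
    (measurable_one (α := ℝ≥0∞) (β := ℝ × ℝ)).indicator
      (measurableSet_lt (f := fun p : ℝ × ℝ => ENNReal.ofReal p.1) (g := fun p => ntMax f p.2)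
        (ENNReal.measurable_ofReal.comp measurable_fst) (hN.comp measurable_snd))
  have hm3 : Measurable (Function.uncurry fun (l x : ℝ) => (ENNReal.ofReal l ^ 2)⁻¹ *
      (ntMax f x ^ 2 * Set.indicator {l | ntMax f x ≤ ENNReal.ofReal l} (1 : ℝ → ℝ≥0∞) l)) := by
    refine Measurable.mul (by fun_prop) (Measurable.mul ((hN.comp measurable_snd).pow_const 2) ?_)
    exact (measurable_one (α := ℝ≥0∞) (β := ℝ × ℝ)).indicator
      (measurableSet_le (f := fun p : ℝ × ℝ => ntMax f p.2) (g := fun p => ENNReal.ofReal p.1)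
        (hN.comp measurable_snd) (ENNReal.measurable_ofReal.comp measurable_fst))
  have hlev : ∀ l ∈ Set.Ioi (0 : ℝ), ∫⁻ x, Set.indicator {l | ENNReal.ofReal l < ‖v x‖ₑ} 1 l
      ≤ 7 * (∫⁻ x, Set.indicator {l | ENNReal.ofReal l < ntMax f x} 1 l) +
        6 * ∫⁻ x, (ENNReal.ofReal l ^ 2)⁻¹ *
          (ntMax f x ^ 2 * Set.indicator {l | ntMax f x ≤ ENNReal.ofReal l} 1 l) := by
    intro l hl
    have hl0 : (0 : ℝ) < l := hl
    have hL0 : ENNReal.ofReal l ≠ 0 := by simpa using hl0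
    have hLt : ENNReal.ofReal l ≠ ∞ := ENNReal.ofReal_ne_top
    set L := ENNReal.ofReal l with hL
    set E : Set ℝ := {x | ntMax f x ≤ L} with hE
    have hEm : MeasurableSet E := measurableSet_le hN measurable_const
    have hEc : Eᶜ = {x | L < ntMax f x} := by ext x; simp [hE]
    -- An empty good set would mean `ntMax f ≥ L > 0` everywhere, contradicting integrability on the
    -- line.
    have hne : E.Nonempty := by
      by_contra hcon
      rw [Set.not_nonempty_iff_eq_empty] at hcon
      have h1 : ∀ x, L ≤ ntMax f x := fun x => by
        have : x ∉ E := by rw [hcon]; simp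
        exact (not_le.1 this).le
      have h2 := lintegral_mono (μ := volume) h1
      rw [lintegral_const, Real.volume_univ, ENNReal.mul_top hL0] at h2
      exact hfin (top_le_iff.1 h2)
    have hgood := lintegral_conj_sq_good_le hf hη hne
    have e1 : ∫⁻ x, Set.indicator {l | ENNReal.ofReal l < ‖v x‖ₑ} 1 l = volume {x | L < ‖v x‖ₑ} := by
      rw [← lintegral_indicator_one (measurableSet_lt measurable_const hvc.measurable.enorm)]
      rfl
    have e2 : ∫⁻ x, Set.indicator {l | ENNReal.ofReal l < ntMax f x} 1 l
        = volume {x | L < ntMax f x} := by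
      rw [← lintegral_indicator_one (measurableSet_lt measurable_const hN)]
      rfl
    have e3 : ∫⁻ x, (L ^ 2)⁻¹ *
          (ntMax f x ^ 2 * Set.indicator {l | ntMax f x ≤ ENNReal.ofReal l} 1 l)
        = (L ^ 2)⁻¹ * ∫⁻ x in E, ntMax f x ^ 2 := by
      rw [lintegral_const_mul' _ _ (by simp [hL0]), ← lintegral_indicator hEm]
      congr 1
      apply lintegral_congr
      intro x
      by_cases hx : ntMax f x ≤ ENNReal.ofReal l
      · rw [Set.indicator_of_mem (show l ∈ {l : ℝ | ntMax f x ≤ ENNReal.ofReal l} from hx),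
          Set.indicator_of_mem (show x ∈ E from hx)]
        simp
      · rw [Set.indicator_of_notMem (show l ∉ {l : ℝ | ntMax f x ≤ ENNReal.ofReal l} from hx),
          Set.indicator_of_notMem (show x ∉ E from hx)]
        simp
    rw [e1, e2, e3]
    have hcheb : L ^ 2 * volume ({x | L < ‖v x‖ₑ} ∩ E) ≤ ∫⁻ x in E, ‖v x‖ₑ ^ 2 := by
      have := mul_meas_ge_le_lintegral (μ := volume.restrict E) (hvc.measurable.enorm.pow_const 2)
        (L ^ 2)
      refine le_trans (mul_le_mul_right ?_ _) this
      rw [Measure.restrict_apply (measurableSet_le measurable_const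
        (hvc.measurable.enorm.pow_const 2))]
      apply measure_mono
      rintro x ⟨hx, hxE⟩
      have hx' : L ≤ ‖v x‖ₑ := le_of_lt hx
      exact ⟨Set.mem_ofPred_eq ▸ pow_le_pow_left' hx' 2, hxE⟩
    have hLL : (L ^ 2)⁻¹ * L ^ 2 = 1 := ENNReal.inv_mul_cancel (by simp [hL0]) (by simp [hLt])
    calc volume {x | L < ‖v x‖ₑ}
        ≤ volume ({x | L < ‖v x‖ₑ} ∩ E) + volume Eᶜ := by
          refine (measure_mono ?_).trans (measure_union_le _ _)
          intro x hx
          by_cases hxE : x ∈ E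
          · exact Or.inl ⟨hx, hxE⟩
          · exact Or.inr hxE
      _ = (L ^ 2)⁻¹ * (L ^ 2 * volume ({x | L < ‖v x‖ₑ} ∩ E)) + volume Eᶜ := by
          rw [← mul_assoc, hLL, one_mul]
      _ ≤ (L ^ 2)⁻¹ * (6 * ((∫⁻ x in E, ntMax f x ^ 2) + L ^ 2 * volume {x | L < ntMax f x}))
            + volume Eᶜ := by
          exact add_le_add_left (mul_le_mul_right (hcheb.trans hgood) _) _
      _ = 6 * ((L ^ 2)⁻¹ * ∫⁻ x in E, ntMax f x ^ 2)
            + (6 * (((L ^ 2)⁻¹ * L ^ 2) * volume {x | L < ntMax f x}) + volume Eᶜ) := by ring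
      _ = _ := by rw [hLL, hEc]; ring
  calc ∫⁻ x, ‖v x‖ₑ
      = ∫⁻ x, ∫⁻ l in Set.Ioi (0 : ℝ), Set.indicator {l | ENNReal.ofReal l < ‖v x‖ₑ} 1 l := by
        simp_rw [lintegral_indicator_lt_Ioi]
    _ = ∫⁻ l in Set.Ioi (0 : ℝ), ∫⁻ x, Set.indicator {l | ENNReal.ofReal l < ‖v x‖ₑ} 1 l :=
        lintegral_lintegral_swap hm1.aemeasurable
    _ ≤ ∫⁻ l in Set.Ioi (0 : ℝ), (7 * (∫⁻ x, Set.indicator {l | ENNReal.ofReal l < ntMax f x} 1 l) +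
        6 * ∫⁻ x, (ENNReal.ofReal l ^ 2)⁻¹ *
          (ntMax f x ^ 2 * Set.indicator {l | ntMax f x ≤ ENNReal.ofReal l} 1 l)) :=
        setLIntegral_mono' measurableSet_Ioi hlev
    _ = 7 * (∫⁻ x, ∫⁻ l in Set.Ioi (0 : ℝ), Set.indicator {l | ENNReal.ofReal l < ntMax f x} 1 l) +
        6 * ∫⁻ x, ∫⁻ l in Set.Ioi (0 : ℝ), (ENNReal.ofReal l ^ 2)⁻¹ *
          (ntMax f x ^ 2 * Set.indicator {l | ntMax f x ≤ ENNReal.ofReal l} 1 l) := by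
        have hm4 : Measurable fun l : ℝ =>
            7 * ∫⁻ x, Set.indicator {l | ENNReal.ofReal l < ntMax f x} (1 : ℝ → ℝ≥0∞) l :=
          Measurable.const_mul hm2.lintegral_prod_right' 7
        rw [lintegral_add_left hm4,
          lintegral_const_mul' _ _ (by norm_num), lintegral_const_mul' _ _ (by norm_num),
          lintegral_lintegral_swap hm2.aemeasurable, lintegral_lintegral_swap hm3.aemeasurable]
    _ ≤ 7 * (∫⁻ x, ntMax f x) + 6 * ∫⁻ x, ntMax f x := by
        gcongr with x x
        · exact (lintegral_indicator_lt_Ioi _).le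
        · exact lintegral_inv_sq_tail_le _
    _ = 13 * ∫⁻ x, ntMax f x := by rw [← add_mul]; norm_num

end RealHardy

namespace RealHardy

open Filter Topology

/-! ### Distributions with integrable maximal function are integrable functions -/

/-- A linear functional dominated by the norm of a linear map `T` factors through `T`. -/
theorem exists_clm_eq_comp {V E : Type*} [AddCommGroup V] [Module ℂ V] [NormedAddCommGroup E]
    [NormedSpace ℂ E] (T : V →ₗ[ℂ] E) (f : V →ₗ[ℂ] ℂ) (C : ℝ) (h : ∀ v, ‖f v‖ ≤ C * ‖T v‖) :
    ∃ g : E →L[ℂ] ℂ, ∀ v, f v = g (T v) := by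
  obtain ⟨s, hs⟩ := T.rangeRestrict.exists_rightInverse_of_surjective T.range_rangeRestrict
  have hs' : ∀ w : T.range, T (s w) = w := fun w => by
    have := congrArg (fun r => ((r w : T.range) : E)) hs
    simpa using this
  let g₀ : T.range →L[ℂ] ℂ := (f ∘ₗ s).mkContinuous C (fun w => by
    have := h (s w)
    rw [hs'] at this
    simpa using this)
  obtain ⟨g, hg, -⟩ := exists_extension_norm_eq T.range g₀
  refine ⟨g, fun v => ?_⟩
  have h1 : g (T v) = f (s (T.rangeRestrict v)) := hg (T.rangeRestrict v)
  rw [h1]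
  have h2 := h (v - s (T.rangeRestrict v))
  rw [map_sub, map_sub, hs'] at h2
  have h3 : ((T.rangeRestrict v : T.range) : E) = T v := rfl
  rw [h3, sub_self, norm_zero, mul_zero, norm_le_zero_iff] at h2
  exact sub_eq_zero.mp h2

/-- The test functions supported in `[-M, M]`. -/
def testOn (M : ℝ) : Submodule ℂ 𝓢(ℝ, ℂ) where
  carrier := {φ | ∀ x, M < |x| → φ x = 0}
  add_mem' {φ ψ} hφ hψ x hx := by simp [hφ x hx, hψ x hx]
  zero_mem' x _ := rfl
  smul_mem' c φ hφ x hx := by simp [hφ x hx]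

theorem continuous_iteratedDeriv (φ : 𝓢(ℝ, ℂ)) (l : ℕ) : Continuous (iteratedDeriv l φ) :=
  (φ.smooth l).continuous_iteratedDeriv l le_rfl

/-- The derivatives of order at most `L`, as continuous functions on `[-M, M]`. -/
noncomputable def jet (M : ℝ) (L : ℕ) : 𝓢(ℝ, ℂ) →ₗ[ℂ] (Fin (L + 1) → C(Set.Icc (-M) M, ℂ)) where
  toFun φ l := ⟨fun y => iteratedDeriv l φ y,
    (continuous_iteratedDeriv φ l).comp continuous_subtype_val⟩
  map_add' φ ψ := by
    ext l y
    have := iteratedDeriv_add (n := (l : ℕ)) (x := (y : ℝ)) (f := φ) (g := ψ)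
      ((φ.smooth l).contDiffAt) ((ψ.smooth l).contDiffAt)
    exact this
  map_smul' c φ := by
    ext l y
    have := iteratedDeriv_const_smul_field (n := (l : ℕ)) (x := (y : ℝ)) c (φ : ℝ → ℂ)
    exact this

theorem jet_apply (M : ℝ) (L : ℕ) (φ : 𝓢(ℝ, ℂ)) (l : Fin (L + 1)) (y : Set.Icc (-M) M) :
    jet M L φ l y = iteratedDeriv l φ y := rfl

theorem iteratedDeriv_eq_zero_of_mem_testOn {M : ℝ} {φ : 𝓢(ℝ, ℂ)} (hφ : φ ∈ testOn M) (l : ℕ)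
    {x : ℝ} (hx : M < |x|) : iteratedDeriv l φ x = 0 := by
  have h : (φ : ℝ → ℂ) =ᶠ[𝓝 x] fun _ => (0 : ℂ) := by
    filter_upwards [(isOpen_lt continuous_const continuous_abs).mem_nhds hx] with y hy
    exact hφ y hy
  rw [h.iteratedDeriv_eq l]
  simp

/-- On a fixed interval the polynomial weights of the Schwartz seminorms are bounded, so only sup
norms of derivatives remain. This replaces the Fréchet space by a Banach space in which Bochner
integrals make sense. -/
theorem seminorm_le_jet {M : ℝ} {L k n : ℕ} (hM : 0 ≤ M) (hn : n ≤ L) {φ : 𝓢(ℝ, ℂ)}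
    (hφ : φ ∈ testOn M) : SchwartzMap.seminorm ℂ k n φ ≤ M ^ k * ‖jet M L φ‖ := by
  refine SchwartzMap.seminorm_le_bound' ℂ k n φ (by positivity) fun x => ?_
  by_cases hx : M < |x|
  · rw [iteratedDeriv_eq_zero_of_mem_testOn hφ n hx]
    simp only [norm_zero, mul_zero]
    positivity
  rw [not_lt] at hx
  have hx' := abs_le.mp hx
  have h1 : ‖iteratedDeriv n φ x‖ ≤ ‖jet M L φ‖ := by
    refine le_trans ?_ (norm_le_pi_norm _ (⟨n, by omega⟩ : Fin (L + 1)))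
    exact (jet M L φ ⟨n, by omega⟩).norm_coe_le_norm ⟨x, hx'⟩
  gcongr

/-- A tempered distribution, on test functions supported in a fixed interval, is a continuous
function of finitely many derivatives. -/
theorem exists_eq_jet (f : 𝓢'(ℝ, ℂ)) : ∃ L : ℕ, ∀ M : ℝ, 0 ≤ M →
    ∃ g : (Fin (L + 1) → C(Set.Icc (-M) M, ℂ)) →L[ℂ] ℂ, ∀ φ ∈ testOn M, f φ = g (jet M L φ) := by
  let q : Seminorm ℂ 𝓢(ℝ, ℂ) := (normSeminorm ℂ ℂ).comp f.toLinearMap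
  have hq : Continuous q := continuous_norm.comp f.cont
  obtain ⟨s, C, hC, hs⟩ := Seminorm.bound_of_continuous (schwartz_withSeminorms ℂ ℝ ℂ) q hq
  refine ⟨s.sup Prod.snd, fun M hM => ?_⟩
  obtain ⟨g, hg⟩ := exists_clm_eq_comp ((jet M (s.sup Prod.snd)).domRestrict (testOn M))
    (f.toLinearMap.domRestrict (testOn M)) (C * ∑ i ∈ s, M ^ i.1) (by
    rintro ⟨φ, hφ⟩
    have h1 : ‖f φ‖ ≤ C * (s.sup (schwartzSeminormFamily ℂ ℝ ℂ)) φ := hs φ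
    refine h1.trans ?_
    rw [mul_assoc]
    refine mul_le_mul_of_nonneg_left ?_ C.2
    refine Seminorm.finset_sup_apply_le (mul_nonneg (by positivity) (norm_nonneg _))
      fun i hi => ?_
    refine (seminorm_le_jet hM (Finset.le_sup (f := Prod.snd) hi) hφ).trans ?_
    refine mul_le_mul_of_nonneg_right ?_ (norm_nonneg _)
    exact Finset.single_le_sum (f := fun i : ℕ × ℕ => M ^ i.1) (fun i _ => by positivity) hi)
  exact ⟨g, fun φ hφ => hg ⟨φ, hφ⟩⟩

theorem contDiff_dilation {χ : ℝ → ℂ} (hs : ContDiff ℝ (⊤ : ℕ∞) χ) (t : ℝ) :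
    ContDiff ℝ (⊤ : ℕ∞) fun u => (t : ℂ)⁻¹ * χ (u / t) :=
  contDiff_const.mul (hs.comp (contDiff_id.div_const _))

theorem iteratedDeriv_kernel {χ : ℝ → ℂ} (hs : ContDiff ℝ (⊤ : ℕ∞) χ) (hc : HasCompactSupport χ)
    (t : Set.Ioi (0 : ℝ)) (x : ℝ) (l : ℕ) (y : ℝ) :
    iteratedDeriv l (kernel χ hs hc t x) y =
      (-1 : ℝ) ^ l • iteratedDeriv l (fun u => ((t : ℝ) : ℂ)⁻¹ * χ (u / (t : ℝ))) (x - y) :=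
  congrFun (iteratedDeriv_comp_const_sub (f := fun u : ℝ => ((t : ℝ) : ℂ)⁻¹ * χ (u / (t : ℝ))) l x) y

theorem continuous_jet_kernel {χ : ℝ → ℂ} (hs : ContDiff ℝ (⊤ : ℕ∞) χ) (hc : HasCompactSupport χ)
    (t : Set.Ioi (0 : ℝ)) (M : ℝ) (L : ℕ) : Continuous fun x => jet M L (kernel χ hs hc t x) := by
  refine continuous_pi fun l => ?_
  have hκ : Continuous (iteratedDeriv l (fun u => ((t : ℝ) : ℂ)⁻¹ * χ (u / (t : ℝ)))) :=
    (contDiff_dilation hs t).continuous_iteratedDeriv l (mod_cast le_top)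
  let K : C(ℝ × Set.Icc (-M) M, ℂ) := ⟨fun p => (-1 : ℝ) ^ (l : ℕ) •
    iteratedDeriv l (fun u => ((t : ℝ) : ℂ)⁻¹ * χ (u / (t : ℝ))) (p.1 - p.2), by fun_prop⟩
  have : (fun x => jet M L (kernel χ hs hc t x) l) = K.curry := by
    ext x y
    exact iteratedDeriv_kernel hs hc t x l y
  rw [this]
  exact K.curry.continuous

theorem kernel_mem_testOn {χ : ℝ → ℂ} (hs : ContDiff ℝ (⊤ : ℕ∞) χ) (hc : HasCompactSupport χ)
    {R : ℝ} (hR : ∀ u, R < |u| → χ u = 0) (t : Set.Ioi (0 : ℝ)) {x X : ℝ} (hx : |x| ≤ X) :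
    kernel χ hs hc t x ∈ testOn (X + t * R) := by
  intro y hy
  rw [kernel_apply, hR, mul_zero]
  have ht : (0 : ℝ) < t := t.2
  rw [abs_div, abs_of_pos ht, lt_div_iff₀ ht]
  have := abs_sub_abs_le_abs_sub y x
  rw [abs_sub_comm y x] at this
  linarith

theorem exists_support_bound {χ : ℝ → ℂ} (hc : HasCompactSupport χ) :
    ∃ R : ℝ, 0 ≤ R ∧ ∀ u, R < |u| → χ u = 0 := by
  obtain ⟨R, hR⟩ := hc.isCompact.isBounded.subset_closedBall 0
  refine ⟨max R 0, le_max_right _ _, fun u hu => ?_⟩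
  refine image_eq_zero_of_notMem_tsupport fun h => ?_
  have := hR h
  rw [Metric.mem_closedBall, dist_zero_right, Real.norm_eq_abs] at this
  exact absurd (this.trans (le_max_left R 0)) (not_le.mpr hu)

/-- For `x` near `x₀` all kernels are supported in one interval, where `f` factors through the jet,
and the jet of the kernel depends continuously on `x`. -/
theorem continuous_conv (f : 𝓢'(ℝ, ℂ)) {χ : ℝ → ℂ} (hs : ContDiff ℝ (⊤ : ℕ∞) χ)
    (hc : HasCompactSupport χ) (t : Set.Ioi (0 : ℝ)) : Continuous (conv f χ hs hc t) := by
  obtain ⟨R, hR0, hR⟩ := exists_support_bound hc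
  obtain ⟨L, hL⟩ := exists_eq_jet f
  have ht : (0 : ℝ) < t := t.2
  rw [continuous_iff_continuousAt]
  intro x₀
  obtain ⟨g, hg⟩ := hL (|x₀| + 1 + t * R) (by positivity)
  have h1 : ContinuousAt (fun x => g (jet (|x₀| + 1 + t * R) L (kernel χ hs hc t x))) x₀ :=
    (g.continuous.comp (continuous_jet_kernel hs hc t _ L)).continuousAt
  refine h1.congr ?_
  have : ∀ᶠ x in 𝓝 x₀, |x| < |x₀| + 1 :=
    (continuous_abs.tendsto x₀).eventually_lt_const (by linarith)
  filter_upwards [this] with x hx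
  exact (hg _ (kernel_mem_testOn hs hc hR t hx.le)).symm

theorem measurable_maximal (f : 𝓢'(ℝ, ℂ)) {χ : ℝ → ℂ} (hs : ContDiff ℝ (⊤ : ℕ∞) χ)
    (hc : HasCompactSupport χ) : Measurable (maximal f χ hs hc) := by
  refine LowerSemicontinuous.measurable ?_
  exact lowerSemicontinuous_iSup fun t =>
    (continuous_conv f hs hc t).enorm.lowerSemicontinuous

open scoped Convolution

theorem contDiff_iteratedDeriv {g : ℝ → ℂ} (hg : ContDiff ℝ (⊤ : ℕ∞) g) (n : ℕ) :
    ContDiff ℝ (⊤ : ℕ∞) (iteratedDeriv n g) := by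
  induction n with
  | zero => simpa using hg
  | succ n ih =>
    rw [iteratedDeriv_succ]
    exact (contDiff_infty_iff_deriv.mp ih).2

theorem hasCompactSupport_iteratedDeriv {g : ℝ → ℂ} (hg : HasCompactSupport g) (n : ℕ) :
    HasCompactSupport (iteratedDeriv n g) := by
  induction n with
  | zero => simpa using hg
  | succ n ih =>
    rw [iteratedDeriv_succ]
    exact ih.deriv

theorem iteratedDeriv_convolution_right {f g : ℝ → ℂ} (hf : LocallyIntegrable f)
    (hcg : HasCompactSupport g) (hg : ContDiff ℝ (⊤ : ℕ∞) g) (n : ℕ) :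
    iteratedDeriv n (f ⋆[ContinuousLinearMap.mul ℝ ℂ] g) =
      f ⋆[ContinuousLinearMap.mul ℝ ℂ] iteratedDeriv n g := by
  induction n with
  | zero => simp
  | succ n ih =>
    rw [iteratedDeriv_succ, ih, iteratedDeriv_succ]
    ext x
    exact ((hasCompactSupport_iteratedDeriv hcg n).hasDerivAt_convolution_right _ hf
      ((contDiff_iteratedDeriv hg n).of_le (mod_cast le_top)) x).deriv

theorem iteratedDeriv_convolution_left {f g : ℝ → ℂ} (hg : LocallyIntegrable g)
    (hcf : HasCompactSupport f) (hf : ContDiff ℝ (⊤ : ℕ∞) f) (n : ℕ) :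
    iteratedDeriv n (f ⋆[ContinuousLinearMap.mul ℝ ℂ] g) =
      iteratedDeriv n f ⋆[ContinuousLinearMap.mul ℝ ℂ] g := by
  induction n with
  | zero => simp
  | succ n ih =>
    rw [iteratedDeriv_succ, ih, iteratedDeriv_succ]
    ext x
    exact ((hasCompactSupport_iteratedDeriv hcf n).hasDerivAt_convolution_left _
      ((contDiff_iteratedDeriv hf n).of_le (mod_cast le_top)) hg x).deriv

theorem hasCompactSupport_neg_dilation {χ : ℝ → ℂ} (hc : HasCompactSupport χ)
    (t : Set.Ioi (0 : ℝ)) :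
    HasCompactSupport fun u : ℝ => ((t : ℝ) : ℂ)⁻¹ * χ (-u / (t : ℝ)) := by
  have ht : (t : ℝ) ≠ 0 := ne_of_gt t.2
  exact (hc.comp_homeomorph ((Homeomorph.neg ℝ).trans
    (Homeomorph.mulRight₀ (t : ℝ)⁻¹ (inv_ne_zero ht)))).mul_left

theorem contDiff_neg_dilation {χ : ℝ → ℂ} (hs : ContDiff ℝ (⊤ : ℕ∞) χ) (t : ℝ) :
    ContDiff ℝ (⊤ : ℕ∞) fun u : ℝ => (t : ℂ)⁻¹ * χ (-u / t) :=
  (contDiff_dilation hs t).comp contDiff_neg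

theorem hasCompactSupport_convolution_mul {f g : ℝ → ℂ} (hf : HasCompactSupport f)
    (hg : HasCompactSupport g) :
    HasCompactSupport (f ⋆[ContinuousLinearMap.mul ℝ ℂ] g) :=
  HasCompactSupport.convolution _ hf hg

theorem contDiff_convolution_mul {f g : ℝ → ℂ} (hf : Continuous f)
    (hcg : HasCompactSupport g) (hg : ContDiff ℝ (⊤ : ℕ∞) g) :
    ContDiff ℝ (⊤ : ℕ∞) (f ⋆[ContinuousLinearMap.mul ℝ ℂ] g) :=
  hcg.contDiff_convolution_right _ hf.locallyIntegrable hg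

/-- The test function `y ↦ ∫ φ x * χ_t (x - y) dx`. -/
noncomputable def smoothing (χ : ℝ → ℂ) (hs : ContDiff ℝ (⊤ : ℕ∞) χ) (hc : HasCompactSupport χ)
    (t : Set.Ioi (0 : ℝ)) (φ : 𝓢(ℝ, ℂ)) (hφ : HasCompactSupport φ) : 𝓢(ℝ, ℂ) :=
  HasCompactSupport.toSchwartzMap
    (hasCompactSupport_convolution_mul hφ (hasCompactSupport_neg_dilation hc t))
    (contDiff_convolution_mul φ.continuous (hasCompactSupport_neg_dilation hc t)
      (contDiff_neg_dilation hs t))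

theorem iteratedDeriv_smoothing {χ : ℝ → ℂ} (hs : ContDiff ℝ (⊤ : ℕ∞) χ)
    (hc : HasCompactSupport χ) (t : Set.Ioi (0 : ℝ)) {φ : 𝓢(ℝ, ℂ)} (hφ : HasCompactSupport φ)
    (l : ℕ) (y : ℝ) : iteratedDeriv l (smoothing χ hs hc t φ hφ) y =
      ∫ x, φ x * iteratedDeriv l (kernel χ hs hc t x) y := by
  have h1 : iteratedDeriv l (smoothing χ hs hc t φ hφ) y =
      (φ ⋆[ContinuousLinearMap.mul ℝ ℂ]
        iteratedDeriv l fun u : ℝ => ((t : ℝ) : ℂ)⁻¹ * χ (-u / (t : ℝ))) y :=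
    congrFun (iteratedDeriv_convolution_right (φ.continuous.locallyIntegrable)
      (hasCompactSupport_neg_dilation hc t) (contDiff_neg_dilation hs t) l) y
  rw [h1, convolution_def]
  refine integral_congr_ae (Eventually.of_forall fun x => ?_)
  have h2 := congrFun (iteratedDeriv_comp_sub_const l
    (fun u : ℝ => ((t : ℝ) : ℂ)⁻¹ * χ (-u / (t : ℝ))) x) y
  simp only [neg_sub] at h2
  simp only [ContinuousLinearMap.mul_apply']
  rw [← h2]
  rfl

/-- Here the derivatives fall on `φ`, which serves the limit `t → 0`; in `iteratedDeriv_smoothing`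
they fall on the kernel, which serves the pairing with the distribution. -/
theorem iteratedDeriv_smoothing' {χ : ℝ → ℂ} (hs : ContDiff ℝ (⊤ : ℕ∞) χ)
    (hc : HasCompactSupport χ) (t : Set.Ioi (0 : ℝ)) {φ : 𝓢(ℝ, ℂ)} (hφ : HasCompactSupport φ)
    (l : ℕ) (y : ℝ) : iteratedDeriv l (smoothing χ hs hc t φ hφ) y =
      ∫ v, iteratedDeriv l φ (y + t * v) * χ v := by
  have ht : (0 : ℝ) < t := t.2
  have h1 : iteratedDeriv l (smoothing χ hs hc t φ hφ) y =
      (iteratedDeriv l φ ⋆[ContinuousLinearMap.mul ℝ ℂ]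
        fun u : ℝ => ((t : ℝ) : ℂ)⁻¹ * χ (-u / (t : ℝ))) y :=
    congrFun (iteratedDeriv_convolution_left
      (contDiff_neg_dilation hs t).continuous.locallyIntegrable hφ (φ.smooth ⊤) l) y
  rw [h1, convolution_def]
  have h2 := integral_sub_right_eq_self (μ := volume)
    (fun x : ℝ => iteratedDeriv l φ (y + t * (x / t)) * χ (x / t)) y
  have h3 := Measure.integral_comp_div (fun v : ℝ => iteratedDeriv l φ (y + t * v) * χ v) (t : ℝ)
  rw [h3, abs_of_pos ht, Complex.real_smul] at h2
  have h4 : (((t : ℝ)) : ℂ) ≠ 0 := by exact_mod_cast ht.ne'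
  rw [← mul_right_inj' h4, ← h2, ← integral_const_mul]
  refine integral_congr_ae (Eventually.of_forall fun x => ?_)
  simp only [ContinuousLinearMap.mul_apply', neg_sub]
  rw [mul_div_cancel₀ _ ht.ne', add_sub_cancel]
  field_simp

theorem smoothing_mem_testOn {χ : ℝ → ℂ} (hs : ContDiff ℝ (⊤ : ℕ∞) χ) (hc : HasCompactSupport χ)
    {R : ℝ} (hR : ∀ u, R < |u| → χ u = 0) (t : Set.Ioi (0 : ℝ)) {φ : 𝓢(ℝ, ℂ)}
    (hφ : HasCompactSupport φ) {M : ℝ} (hM : φ ∈ testOn M) :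
    smoothing χ hs hc t φ hφ ∈ testOn (M + t * R) := by
  intro y hy
  have h := iteratedDeriv_smoothing hs hc t hφ 0 y
  simp only [iteratedDeriv_zero] at h
  rw [h]
  refine integral_eq_zero_of_ae (Eventually.of_forall fun x => ?_)
  by_cases hx : M < |x|
  · simp [hM x hx]
  · have := kernel_mem_testOn hs hc hR t (not_lt.mp hx) y hy
    simp [this]

theorem clm_integral_smul {E : Type*} [NormedAddCommGroup E] [NormedSpace ℂ E] [CompleteSpace E]
    (g : E →L[ℂ] ℂ) {φ : ℝ → ℂ} (hφ : Continuous φ) (hφc : HasCompactSupport φ) {J : ℝ → E}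
    (hJ : Continuous J) : g (∫ x, φ x • J x) = ∫ x, φ x * g (J x) := by
  have hint : Integrable fun x => φ x • J x :=
    (hφ.smul hJ).integrable_of_hasCompactSupport hφc.smul_right
  rw [← g.integral_comp_comm hint]
  simp only [map_smul, smul_eq_mul]

/-- Pairing a distribution with a smoothed test function. -/
theorem apply_smoothing (f : 𝓢'(ℝ, ℂ)) {χ : ℝ → ℂ} (hs : ContDiff ℝ (⊤ : ℕ∞) χ)
    (hc : HasCompactSupport χ) (t : Set.Ioi (0 : ℝ)) {φ : 𝓢(ℝ, ℂ)} (hφ : HasCompactSupport φ) :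
    f (smoothing χ hs hc t φ hφ) = ∫ x, φ x * conv f χ hs hc t x := by
  obtain ⟨R, hR0, hR⟩ := exists_support_bound hc
  obtain ⟨M, hM0, hM⟩ := exists_support_bound hφ
  obtain ⟨L, hL⟩ := exists_eq_jet f
  have ht : (0 : ℝ) < t := t.2
  obtain ⟨g, hg⟩ := hL (M + t * R) (by positivity)
  rw [hg _ (smoothing_mem_testOn hs hc hR t hφ hM)]
  have hJ := continuous_jet_kernel hs hc t (M + t * R) L
  have h1 : jet (M + t * R) L (smoothing χ hs hc t φ hφ) =
      ∫ x, φ x • jet (M + t * R) L (kernel χ hs hc t x) := by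
    ext l y
    rw [jet_apply, iteratedDeriv_smoothing]
    exact (clm_integral_smul ((ContinuousMap.evalCLM ℂ y).comp (ContinuousLinearMap.proj l))
      φ.continuous hφ hJ).symm
  rw [h1, clm_integral_smul g φ.continuous hφ hJ]
  refine integral_congr_ae (Eventually.of_forall fun x => ?_)
  by_cases hx : M < |x|
  · simp [hM x hx]
  · refine congrArg (φ x * ·) ?_
    exact (hg _ (kernel_mem_testOn hs hc hR t (not_lt.mp hx))).symm

/-- Each derivative of `φ` is Lipschitz by the bound on the next one, so the jets of the smoothings
converge uniformly at rate `t ∫ |v| |χ v| dv`. -/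
theorem tendsto_apply_smoothing (f : 𝓢'(ℝ, ℂ)) {χ : ℝ → ℂ} (hs : ContDiff ℝ (⊤ : ℕ∞) χ)
    (hc : HasCompactSupport χ) {φ : 𝓢(ℝ, ℂ)} (hφ : HasCompactSupport φ) :
    Tendsto (fun n : ℕ => f (smoothing χ hs hc ⟨1 / ((n : ℝ) + 1), Set.mem_Ioi.mpr Nat.one_div_pos_of_nat⟩ φ hφ))
      atTop (𝓝 ((∫ x, χ x) * f φ)) := by
  obtain ⟨R, hR0, hR⟩ := exists_support_bound hc
  obtain ⟨M, hM0, hM⟩ := exists_support_bound hφ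
  obtain ⟨L, hL⟩ := exists_eq_jet f
  obtain ⟨g, hg⟩ := hL (M + R) (by positivity)
  have hmem : φ ∈ testOn (M + R) := fun x hx => hM x (by linarith)
  have hmem' : ∀ n : ℕ, smoothing χ hs hc ⟨1 / ((n : ℝ) + 1), Set.mem_Ioi.mpr Nat.one_div_pos_of_nat⟩ φ hφ ∈
      testOn (M + R) := by
    intro n x hx
    refine smoothing_mem_testOn hs hc hR _ hφ hM x (lt_of_le_of_lt ?_ hx)
    have : 1 / ((n : ℝ) + 1) ≤ 1 := by
      rw [div_le_one (by positivity)]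
      linarith [n.cast_nonneg (α := ℝ)]
    have := mul_le_mul_of_nonneg_right this hR0
    linarith
  simp_rw [fun n => hg _ (hmem' n)]
  rw [hg _ hmem, ← smul_eq_mul, ← map_smul]
  refine (g.continuous.tendsto _).comp ?_
  rw [tendsto_pi_nhds]
  intro l
  rw [tendsto_iff_norm_sub_tendsto_zero]
  obtain ⟨B, hB⟩ : ∃ B, ∀ x, ‖iteratedDeriv (l + 1) φ x‖ ≤ B :=
    ⟨_, fun x => by simpa using φ.le_seminorm' ℝ 0 (l + 1) x⟩
  have hB0 : 0 ≤ B := (norm_nonneg _).trans (hB 0)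
  have hlip : ∀ x y, ‖iteratedDeriv l φ y - iteratedDeriv l φ x‖ ≤ B * ‖y - x‖ := fun x y => by
    refine convex_univ.norm_image_sub_le_of_norm_deriv_le (f := iteratedDeriv l φ)
      (fun z _ => ?_) (fun z _ => ?_) (Set.mem_univ x) (Set.mem_univ y)
    · exact ((φ.smooth (l + 1)).differentiable_iteratedDeriv l
        (by exact_mod_cast Nat.lt_succ_self l)).differentiableAt
    · rw [← iteratedDeriv_succ]
      exact hB z
  have hχi : Integrable χ := hs.continuous.integrable_of_hasCompactSupport hc
  have hχR : Integrable fun v => |v| * ‖χ v‖ :=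
    (continuous_abs.mul hs.continuous.norm).integrable_of_hasCompactSupport hc.norm.mul_left
  have hlim : Tendsto (fun n : ℕ => B * (1 / ((n : ℝ) + 1)) * ∫ v, |v| * ‖χ v‖) atTop (𝓝 0) := by
    have := (tendsto_one_div_add_atTop_nhds_zero_nat (𝕜 := ℝ)).const_mul B
    have := this.mul_const (∫ v, |v| * ‖χ v‖)
    simpa using this
  refine squeeze_zero (fun n => norm_nonneg _) (fun n => ?_) hlim
  set t : Set.Ioi (0 : ℝ) := ⟨1 / ((n : ℝ) + 1), Set.mem_Ioi.mpr Nat.one_div_pos_of_nat⟩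
    with htdef
  have ht : (0 : ℝ) < t := t.2
  have htn : 1 / ((n : ℝ) + 1) = t := rfl
  rw [htn]
  rw [ContinuousMap.norm_le _ (mul_nonneg (by positivity)
    (integral_nonneg fun v => by positivity))]
  intro y
  have h0 : (jet (M + R) L (smoothing χ hs hc t φ hφ) l -
      ((∫ x, χ x) • jet (M + R) L φ) l) y =
      (∫ v, iteratedDeriv l φ (y + t * v) * χ v) - ∫ v, iteratedDeriv l φ y * χ v := by
    rw [integral_const_mul, ← iteratedDeriv_smoothing' hs hc t hφ, mul_comm]
    rfl
  have hi1 : Integrable fun v => iteratedDeriv l φ (y + t * v) * χ v :=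
    (((continuous_iteratedDeriv φ l).comp (by fun_prop)).mul
      hs.continuous).integrable_of_hasCompactSupport hc.mul_left
  rw [h0, ← integral_sub hi1 (hχi.const_mul _), ← integral_const_mul]
  refine norm_integral_le_of_norm_le (hχR.const_mul _) (Eventually.of_forall fun v => ?_)
  rw [← sub_mul, norm_mul]
  have := hlip y (y + t * v)
  rw [add_sub_cancel_left, norm_mul, Real.norm_eq_abs, abs_of_pos ht, Real.norm_eq_abs] at this
  calc _ ≤ B * (t * |v|) * ‖χ v‖ := by gcongr
    _ = _ := by ring

end RealHardy

/-! ### Representation of a distribution by a density. -/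

namespace RealHardy

open Filter Topology

theorem enorm_apply_le_lintegral (f : 𝓢'(ℝ, ℂ)) {χ : ℝ → ℂ} (hs : ContDiff ℝ (⊤ : ℕ∞) χ)
    (hc : HasCompactSupport χ) {φ : 𝓢(ℝ, ℂ)} (hφ : HasCompactSupport φ) :
    ‖∫ x, χ x‖ₑ * ‖f φ‖ₑ ≤ ∫⁻ x, ‖φ x‖ₑ * maximal f χ hs hc x := by
  have h := (tendsto_apply_smoothing f hs hc hφ).enorm
  rw [enorm_mul] at h
  refine le_of_tendsto' h fun n => ?_
  rw [apply_smoothing]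
  refine (enorm_integral_le_lintegral_enorm _).trans (lintegral_mono fun x => ?_)
  rw [enorm_mul]
  exact mul_le_mul_right (le_iSup (fun t => ‖conv f χ hs hc t x‖ₑ) _) _

/-- The compactly supported test functions. -/
def compactlySupported : Submodule ℂ 𝓢(ℝ, ℂ) where
  carrier := {φ | HasCompactSupport φ}
  add_mem' {φ ψ} hφ hψ := HasCompactSupport.add (f := φ) (f' := ψ) hφ hψ
  zero_mem' := HasCompactSupport.zero
  smul_mem' c φ hφ := HasCompactSupport.smul_left (f := fun _ : ℝ => c) (f' := φ) hφ

/-- The maximal function is the density of a finite measure `μ`, and `f` is bounded for the norm of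
`L¹(μ)`, hence for that of `L²(μ)`. Riesz representation in this Hilbert space suffices: the
representing function is in `L²(μ)`, hence in `L¹(μ)`, so its product with the maximal function is
integrable. -/
theorem exists_function_on_compactlySupported (f : 𝓢'(ℝ, ℂ)) {χ : ℝ → ℂ}
    (hs : ContDiff ℝ (⊤ : ℕ∞) χ) (hc : HasCompactSupport χ) (hχ : (∫ x, χ x) ≠ 0)
    (hf : ∫⁻ x, maximal f χ hs hc x < ∞) :
    ∃ F : ℝ → ℂ, Integrable F ∧ ∀ φ ∈ compactlySupported, f φ = ∫ x, φ x * F x := by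
  have hm := measurable_maximal f hs hc
  set μ : Measure ℝ := volume.withDensity (maximal f χ hs hc) with hμ
  have : IsFiniteMeasure μ := isFiniteMeasure_withDensity hf.ne
  have hfin : ∀ᵐ x, maximal f χ hs hc x < ∞ := ae_lt_top hm hf.ne
  let T : 𝓢(ℝ, ℂ) →ₗ[ℂ] Lp ℂ 2 μ := (toLpCLM ℂ ℂ 2 μ).toLinearMap
  have hT : ∀ φ, T φ = φ.toLp 2 μ := fun φ => rfl
  have hbound : ∀ φ ∈ compactlySupported,
      ‖f φ‖ ≤ (‖∫ x, χ x‖ₑ⁻¹ * μ Set.univ ^ (1 / 2 : ℝ)).toReal * ‖T φ‖ := by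
    intro φ hφ
    have h1 := enorm_apply_le_lintegral f hs hc hφ
    have h2 : ∫⁻ x, ‖φ x‖ₑ * maximal f χ hs hc x = eLpNorm φ 1 μ := by
      rw [eLpNorm_one_eq_lintegral_enorm, hμ, lintegral_withDensity_eq_lintegral_mul _ hm
        φ.continuous.enorm.measurable]
      exact lintegral_congr fun x => mul_comm _ _
    have h3 := eLpNorm_le_eLpNorm_mul_rpow_measure_univ (μ := μ) (p := 1) (q := 2)
      (by norm_num) φ.continuous.aestronglyMeasurable
    have h4 : (1 / (1 : ℝ≥0∞).toReal - 1 / (2 : ℝ≥0∞).toReal) = 1 / 2 := by norm_num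
    rw [h4] at h3
    have h5 : eLpNorm φ 2 μ = ‖T φ‖ₑ := by
      rw [hT, Lp.enorm_def]
      exact (eLpNorm_congr_ae (φ.coeFn_toLp 2 μ)).symm
    rw [h2] at h1
    have h6 : ‖f φ‖ₑ ≤ ‖∫ x, χ x‖ₑ⁻¹ * μ Set.univ ^ (1 / 2 : ℝ) * ‖T φ‖ₑ := by
      rw [mul_assoc, ← ENNReal.mul_le_iff_le_inv (by simpa using hχ) (by simp)]
      refine h1.trans (h3.trans_eq ?_)
      rw [h5, mul_comm]
    have h7 := ENNReal.toReal_mono (by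
      refine ENNReal.mul_ne_top (ENNReal.mul_ne_top (by simpa using hχ) ?_) (by simp)
      exact ENNReal.rpow_ne_top_of_nonneg (by norm_num) (measure_ne_top μ _)) h6
    rw [ENNReal.toReal_mul, toReal_enorm, toReal_enorm] at h7
    exact h7
  obtain ⟨g, hg⟩ := exists_clm_eq_comp (T.domRestrict compactlySupported)
    (f.toLinearMap.domRestrict compactlySupported) _ (fun φ => hbound φ.1 φ.2)
  let h : Lp ℂ 2 μ := (InnerProductSpace.toDual ℂ (Lp ℂ 2 μ)).symm g
  have hhi : Integrable h μ := (Lp.memLp h).integrable (by norm_num)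
  refine ⟨fun x => (maximal f χ hs hc x).toReal • starRingEnd ℂ (h x), ?_, fun φ hφ => ?_⟩
  · rw [← integrable_withDensity_iff_integrable_smul' hm hfin]
    exact (Complex.conjCLE : ℂ →L[ℝ] ℂ).integrable_comp hhi
  · have h1 : f φ = g (T φ) := hg ⟨φ, hφ⟩
    have h2 : g (T φ) = inner ℂ h (T φ) := by
      rw [← InnerProductSpace.toDual_apply_apply, LinearIsometryEquiv.apply_symm_apply]
    rw [h1, h2, L2.inner_def]
    have h3 : ∫ x, inner ℂ (h x) (T φ x) ∂μ = ∫ x, φ x * starRingEnd ℂ (h x) ∂μ := by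
      refine integral_congr_ae ?_
      filter_upwards [φ.coeFn_toLp 2 μ] with x hx
      rw [hT, hx, RCLike.inner_apply]
    rw [h3]
    refine (integral_withDensity_eq_integral_toReal_smul hm hfin _).trans ?_
    refine integral_congr_ae (Eventually.of_forall fun x => ?_)
    simp only [Complex.real_smul]
    ring

/-- Truncations of a Schwartz function. -/
theorem exists_compactlySupported_seq (φ : 𝓢(ℝ, ℂ)) :
    ∃ u : ℕ → 𝓢(ℝ, ℂ), (∀ n, u n ∈ compactlySupported) ∧ Tendsto u atTop (𝓝 φ) := by
  let b : ContDiffBump (0 : ℝ) := ⟨1, 2, one_pos, one_lt_two⟩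
  let ψ : ℝ → ℂ := fun x => (b x : ℂ)
  have hψs : ContDiff ℝ (⊤ : ℕ∞) ψ := Complex.ofRealCLM.contDiff.comp b.contDiff
  have hψc : HasCompactSupport ψ := b.hasCompactSupport.comp_left (g := Complex.ofReal) rfl
  let η : ℝ → ℂ := fun x => 1 - ψ x
  have hηs : ContDiff ℝ (⊤ : ℕ∞) η := contDiff_const.sub hψs
  have hη0 : ∀ x : ℝ, |x| ≤ 1 → η x = 0 := fun x hx => by
    have : b x = 1 := b.one_of_mem_closedBall (by simpa using hx)
    simp [η, ψ, this]
  have hηb : ∀ l : ℕ, ∃ B : ℝ, 0 ≤ B ∧ ∀ x, ‖iteratedDeriv l η x‖ ≤ B := by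
    intro l
    obtain ⟨B, hB⟩ := (hψs.continuous_iteratedDeriv l (mod_cast le_top)).bounded_above_of_compact_support
      (hasCompactSupport_iteratedDeriv hψc l)
    refine ⟨1 + B, by linarith [(norm_nonneg _).trans (hB 0)], fun x => ?_⟩
    have h1 : iteratedDeriv l η x = iteratedDeriv l (fun _ => (1 : ℂ)) x - iteratedDeriv l ψ x :=
      iteratedDeriv_sub contDiffAt_const ((hψs.contDiffAt).of_le (mod_cast le_top))
    rw [h1]
    refine (norm_sub_le _ _).trans (add_le_add ?_ (hB x))
    rw [iteratedDeriv_const]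
    split_ifs <;> simp
  have hcs : ∀ n : ℕ, HasCompactSupport fun x : ℝ => φ x * ψ (((n : ℝ) + 1)⁻¹ * x) := fun n => by
    refine HasCompactSupport.mul_left ?_
    have : ((n : ℝ) + 1)⁻¹ ≠ 0 := by positivity
    exact hψc.comp_homeomorph (Homeomorph.mulLeft₀ _ this)
  let u : ℕ → 𝓢(ℝ, ℂ) := fun n => HasCompactSupport.toSchwartzMap (hcs n)
    ((φ.smooth ⊤).mul (hψs.comp (contDiff_const.mul contDiff_id)))
  refine ⟨u, hcs, ?_⟩
  rw [(schwartz_withSeminorms ℂ ℝ ℂ).tendsto_nhds]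
  rintro ⟨k, l⟩ ε hε
  choose B hB0 hB using hηb
  set S : ℝ := ∑ i ∈ Finset.range (l + 1), (l.choose i : ℝ) *
    SchwartzMap.seminorm ℂ (k + 1) i φ * B (l - i) with hS
  have hS0 : 0 ≤ S := Finset.sum_nonneg fun i _ => by
    have := apply_nonneg (SchwartzMap.seminorm ℂ (k + 1) i) φ
    have := hB0 (l - i)
    positivity
  have hlim : Tendsto (fun n : ℕ => S * (1 / ((n : ℝ) + 1))) atTop (𝓝 0) := by
    simpa using (tendsto_one_div_add_atTop_nhds_zero_nat (𝕜 := ℝ)).const_mul S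
  filter_upwards [hlim.eventually_lt_const hε] with n hn
  refine lt_of_le_of_lt ?_ hn
  rw [← neg_sub φ (u n), map_neg_eq_map]
  refine SchwartzMap.seminorm_le_bound' ℂ k l _ (by positivity) fun x => ?_
  have hd : ((φ - u n : 𝓢(ℝ, ℂ)) : ℝ → ℂ) = fun x => φ x * η (((n : ℝ) + 1)⁻¹ * x) := by
    ext x
    change φ x - φ x * ψ (((n : ℝ) + 1)⁻¹ * x) = _
    simp only [η]
    ring
  have hn1 : (0 : ℝ) < (n : ℝ) + 1 := by positivity
  have hcomp : ContDiff ℝ (⊤ : ℕ∞) fun x : ℝ => η (((n : ℝ) + 1)⁻¹ * x) :=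
    hηs.comp (contDiff_const.mul contDiff_id)
  by_cases hx : |x| < (n : ℝ) + 1
  · have : ((φ - u n : 𝓢(ℝ, ℂ)) : ℝ → ℂ) =ᶠ[𝓝 x] fun _ => (0 : ℂ) := by
      filter_upwards [(isOpen_lt continuous_abs continuous_const).mem_nhds hx] with y hy
      rw [hd]
      simp only
      rw [hη0, mul_zero]
      rw [abs_mul, abs_of_pos (inv_pos.mpr hn1), inv_mul_le_iff₀ hn1, mul_one]
      exact le_of_lt hy
    rw [this.iteratedDeriv_eq l]
    simp
    positivity
  rw [not_lt] at hx
  have hsum : iteratedDeriv l (φ - u n : 𝓢(ℝ, ℂ)) x = ∑ i ∈ Finset.range (l + 1),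
      (l.choose i : ℂ) * iteratedDeriv i φ x *
        ((((n : ℝ) + 1)⁻¹) ^ (l - i) • iteratedDeriv (l - i) η (((n : ℝ) + 1)⁻¹ * x)) := by
    rw [hd]
    rw [iteratedDeriv_fun_mul ((φ.smooth l).contDiffAt) (hcomp.contDiffAt.of_le (mod_cast le_top))]
    refine Finset.sum_congr rfl fun i hi => ?_
    congr 1
    have hηl : ContDiff ℝ ((l - i : ℕ) : ℕ∞) η := hηs.of_le (mod_cast le_top)
    exact congrFun (iteratedDeriv_comp_const_smul hηl _) x
  rw [hsum, hS, Finset.sum_mul]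
  refine (mul_le_mul_of_nonneg_left (norm_sum_le _ _) (by positivity)).trans ?_
  rw [Finset.mul_sum]
  refine Finset.sum_le_sum fun i hi => ?_
  rw [norm_mul, norm_mul, norm_smul, norm_pow, Complex.norm_natCast, Real.norm_eq_abs,
    abs_of_pos (inv_pos.mpr hn1)]
  have h1 : (((n : ℝ) + 1)⁻¹) ^ (l - i) ≤ 1 := by
    refine pow_le_one₀ (by positivity) (inv_le_one_of_one_le₀ ?_)
    linarith [n.cast_nonneg (α := ℝ)]
  have h2 := hB (l - i) (((n : ℝ) + 1)⁻¹ * x)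
  have h3 := φ.le_seminorm' ℂ (k + 1) i x
  -- The difference vanishes for `|x| < n + 1`; outside, one extra power of `|x|` is traded for the
  -- factor that tends to zero.
  have h4 : |x| ^ k ≤ |x| ^ (k + 1) * (1 / ((n : ℝ) + 1)) := by
    rw [pow_succ, mul_assoc]
    refine le_mul_of_one_le_right (by positivity) ?_
    rw [mul_one_div, one_le_div hn1]
    exact hx
  calc |x| ^ k * ((l.choose i : ℝ) * ‖iteratedDeriv i φ x‖ * ((((n : ℝ) + 1)⁻¹) ^ (l - i) *
        ‖iteratedDeriv (l - i) η (((n : ℝ) + 1)⁻¹ * x)‖))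
      ≤ (|x| ^ (k + 1) * (1 / ((n : ℝ) + 1))) * ((l.choose i : ℝ) * ‖iteratedDeriv i φ x‖ *
        (1 * B (l - i))) := by gcongr
    _ = (l.choose i : ℝ) * (|x| ^ (k + 1) * ‖iteratedDeriv i φ x‖) * B (l - i) *
        (1 / ((n : ℝ) + 1)) := by ring
    _ ≤ _ := by
      have := hB0 (l - i)
      gcongr

/-- Integration of Schwartz functions against an integrable function. -/
noncomputable def functional (F : ℝ → ℂ) (hF : Integrable F) : 𝓢'(ℝ, ℂ) :=
  Lp.toTemperedDistribution (p := 1) (hF.toL1 F)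

theorem functional_apply {F : ℝ → ℂ} (hF : Integrable F) (φ : 𝓢(ℝ, ℂ)) :
    functional F hF φ = ∫ x, φ x * F x := by
  rw [functional, Lp.toTemperedDistribution_apply]
  refine integral_congr_ae ?_
  filter_upwards [hF.coeFn_toL1] with x hx
  rw [hx, smul_eq_mul]

theorem exists_isFunction {f : 𝓢'(ℝ, ℂ)} {χ : ℝ → ℂ}
    {hs : ContDiff ℝ (⊤ : ℕ∞) χ} {hc : HasCompactSupport χ} (hχ : (∫ x, χ x) ≠ 0)
    (hf : f ∈ hardyOne χ hs hc) : ∃ F : ℝ → ℝ, IsFunction f F := by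
  obtain ⟨G, hG, hfG⟩ := exists_function_on_compactlySupported f hs hc hχ hf.2
  have hall : ∀ φ : 𝓢(ℝ, ℂ), f φ = ∫ x, φ x * G x := by
    intro φ
    obtain ⟨u, hu, hlim⟩ := exists_compactlySupported_seq φ
    have h1 : Tendsto (fun n => f (u n)) atTop (𝓝 (f φ)) := (f.cont.tendsto φ).comp hlim
    have h2 : Tendsto (fun n => functional G hG (u n)) atTop (𝓝 (functional G hG φ)) :=
      ((functional G hG).cont.tendsto φ).comp hlim
    rw [← functional_apply hG]
    refine tendsto_nhds_unique h1 (h2.congr fun n => ?_)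
    rw [functional_apply, hfG _ (hu n)]
  -- Reality of the distribution, tested on real smooth functions with compact support, makes the
  -- imaginary part of the density vanish.
  have him : ∀ᵐ x, (G x).im = 0 := by
    refine ae_eq_zero_of_integral_contDiff_smul_eq_zero hG.im.locallyIntegrable
      fun g hg hgc => ?_
    have hgc' : HasCompactSupport fun x => (g x : ℂ) := hgc.comp_left (g := Complex.ofReal) rfl
    let ψ : 𝓢(ℝ, ℂ) := HasCompactSupport.toSchwartzMap hgc' (Complex.ofRealCLM.contDiff.comp hg)
    have h1 := hf.1 ψ (fun x => Complex.ofReal_im _)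
    have h2 : Integrable fun x => (g x : ℂ) * G x :=
      hG.bdd_mul (c := ‖ψ.toBoundedContinuousFunction‖) ψ.continuous.aestronglyMeasurable
        (Eventually.of_forall fun x => ψ.toBoundedContinuousFunction.norm_coe_le_norm x)
    rw [hall ψ] at h1
    have h3 : (∫ x, ψ x * G x).im = ∫ x, (ψ x * G x).im := (integral_im h2).symm
    rw [h3] at h1
    rw [← h1]
    refine integral_congr_ae (Eventually.of_forall fun x => ?_)
    change g x * (G x).im = ((g x : ℂ) * G x).im
    simp
  refine ⟨fun x => (G x).re, hG.re, fun φ => ?_⟩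
  rw [hall φ]
  refine integral_congr_ae ?_
  filter_upwards [him] with x hx
  congr 1
  exact Complex.ext (by simp) (by simp [hx])

end RealHardy

/-! ### `L¹` bounds for the analytic extension on horizontal lines. -/

namespace RealHardy

open Filter Topology

theorem IsFunction.maximal_eq {f : 𝓢'(ℝ, ℂ)} {F : ℝ → ℝ} (hF : IsFunction f F) {χ : ℝ → ℂ}
    (hs : ContDiff ℝ (⊤ : ℕ∞) χ) (hc : HasCompactSupport χ) (x : ℝ) :
    maximal f χ hs hc x = vmax χ (fun t => (F t : ℂ)) x := by
  refine iSup_congr fun t => ?_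
  rw [conv, hF.2]
  rfl

theorem vmax_const_mul (c : ℂ) (χ f : ℝ → ℂ) (x : ℝ) :
    vmax (fun u => c * χ u) f x = ‖c‖ₑ * vmax χ f x := by
  rw [vmax, vmax, ENNReal.mul_iSup]
  refine iSup_congr fun t => ?_
  rw [← enorm_mul, cv, cv, ← integral_const_mul]
  congr 2
  ext y
  ring

/-- Almost everywhere `ntMax F` is at most a constant times `(hlMax h) ^ 2`, with `h` the square
root of the vertical maximal function. The exponent `1 / 2` turns the `L¹` hypothesis into an `L²`
one, where the maximal operator is bounded. -/
theorem lintegral_ntMax_lt_top {χ : ℝ → ℂ} (hs : ContDiff ℝ (⊤ : ℕ∞) χ) (hc : HasCompactSupport χ)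
    (h1 : ∫ w, χ w = 1) {F : ℝ → ℝ} (hF : Integrable F)
    (hm : Measurable (vmax χ fun t => (F t : ℂ))) (hfin : ∫⁻ x, vmax χ (fun t => (F t : ℂ)) x ≠ ∞) :
    ∫⁻ x, ntMax F x ≠ ∞ := by
  obtain ⟨C₁, hC₁, hT⟩ := Tang.of_exists hs hc h1
  obtain ⟨C₂, hC₂, hN⟩ := ntMax_le_of_tang hs hc h1
  set h : ℝ → ℝ≥0∞ := fun y => vmax χ (fun t => (F t : ℂ)) y ^ (1 / 2 : ℝ) with hh
  have hhm : Measurable h := hm.pow_const _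
  have hsq : ∀ x, h x ^ 2 = vmax χ (fun t => (F t : ℂ)) x := fun x => by
    rw [hh, ← ENNReal.rpow_natCast, ← ENNReal.rpow_mul]
    norm_num
  have hM : ∫⁻ x, hlMax h x ^ 2 ≠ ∞ := by
    refine ne_top_of_le_ne_top ?_ (lintegral_hlMax_sq_le hhm)
    simp_rw [hsq]
    exact ENNReal.mul_ne_top (by norm_num) hfin
  have hFc : Integrable fun t => (F t : ℂ) := hF.ofReal
  have ha1 : ∀ᵐ x, hlMax h x ^ 2 < ∞ := ae_lt_top ((measurable_hlMax h).pow_const 2) hM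
  have ha2 := ae_hlMax_lt_top (h := fun y => ‖(F y : ℂ)‖ₑ) hFc.2.ne
  have hle : ∀ᵐ x, ntMax F x ≤ ENNReal.ofReal (C₂ * C₁) * hlMax h x ^ 2 := by
    filter_upwards [ha1, ha2] with x hx1 hx2
    have hx3 : hlMax h x ≠ ∞ := fun h => by simp [h] at hx1
    have hx4 : hlMax h x = ENNReal.ofReal (hlMax h x).toReal := (ENNReal.ofReal_toReal hx3).symm
    have := hN F hF x _ (hT _ hFc x _ ENNReal.toReal_nonneg
      (exists_tang_of_hlMax_lt_top hs.continuous hc hFc hx2) hx4.le)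
    refine this.trans_eq ?_
    rw [← mul_assoc, ENNReal.ofReal_mul (by positivity), ENNReal.ofReal_pow ENNReal.toReal_nonneg,
      ← hx4]
  refine ne_top_of_le_ne_top ?_ (lintegral_mono_ae hle)
  rw [lintegral_const_mul _ ((measurable_hlMax h).pow_const 2)]
  exact ENNReal.mul_ne_top ENNReal.ofReal_ne_top hM

/-- The analytic extension of an element of `ℋ¹(ℝ)` is bounded in `L¹` on horizontal lines. -/
theorem exists_lintegral_analyticExt_le {f : 𝓢'(ℝ, ℂ)} {χ : ℝ → ℂ}
    {hs : ContDiff ℝ (⊤ : ℕ∞) χ} {hc : HasCompactSupport χ} (hχ : (∫ x, χ x) ≠ 0)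
    (hf : f ∈ hardyOne χ hs hc) {F : ℝ → ℝ} (hF : IsFunction f F) :
    ∃ C : ℝ≥0∞, C ≠ ∞ ∧ ∀ η : ℝ, 0 < η →
      ∫⁻ x : ℝ, ‖analyticExt F (x + η * Complex.I)‖ₑ ≤ C := by
  -- The reproducing formula needs a kernel of mean one; rescaling `χ` only multiplies the maximal
  -- function by a constant.
  set c := (∫ x, χ x)⁻¹ with hcdef
  have hs' : ContDiff ℝ (⊤ : ℕ∞) fun u => c * χ u := contDiff_const.mul hs
  have hc' : HasCompactSupport fun u => c * χ u := hc.mul_left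
  have h1 : ∫ u, c * χ u = 1 := by rw [integral_const_mul, hcdef, inv_mul_cancel₀ hχ]
  have heq : vmax (fun u => c * χ u) (fun t => (F t : ℂ)) =
      fun x => ‖c‖ₑ * maximal f χ hs hc x := by
    ext x
    rw [vmax_const_mul, hF.maximal_eq]
  have hmm := measurable_maximal f hs hc
  have hfin : ∫⁻ x, ntMax F x ≠ ∞ := by
    refine lintegral_ntMax_lt_top hs' hc' h1 hF.1 ?_ ?_
    · rw [heq]
      exact hmm.const_mul _
    · rw [heq, lintegral_const_mul _ hmm]
      exact ENNReal.mul_ne_top (by simp) hf.2.ne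
  refine ⟨14 * ∫⁻ x, ntMax F x, ENNReal.mul_ne_top (by norm_num) hfin, fun η hη => ?_⟩
  have hle : ∀ x : ℝ, ‖analyticExt F (x + η * Complex.I)‖ₑ ≤
      ntMax F x + ‖(analyticExt F (x + η * Complex.I)).im‖ₑ := fun x => by
    have h2 : ‖analyticExt F (x + η * Complex.I)‖ₑ ≤ ‖(analyticExt F (x + η * Complex.I)).re‖ₑ +
        ‖(analyticExt F (x + η * Complex.I)).im‖ₑ := by
      rw [← ofReal_norm, ← ofReal_norm, ← ofReal_norm, ← ENNReal.ofReal_add (norm_nonneg _)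
        (norm_nonneg _)]
      exact ENNReal.ofReal_le_ofReal (Complex.norm_le_abs_re_add_abs_im _)
    refine h2.trans (add_le_add ?_ le_rfl)
    exact le_ntMax F (by simpa using hη)
  refine (lintegral_mono hle).trans ?_
  rw [lintegral_add_left (measurable_ntMax F)]
  refine (add_le_add le_rfl (lintegral_conj_le hF.1 hfin hη)).trans_eq ?_
  ring

end RealHardy

namespace RealHardy

open Filter Topology

/-! ### Complex Hardy spaces on the line -/

/-- Functions in `L²` whose Fourier transform vanishes on the negative half-line. -/
def IsH2 (α : ℝ → ℂ) : Prop :=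
  MemLp α 2 ∧ ∀ φ : 𝓢(ℝ, ℂ), (∀ ξ, 0 ≤ ξ → φ ξ = 0) → ∫ x, α x * 𝓕 φ x = 0

/-- Functions in `L¹` whose Fourier transform vanishes on the nonpositive half-line. -/
def IsH1 (F : ℝ → ℂ) : Prop := Integrable F ∧ ∀ ξ ≤ 0, 𝓕 F ξ = 0

theorem IsH2.congr {α β : ℝ → ℂ} (hα : IsH2 α) (h : α =ᵐ[volume] β) : IsH2 β := by
  refine ⟨hα.1.ae_eq h, fun φ hφ => ?_⟩
  rw [← hα.2 φ hφ]
  refine integral_congr_ae ?_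
  filter_upwards [h] with x hx
  rw [hx]

theorem IsH1.congr {F G : ℝ → ℂ} (hF : IsH1 F) (h : F =ᵐ[volume] G) : IsH1 G :=
  ⟨hF.1.congr h, fun ξ hξ => by rw [← hF.2 ξ hξ, Real.fourier_congr_ae h]⟩

theorem integrable_mul_schwartz {α : ℝ → ℂ} (hα : MemLp α 2) (φ : 𝓢(ℝ, ℂ)) :
    Integrable fun x => α x * φ x := hα.integrable_mul (φ.memLp 2)

theorem IsH2.add {α β : ℝ → ℂ} (hα : IsH2 α) (hβ : IsH2 β) : IsH2 fun x => α x + β x := by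
  refine ⟨hα.1.add hβ.1, fun φ hφ => ?_⟩
  simp only [add_mul]
  rw [integral_add (integrable_mul_schwartz hα.1 (𝓕 φ)) (integrable_mul_schwartz hβ.1 (𝓕 φ)),
    hα.2 φ hφ, hβ.2 φ hφ, add_zero]

theorem IsH2.const_mul {α : ℝ → ℂ} (hα : IsH2 α) (c : ℂ) : IsH2 fun x => c * α x := by
  refine ⟨hα.1.const_mul c, fun φ hφ => ?_⟩
  simp only [mul_assoc]
  rw [integral_const_mul, hα.2 φ hφ, mul_zero]

/-- The distributional and the `L²` Fourier transforms agree, so the defining pairings are integrals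
against `𝓕 a`; test functions supported in the open negative half-line detect it there. -/
theorem isH2_iff_fourier (a : Lp ℂ 2 (volume : Measure ℝ)) :
    IsH2 a ↔ ∀ᵐ ξ : ℝ, ξ < 0 → (𝓕 a : Lp ℂ 2 (volume : Measure ℝ)) ξ = 0 := by
  have key : ∀ φ : 𝓢(ℝ, ℂ), ∫ x, a x * 𝓕 φ x =
      ∫ ξ, φ ξ * (𝓕 a : Lp ℂ 2 (volume : Measure ℝ)) ξ := by
    intro φ
    have h := congrArg (fun T : 𝓢'(ℝ, ℂ) => T φ) (Lp.fourier_toTemperedDistribution_eq a)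
    simp only [TemperedDistribution.fourier_apply, Lp.toTemperedDistribution_apply,
      smul_eq_mul] at h
    rw [← h]
    exact integral_congr_ae (Eventually.of_forall fun x => mul_comm _ _)
  constructor
  · intro h
    refine (isOpen_Iio (a := (0 : ℝ))).ae_eq_zero_of_integral_contDiff_smul_eq_zero
      (((Lp.memLp (𝓕 a)).locallyIntegrable (by norm_num)).locallyIntegrableOn _) ?_
    intro g hg hgc hgU
    have hgc' : HasCompactSupport fun x => (g x : ℂ) := hgc.comp_left (g := Complex.ofReal) rfl
    let ψ : 𝓢(ℝ, ℂ) := HasCompactSupport.toSchwartzMap hgc' (Complex.ofRealCLM.contDiff.comp hg)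
    have h1 := h.2 ψ (fun ξ hξ => by
      change (g ξ : ℂ) = 0
      rw [image_eq_zero_of_notMem_tsupport fun h' => absurd (hgU h') (not_lt.mpr hξ),
        Complex.ofReal_zero])
    rw [key] at h1
    exact h1
  · intro h
    refine ⟨Lp.memLp a, fun φ hφ => ?_⟩
    rw [key]
    refine integral_eq_zero_of_ae ?_
    filter_upwards [h] with ξ hξ
    rcases lt_or_ge ξ 0 with h0 | h0
    · simp [hξ h0]
    · simp [hφ ξ h0]

theorem IsH2.toLp {α : ℝ → ℂ} (hα : IsH2 α) : IsH2 (hα.1.toLp α) := hα.congr hα.1.coeFn_toLp.symm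

theorem IsH2.integrable_mul {α β : ℝ → ℂ} (hα : IsH2 α) (hβ : IsH2 β) :
    Integrable fun x => α x * β x := hα.1.integrable_mul hβ.1

/-- By Plancherel the integral pairs the spectrum of `β` with the reflected spectrum of `α`, and
these live on opposite half-lines. -/
theorem IsH2.integral_mul_eq_zero {α β : ℝ → ℂ} (hα : IsH2 α) (hβ : IsH2 β) :
    ∫ x, α x * β x = 0 := by
  set a := hα.1.toLp α with ha
  set b := hβ.1.toLp β with hb
  have h1 : ∫ x, α x * β x = inner ℂ (conjL a) b := by
    rw [L2.inner_def]
    refine integral_congr_ae ?_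
    filter_upwards [coeFn_conjL a, hα.1.coeFn_toLp, hβ.1.coeFn_toLp] with x h1 h2 h3
    rw [RCLike.inner_apply, h1, ha, hb, h2, h3, RingHomCompTriple.comp_apply, RingHom.id_apply,
      mul_comm]
  rw [h1, ← Lp.inner_fourier_eq, L2.inner_def]
  have h2 : 𝓕 (conjL a) = reflL (conjL (𝓕 a)) := by
    rw [conjL_fourier, ← reflL_fourier, reflL_reflL]
  rw [h2]
  refine integral_eq_zero_of_ae ?_
  have ha0 := (isH2_iff_fourier a).mp hα.toLp
  have hb0 := (isH2_iff_fourier b).mp hβ.toLp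
  have hq := (Measure.measurePreserving_neg (volume : Measure ℝ)).quasiMeasurePreserving
  filter_upwards [coeFn_reflL (conjL (𝓕 a)), hq.ae (coeFn_conjL (𝓕 a)), hq.ae ha0, hb0,
    ae_iff.mpr (by simp : volume {ξ : ℝ | ¬ ξ ≠ 0} = 0)] with ξ e1 e2 e3 e4 e5
  rw [RCLike.inner_apply, e1, e2]
  rcases lt_or_gt_of_ne e5 with h | h
  · simp [e4 h]
  · simp [e3 (by linarith)]

theorem fourier_fourier_schwartz (φ : 𝓢(ℝ, ℂ)) (ξ : ℝ) : 𝓕 (𝓕 φ) ξ = φ (-ξ) := by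
  have h : 𝓕⁻ (𝓕 φ) (-ξ) = φ (-ξ) := by rw [fourierInv_fourier_eq]
  rw [← h, SchwartzMap.fourierInv_coe, Real.fourierInv_eq_fourier_neg, neg_neg]
  rfl

theorem isH2_fourier_schwartz {φ : 𝓢(ℝ, ℂ)} (hφ : ∀ ξ, 0 ≤ ξ → φ ξ = 0) :
    IsH2 fun x => 𝓕 φ x := by
  refine ⟨(𝓕 φ).memLp 2, fun ψ hψ => ?_⟩
  rw [← SchwartzMap.integral_fourier_mul_eq]
  refine integral_eq_zero_of_ae (Eventually.of_forall fun ξ => ?_)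
  simp only [fourier_fourier_schwartz, Pi.zero_apply]
  rcases le_total 0 ξ with h | h
  · rw [hψ ξ h, mul_zero]
  · rw [hφ (-ξ) (by linarith), zero_mul]

/-- `ℋ²` is its own annihilator under the bilinear pairing: the functions `𝓕 φ` in the definition of
`IsH2` are themselves in `ℋ²`. -/
theorem isH2_of_integral_mul_eq_zero {α : ℝ → ℂ} (hα : MemLp α 2)
    (h : ∀ β, IsH2 β → ∫ x, α x * β x = 0) : IsH2 α :=
  ⟨hα, fun _ hφ => h _ (isH2_fourier_schwartz hφ)⟩

theorem MemLp.bdd_mul_two {α g : ℝ → ℂ} (hα : MemLp α 2) (hg : AEStronglyMeasurable g volume) {C : ℝ}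
    (hC : ∀ x, ‖g x‖ ≤ C) : MemLp (fun x => g x * α x) 2 := by
  refine MemLp.of_le_mul (c := C) hα (hg.mul hα.aestronglyMeasurable) (Eventually.of_forall fun x => ?_)
  rw [norm_mul]
  exact mul_le_mul_of_nonneg_right (hC x) (norm_nonneg _)

theorem norm_exp_two_pi_mul_I (s x : ℝ) : ‖Complex.exp (2 * Real.pi * Complex.I * s * x)‖ = 1 := by
  rw [Complex.norm_exp]
  simp

theorem IsH2.exp_mul {β : ℝ → ℂ} (hβ : IsH2 β) {a : ℝ} (ha : 0 ≤ a) :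
    IsH2 fun x => Complex.exp (2 * Real.pi * Complex.I * a * x) * β x := by
  refine ⟨MemLp.bdd_mul_two hβ.1 (by fun_prop) fun x => (norm_exp_two_pi_mul_I a x).le,
    fun φ hφ => ?_⟩
  have h1 := hβ.2 (compSubConstCLM ℂ (-a) φ) (fun ξ hξ => by
    rw [compSubConstCLM_apply]
    exact hφ _ (by linarith))
  rw [← h1]
  refine integral_congr_ae (Eventually.of_forall fun x => ?_)
  have h2 : 𝓕 (compSubConstCLM ℂ (-a) φ) x =
      Complex.exp (2 * Real.pi * Complex.I * a * x) * 𝓕 φ x := by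
    rw [SchwartzMap.fourier_coe, SchwartzMap.fourier_coe, Real.fourier_real_eq_integral_exp_smul,
      Real.fourier_real_eq_integral_exp_smul, ← integral_const_mul]
    rw [← integral_sub_right_eq_self _ a]
    refine integral_congr_ae (Eventually.of_forall fun ξ => ?_)
    simp only [compSubConstCLM_apply, smul_eq_mul, sub_neg_eq_add, sub_add_cancel]
    rw [← mul_assoc, ← Complex.exp_add]
    congr 2
    push_cast
    ring
  simp only
  rw [h2]
  ring

/-- For `ξ ≤ 0` the character in the Fourier integral shifts the spectrum of `β` to the right, so it
can be absorbed into `β`. -/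
theorem IsH2.mul {α β : ℝ → ℂ} (hα : IsH2 α) (hβ : IsH2 β) : IsH1 fun x => α x * β x := by
  refine ⟨hα.integrable_mul hβ, fun ξ hξ => ?_⟩
  rw [Real.fourier_real_eq_integral_exp_smul]
  rw [← hα.integral_mul_eq_zero (hβ.exp_mul (a := -ξ) (by linarith))]
  refine integral_congr_ae (Eventually.of_forall fun x => ?_)
  simp only [smul_eq_mul]
  have : Complex.exp (2 * Real.pi * Complex.I * ((-ξ : ℝ) : ℂ) * x) =
      Complex.exp (((-2 * Real.pi * x * ξ : ℝ) : ℂ) * Complex.I) := by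
    congr 1
    push_cast
    ring
  rw [this]
  ring

theorem inv_ofReal_sub_eq_integral {w : ℂ} (hw : w.im < 0) (x : ℝ) :
    ((x : ℂ) - w)⁻¹ = -(2 * Real.pi * Complex.I) * ∫ s in Set.Ioi (0 : ℝ),
      Complex.exp (2 * Real.pi * Complex.I * (x - w) * s) := by
  have hre : (2 * Real.pi * Complex.I * (x - w)).re < 0 := by
    simp
    nlinarith [Real.pi_pos]
  rw [integral_exp_mul_complex_Ioi hre]
  have h1 : (x : ℂ) - w ≠ 0 := ofReal_sub_ne_zero hw.ne x
  have h2 : (Real.pi : ℂ) ≠ 0 := by exact_mod_cast Real.pi_ne_zero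
  simp
  field_simp

/-- For `w` in the lower half-plane, `1 / (x - w)` is a Laplace integral of the characters of
frequency `s > 0`, with damping `exp (2 π w.im s)` that justifies Fubini. -/
theorem integral_div_eq_zero {g : ℝ → ℂ} (hg : Integrable g) {w : ℂ} (hw : w.im < 0)
    (h : ∀ s : ℝ, 0 < s → ∫ x, g x * Complex.exp (2 * Real.pi * Complex.I * s * x) = 0) :
    ∫ x, g x / ((x : ℂ) - w) = 0 := by
  have hnorm : ∀ x s : ℝ, ‖Complex.exp (2 * Real.pi * Complex.I * (x - w) * s)‖ =
      Real.exp (2 * Real.pi * w.im * s) := by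
    intro x s
    rw [Complex.norm_exp]
    congr 1
    simp
  have hexp : IntegrableOn (fun s : ℝ => Real.exp (2 * Real.pi * w.im * s)) (Set.Ioi 0) :=
    integrableOn_exp_mul_Ioi (by nlinarith [Real.pi_pos]) 0
  have hint : Integrable (fun p : ℝ × ℝ => g p.1 *
      Complex.exp (2 * Real.pi * Complex.I * (p.1 - w) * p.2))
      (volume.prod (volume.restrict (Set.Ioi 0))) := by
    have h0 := hg.norm.mul_prod hexp
    refine h0.mono' (hg.aestronglyMeasurable.comp_fst.mul (by fun_prop))
      (Eventually.of_forall fun p => ?_)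
    rw [norm_mul, hnorm]
  have h1 : ∫ x, g x / ((x : ℂ) - w) = -(2 * Real.pi * Complex.I) * ∫ x, ∫ s in Set.Ioi (0 : ℝ),
      g x * Complex.exp (2 * Real.pi * Complex.I * (x - w) * s) := by
    rw [← integral_const_mul]
    refine integral_congr_ae (Eventually.of_forall fun x => ?_)
    simp only
    rw [div_eq_mul_inv, inv_ofReal_sub_eq_integral hw, integral_const_mul]
    ring
  rw [h1, integral_integral_swap hint]
  have h2 : ∫ s in Set.Ioi (0 : ℝ), ∫ x, g x * Complex.exp (2 * Real.pi * Complex.I * (x - w) * s)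
      = 0 := by
    refine setIntegral_eq_zero_of_forall_eq_zero fun s hs => ?_
    have h3 : ∀ x : ℝ, g x * Complex.exp (2 * Real.pi * Complex.I * (x - w) * s) =
        Complex.exp (-(2 * Real.pi * Complex.I * w * s)) *
          (g x * Complex.exp (2 * Real.pi * Complex.I * s * x)) := by
      intro x
      rw [mul_left_comm, ← Complex.exp_add]
      congr 2
      ring
    simp_rw [h3]
    rw [integral_const_mul, h s hs, mul_zero]
  rw [h2, mul_zero]

theorem memLp_inv_ofReal_sub {w : ℂ} (hw : w.im ≠ 0) : MemLp (fun x : ℝ => ((x : ℂ) - w)⁻¹) 2 := by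
  rw [memLp_two_iff_integrable_sq_norm (continuous_inv_ofReal_sub hw).aestronglyMeasurable]
  have h := (integrable_inv_sq_add_sq (abs_pos.mpr hw) w.re).1
  refine h.congr (Eventually.of_forall fun x => ?_)
  simp only
  rw [norm_inv, inv_pow, ← Complex.normSq_eq_norm_sq, Complex.normSq_apply]
  congr 1
  simp only [Complex.sub_re, Complex.ofReal_re, Complex.sub_im, Complex.ofReal_im, sq_abs]
  ring

theorem isH2_inv_ofReal_sub {w : ℂ} (hw : w.im < 0) : IsH2 fun x : ℝ => ((x : ℂ) - w)⁻¹ := by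
  refine ⟨memLp_inv_ofReal_sub hw.ne, fun φ hφ => ?_⟩
  have h := integral_div_eq_zero (𝓕 φ).integrable hw (fun s hs => by
    have h1 : 𝓕⁻ (𝓕 φ) s = φ s := by rw [fourierInv_fourier_eq]
    rw [hφ s hs.le, SchwartzMap.fourierInv_coe, Real.fourierInv_eq'] at h1
    rw [← h1]
    refine integral_congr_ae (Eventually.of_forall fun x => ?_)
    simp only [smul_eq_mul]
    rw [mul_comm]
    congr 2
    simp
    ring)
  rw [← h]
  refine integral_congr_ae (Eventually.of_forall fun x => ?_)
  simp only
  rw [div_eq_mul_inv, mul_comm]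

theorem IsH1.div {F : ℝ → ℂ} (hF : IsH1 F) {w : ℂ} (hw : w.im < 0) :
    IsH1 fun x => F x / ((x : ℂ) - w) := by
  refine ⟨integrable_div_ofReal_sub hF.1 hw.ne, fun ξ hξ => ?_⟩
  rw [Real.fourier_real_eq_integral_exp_smul]
  have hn : ∀ x : ℝ, ‖Complex.exp (((-2 * Real.pi * x * ξ : ℝ) : ℂ) * Complex.I)‖ = 1 := fun x =>
    Complex.norm_exp_ofReal_mul_I _
  have hg : Integrable fun x : ℝ =>
      Complex.exp (((-2 * Real.pi * x * ξ : ℝ) : ℂ) * Complex.I) * F x :=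
    hF.1.bdd_mul (c := 1) (by fun_prop) (Eventually.of_forall fun x => (hn x).le)
  rw [← integral_div_eq_zero hg hw (fun s hs => by
    have h1 := hF.2 (ξ - s) (by linarith)
    rw [Real.fourier_real_eq_integral_exp_smul] at h1
    rw [← h1]
    refine integral_congr_ae (Eventually.of_forall fun x => ?_)
    simp only [smul_eq_mul]
    rw [mul_right_comm, ← Complex.exp_add]
    congr 2
    push_cast
    ring)]
  refine integral_congr_ae (Eventually.of_forall fun x => ?_)
  simp only [smul_eq_mul]
  ring

theorem IsH1.integral_eq_zero {F : ℝ → ℂ} (hF : IsH1 F) : ∫ x, F x = 0 := by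
  have h := hF.2 0 le_rfl
  rw [Real.fourier_real_eq_integral_exp_smul] at h
  simpa using h

theorem IsH1.cauchyInt_eq_zero {F : ℝ → ℂ} (hF : IsH1 F) {w : ℂ} (hw : w.im < 0) :
    cauchyInt F w = 0 := (hF.div hw).integral_eq_zero

theorem IsH2.cauchyInt_eq_zero {α : ℝ → ℂ} (hα : IsH2 α) {w : ℂ} (hw : w.im < 0) :
    cauchyInt α w = 0 := hα.integral_mul_eq_zero (isH2_inv_ofReal_sub hw)

theorem memLp_div_ofReal_sub {α : ℝ → ℂ} (hα : MemLp α 2) {w : ℂ} (hw : w.im ≠ 0) :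
    MemLp (fun x => α x / ((x : ℂ) - w)) 2 := by
  have := MemLp.bdd_mul_two hα (continuous_inv_ofReal_sub hw).aestronglyMeasurable
    (norm_inv_ofReal_sub_le hw)
  simpa only [div_eq_inv_mul] using this

/-- By duality with `ℋ²`: for `β` in `ℋ²` the product `α β` is in `ℋ¹`, where division by `x - w` is
already available. -/
theorem IsH2.div {α : ℝ → ℂ} (hα : IsH2 α) {w : ℂ} (hw : w.im < 0) :
    IsH2 fun x => α x / ((x : ℂ) - w) := by
  refine isH2_of_integral_mul_eq_zero (memLp_div_ofReal_sub hα.1 hw.ne) fun β hβ => ?_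
  rw [← ((hα.mul hβ).div hw).integral_eq_zero]
  refine integral_congr_ae (Eventually.of_forall fun x => ?_)
  simp only
  ring

end RealHardy

/-! ### Cauchy integrals: uniqueness, characterization of `ℋ²`, evaluation at points. -/

namespace RealHardy

open Filter Topology

theorem cauchyInt_sub_cauchyInt {F : ℝ → ℂ} {z w : ℂ} (hz : z.im ≠ 0) (hw : w.im ≠ 0)
    (h1 : Integrable fun t => F t / ((t : ℂ) - z)) (h2 : Integrable fun t => F t / ((t : ℂ) - w)) :
    cauchyInt F z - cauchyInt F w = (z - w) * ∫ t, F t / (((t : ℂ) - z) * (t - w)) := by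
  rw [cauchyInt, cauchyInt, ← integral_sub h1 h2, ← integral_const_mul]
  refine integral_congr_ae (Eventually.of_forall fun t => ?_)
  have e1 := ofReal_sub_ne_zero hz t
  have e2 := ofReal_sub_ne_zero hw t
  simp only
  field_simp
  ring

theorem integral_poisson_smul_tendsto {φ : ℝ → ℝ} (hφ : Continuous φ) {K : ℝ}
    (hK : ∀ x, ‖φ x‖ ≤ K) {y : ℕ → ℝ} (hy : Tendsto y atTop (𝓝 0)) (t : ℝ) :
    Tendsto (fun n => ∫ u, φ (t + y n * u) * (1 + u ^ 2)⁻¹) atTop (𝓝 (φ t * Real.pi)) := by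
  rw [← integral_univ_inv_one_add_sq, ← integral_const_mul]
  refine tendsto_integral_of_dominated_convergence (fun u => K * (1 + u ^ 2)⁻¹)
    (fun n => ?_) (integrable_inv_one_add_sq.const_mul K) (fun n => Eventually.of_forall fun u => ?_)
    (Eventually.of_forall fun u => ?_)
  · have : Continuous fun u : ℝ => (1 + u ^ 2)⁻¹ :=
      Continuous.inv₀ (by fun_prop) fun u => by positivity
    exact ((hφ.comp (by fun_prop)).mul this).aestronglyMeasurable
  · rw [norm_mul, Real.norm_of_nonneg (by positivity : 0 ≤ (1 + u ^ 2)⁻¹)]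
    exact mul_le_mul_of_nonneg_right (hK _) (by positivity)
  · refine Tendsto.mul_const _ ((hφ.tendsto t).comp ?_)
    simpa using (hy.mul_const u).const_add t

theorem integral_poisson_comp (φ : ℝ → ℝ) (t : ℝ) {y : ℝ} (hy : 0 < y) :
    ∫ x, φ x * (y / ((x - t) ^ 2 + y ^ 2)) = ∫ u, φ (t + y * u) * (1 + u ^ 2)⁻¹ := by
  have h2 := integral_sub_right_eq_self (μ := volume)
    (fun x : ℝ => φ (t + y * (x / y)) * (1 + (x / y) ^ 2)⁻¹) t
  have h3 := Measure.integral_comp_div (fun u : ℝ => φ (t + y * u) * (1 + u ^ 2)⁻¹) y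
  rw [h3, abs_of_pos hy, smul_eq_mul] at h2
  rw [← mul_right_inj' hy.ne', ← h2, ← integral_const_mul]
  refine integral_congr_ae (Eventually.of_forall fun x => ?_)
  simp only
  rw [mul_div_cancel₀ _ hy.ne', add_sub_cancel]
  have : (x - t) ^ 2 + y ^ 2 ≠ 0 := by positivity
  have : 1 + ((x - t) / y) ^ 2 ≠ 0 := by positivity
  field_simp
  ring

/-- An integrable function is determined by its Cauchy integral off the real axis. -/
theorem ae_eq_zero_of_cauchyInt_eq_zero {F : ℝ → ℂ} (hF : Integrable F)
    (h : ∀ z : ℂ, z.im ≠ 0 → |z.im| < 1 → cauchyInt F z = 0) : ∀ᵐ x, F x = 0 := by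
  refine ae_eq_zero_of_integral_contDiff_smul_eq_zero hF.locallyIntegrable fun φ hφ hφc => ?_
  obtain ⟨K, hK⟩ := hφc.exists_bound_of_continuous hφ.continuous
  -- The index shift keeps `y n < 1`, since the hypothesis is only available in the strip `|z.im| <
  -- 1`.
  set y : ℕ → ℝ := fun n => 1 / ((n + 1 : ℕ) + 1 : ℝ) with hy
  have hy0 : ∀ n, 0 < y n := fun n => by simp only [hy]; positivity
  have hy1 : ∀ n, y n < 1 := fun n => by
    simp only [hy]
    rw [div_lt_one (by positivity)]
    push_cast
    linarith [n.cast_nonneg (α := ℝ)]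
  have hyl : Tendsto y atTop (𝓝 0) :=
    (tendsto_one_div_add_atTop_nhds_zero_nat (𝕜 := ℝ)).comp (tendsto_add_atTop_nat 1)
  -- The difference of the Cauchy kernels at two conjugate points is a multiple of the Poisson
  -- kernel.
  have hA : ∀ n (x : ℝ), ∫ t, F t * ((y n / ((x - t) ^ 2 + y n ^ 2) : ℝ) : ℂ) = 0 := by
    intro n x
    have hz : (x + y n * Complex.I : ℂ).im = y n := by simp
    have hw : (x - y n * Complex.I : ℂ).im = -y n := by simp
    have hz0 : (x + y n * Complex.I : ℂ).im ≠ 0 := by rw [hz]; exact (hy0 n).ne'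
    have hw0 : (x - y n * Complex.I : ℂ).im ≠ 0 := by
      rw [hw]; exact neg_ne_zero.mpr (hy0 n).ne'
    have h1 := cauchyInt_sub_cauchyInt hz0 hw0 (integrable_div_ofReal_sub hF hz0)
      (integrable_div_ofReal_sub hF hw0)
    rw [h _ hz0 (by rw [hz, abs_of_pos (hy0 n)]; exact hy1 n),
      h _ hw0 (by rw [hw, abs_neg, abs_of_pos (hy0 n)]; exact hy1 n), sub_zero] at h1
    have hne : (x + y n * Complex.I - (x - y n * Complex.I) : ℂ) ≠ 0 := by
      intro h0
      have := congrArg Complex.im h0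
      simp at this
      linarith [hy0 n]
    have h2 := (mul_eq_zero.mp h1.symm).resolve_left hne
    have h3 : ∀ t : ℝ, F t * ((y n / ((x - t) ^ 2 + y n ^ 2) : ℝ) : ℂ) =
        (y n : ℂ) * (F t / (((t : ℂ) - (x + y n * Complex.I)) * (t - (x - y n * Complex.I)))) := by
      intro t
      have : ((t : ℂ) - (x + y n * Complex.I)) * (t - (x - y n * Complex.I)) =
          (((x - t) ^ 2 + y n ^ 2 : ℝ) : ℂ) := by
        push_cast
        linear_combination (-(y n : ℂ) ^ 2) * Complex.I_sq
      rw [this]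
      push_cast
      ring
    simp_rw [h3]
    rw [integral_const_mul, h2, mul_zero]
  have hB : ∀ n, ∫ t, F t * ((∫ x, φ x * (y n / ((x - t) ^ 2 + y n ^ 2)) : ℝ) : ℂ) = 0 := by
    intro n
    have hφi : Integrable φ := hφ.continuous.integrable_of_hasCompactSupport hφc
    have hker : Continuous fun p : ℝ × ℝ => y n / ((p.2 - p.1) ^ 2 + y n ^ 2) :=
      Continuous.div continuous_const (by fun_prop) fun p => by
        have := hy0 n
        positivity
    have hint : Integrable (fun p : ℝ × ℝ => F p.1 * (φ p.2 *
        (y n / ((p.2 - p.1) ^ 2 + y n ^ 2)) : ℝ)) (volume.prod volume) := by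
      have hm : AEStronglyMeasurable (fun p : ℝ × ℝ =>
          ((y n / ((p.2 - p.1) ^ 2 + y n ^ 2) : ℝ) : ℂ)) (volume.prod volume) :=
        (Complex.continuous_ofReal.comp hker).aestronglyMeasurable
      have hφc : Integrable fun x => (φ x : ℂ) := hφi.ofReal
      have h0 := (hF.mul_prod hφc).mul_bdd (c := (y n)⁻¹) hm
        (Eventually.of_forall fun p => by
          have := hy0 n
          rw [Complex.norm_real, Real.norm_of_nonneg (by positivity), div_le_iff₀ (by positivity)]
          rw [inv_mul_eq_div, le_div_iff₀ this]
          nlinarith [sq_nonneg (p.2 - p.1)])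
      refine h0.congr (Eventually.of_forall fun p => ?_)
      push_cast
      ring
    have h1 : ∀ t, F t * ((∫ x, φ x * (y n / ((x - t) ^ 2 + y n ^ 2)) : ℝ) : ℂ) =
        ∫ x, F t * (φ x * (y n / ((x - t) ^ 2 + y n ^ 2)) : ℝ) := fun t => by
      rw [integral_const_mul, integral_complex_ofReal]
    simp_rw [h1]
    rw [integral_integral_swap hint]
    refine integral_eq_zero_of_ae (Eventually.of_forall fun x => ?_)
    simp only [Pi.zero_apply]
    rw [← mul_zero (φ x : ℂ), ← hA n x, ← integral_const_mul]
    refine integral_congr_ae (Eventually.of_forall fun t => ?_)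
    push_cast
    ring
  have hlim : Tendsto (fun n => ∫ t, F t * ((∫ x, φ x * (y n / ((x - t) ^ 2 + y n ^ 2)) : ℝ) : ℂ))
      atTop (𝓝 (∫ t, F t * ((φ t * Real.pi : ℝ) : ℂ))) := by
    have hb : ∀ n t, ‖∫ x, φ x * (y n / ((x - t) ^ 2 + y n ^ 2))‖ ≤ K * Real.pi := by
      intro n t
      rw [integral_poisson_comp φ t (hy0 n), ← integral_univ_inv_one_add_sq, ← integral_const_mul]
      refine norm_integral_le_of_norm_le (integrable_inv_one_add_sq.const_mul K)
        (Eventually.of_forall fun u => ?_)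
      rw [norm_mul, Real.norm_of_nonneg (by positivity : 0 ≤ (1 + u ^ 2)⁻¹)]
      exact mul_le_mul_of_nonneg_right (hK _) (by positivity)
    refine tendsto_integral_of_dominated_convergence (fun t => ‖F t‖ * (K * Real.pi))
      (fun n => ?_) (hF.norm.mul_const _) (fun n => Eventually.of_forall fun t => ?_)
      (Eventually.of_forall fun t => ?_)
    · refine hF.aestronglyMeasurable.mul (Complex.continuous_ofReal.comp_aestronglyMeasurable ?_)
      have hker : Continuous fun p : ℝ × ℝ => φ p.2 * (y n / ((p.2 - p.1) ^ 2 + y n ^ 2)) :=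
        (hφ.continuous.comp continuous_snd).mul (Continuous.div continuous_const (by fun_prop)
          fun p => by
            have := hy0 n
            positivity)
      exact hker.stronglyMeasurable.integral_prod_right'.aestronglyMeasurable
    · rw [norm_mul, Complex.norm_real]
      exact mul_le_mul_of_nonneg_left (hb n t) (norm_nonneg _)
    · refine Tendsto.const_mul _ ((Complex.continuous_ofReal.tendsto _).comp ?_)
      simp_rw [fun n => integral_poisson_comp φ t (hy0 n)]
      exact integral_poisson_smul_tendsto hφ.continuous hK hyl t
  simp_rw [hB] at hlim
  have h0 := tendsto_nhds_unique hlim tendsto_const_nhds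
  have h4 : ∫ t, F t * ((φ t * Real.pi : ℝ) : ℂ) = Real.pi * ∫ t, φ t • F t := by
    rw [← integral_const_mul]
    refine integral_congr_ae (Eventually.of_forall fun t => ?_)
    simp only [Complex.real_smul]
    push_cast
    ring
  rw [h4] at h0
  exact (mul_eq_zero.mp h0).resolve_left (by exact_mod_cast Real.pi_ne_zero)

theorem coeFn_add_I_smul (a b : Lp ℂ 2 (volume : Measure ℝ)) :
    (a + Complex.I • b : Lp ℂ 2 (volume : Measure ℝ)) =ᵐ[volume] fun x => a x + Complex.I * b x := by
  filter_upwards [Lp.coeFn_add a (Complex.I • b), Lp.coeFn_smul Complex.I b] with x h1 h2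
  rw [h1, Pi.add_apply, h2]
  rfl

theorem fourier_add_I_smul_hilbertComplex (a : Lp ℂ 2 (volume : Measure ℝ)) :
    (𝓕 (a + Complex.I • hilbertComplex a) : Lp ℂ 2 (volume : Measure ℝ)) =ᵐ[volume]
      fun ξ => (1 + Real.sign ξ : ℂ) * (𝓕 a : Lp ℂ 2 (volume : Measure ℝ)) ξ := by
  have h : (𝓕 (a + Complex.I • hilbertComplex a) : Lp ℂ 2 (volume : Measure ℝ)) =
      𝓕 a + Complex.I • (memLp_symbol.toLp symbol • 𝓕 a : Lp ℂ 2 (volume : Measure ℝ)) := by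
    rw [hilbertComplex, FourierTransform.fourier_add, FourierTransform.fourier_smul,
      fourier_fourierInv_eq]
  rw [h]
  filter_upwards [coeFn_add_I_smul (𝓕 a) (memLp_symbol.toLp symbol • 𝓕 a), coeFn_symbol_smul (𝓕 a)]
    with ξ h1 h2
  rw [h1, h2, symbol]
  linear_combination (-(Real.sign ξ : ℂ) * (𝓕 a : Lp ℂ 2 (volume : Measure ℝ)) ξ) * Complex.I_sq

theorem isH2_add_hilbertComplex (a : Lp ℂ 2 (volume : Measure ℝ)) :
    IsH2 fun x => a x + Complex.I * hilbertComplex a x := by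
  refine IsH2.congr ((isH2_iff_fourier _).mpr ?_) (coeFn_add_I_smul a (hilbertComplex a))
  filter_upwards [fourier_add_I_smul_hilbertComplex a] with ξ h1 hξ
  rw [h1, Real.sign_of_neg hξ]
  simp

theorem cauchyInt_congr {F G : ℝ → ℂ} (h : F =ᵐ[volume] G) (z : ℂ) :
    cauchyInt F z = cauchyInt G z :=
  integral_congr_ae (h.mono fun t ht => by simp only [ht])

theorem integrable_div_ofReal_sub_of_memLp {G : ℝ → ℂ} (hG : MemLp G 2) {z : ℂ} (hz : z.im ≠ 0) :
    Integrable fun t => G t / ((t : ℂ) - z) := hG.integrable_mul (memLp_inv_ofReal_sub hz)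

theorem cauchyInt_conj (F : ℝ → ℂ) (z : ℂ) :
    cauchyInt (fun t => starRingEnd ℂ (F t)) z = starRingEnd ℂ (cauchyInt F (starRingEnd ℂ z)) := by
  rw [cauchyInt, cauchyInt, ← integral_conj]
  simp

theorem cauchyInt_add {F G : ℝ → ℂ} {z : ℂ} (h1 : Integrable fun t => F t / ((t : ℂ) - z))
    (h2 : Integrable fun t => G t / ((t : ℂ) - z)) :
    cauchyInt (fun t => F t + G t) z = cauchyInt F z + cauchyInt G z := by
  rw [cauchyInt, cauchyInt, cauchyInt, ← integral_add h1 h2]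
  simp only [add_div]

theorem cauchyInt_sub {F G : ℝ → ℂ} {z : ℂ} (h1 : Integrable fun t => F t / ((t : ℂ) - z))
    (h2 : Integrable fun t => G t / ((t : ℂ) - z)) :
    cauchyInt (fun t => F t - G t) z = cauchyInt F z - cauchyInt G z := by
  rw [cauchyInt, cauchyInt, cauchyInt, ← integral_sub h1 h2]
  simp only [sub_div]

theorem cauchyInt_const_mul (c : ℂ) (F : ℝ → ℂ) (z : ℂ) :
    cauchyInt (fun t => c * F t) z = c * cauchyInt F z := by
  rw [cauchyInt, cauchyInt, ← integral_const_mul]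
  simp only [mul_div_assoc]

/-- Dividing by `t + i` makes `G` integrable, and the resolvent identity carries the vanishing over
to the quotient away from `z = -i`. This is why the `L¹` uniqueness statement asks only for a strip.
-/
theorem ae_eq_zero_of_cauchyInt_eq_zero_of_memLp {G : ℝ → ℂ} (hG : MemLp G 2)
    (h : ∀ z : ℂ, z.im ≠ 0 → cauchyInt G z = 0) : ∀ᵐ x, G x = 0 := by
  have hI : (-Complex.I).im ≠ 0 := by simp
  have h1 := ae_eq_zero_of_cauchyInt_eq_zero (integrable_div_ofReal_sub_of_memLp hG hI)
    (fun z hz hz1 => by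
      have h2 := cauchyInt_sub_cauchyInt hz hI (integrable_div_ofReal_sub_of_memLp hG hz)
        (integrable_div_ofReal_sub_of_memLp hG hI)
      rw [h z hz, h _ hI, sub_zero] at h2
      have hne : z - -Complex.I ≠ 0 := by
        intro h0
        have := congrArg Complex.im h0
        simp at this
        have h3 := neg_lt_of_abs_lt hz1
        linarith
      rw [← (mul_eq_zero.mp h2.symm).resolve_left hne]
      refine integral_congr_ae (Eventually.of_forall fun t => ?_)
      simp only
      rw [div_div, mul_comm])
  filter_upwards [h1] with t ht
  exact (div_eq_zero_iff.mp ht).resolve_right (ofReal_sub_ne_zero hI t)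

/-- The Hilbert transform splits `2 G = P + conj N` with `P`, `N` in `ℋ²`. The Cauchy integral of
`conj N` vanishes above the axis because `N` is in `ℋ²`, and below it because those of `G` and `P`
do; hence `N = 0`. -/
theorem isH2_of_cauchyInt_eq_zero {G : ℝ → ℂ} (hG : MemLp G 2)
    (h : ∀ z : ℂ, z.im < 0 → cauchyInt G z = 0) : IsH2 G := by
  set a := hG.toLp G with ha
  set P : ℝ → ℂ := fun x => a x + Complex.I * hilbertComplex a x with hP
  set N : ℝ → ℂ := fun x => conjL a x + Complex.I * hilbertComplex (conjL a) x with hN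
  have hPH : IsH2 P := isH2_add_hilbertComplex a
  have hNH : IsH2 N := isH2_add_hilbertComplex (conjL a)
  have hsum : ∀ᵐ x, 2 * G x = P x + starRingEnd ℂ (N x) := by
    rw [hN, ← conjL_hilbertComplex]
    filter_upwards [hG.coeFn_toLp, coeFn_conjL a, coeFn_conjL (hilbertComplex a)] with x h1 h2 h3
    rw [hP]
    simp only [h2, h3, map_add, map_mul, Complex.conj_conj, Complex.conj_I]
    rw [ha, h1]
    ring
  have hNm : MemLp (fun x => starRingEnd ℂ (N x)) 2 := hNH.1.star
  have hN0 : ∀ᵐ x, starRingEnd ℂ (N x) = 0 := by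
    refine ae_eq_zero_of_cauchyInt_eq_zero_of_memLp hNm fun z hz => ?_
    rcases lt_or_gt_of_ne hz with h0 | h0
    · have h1 : cauchyInt (fun x => 2 * G x) z = cauchyInt P z +
          cauchyInt (fun x => starRingEnd ℂ (N x)) z := by
        rw [cauchyInt_congr hsum, cauchyInt_add (integrable_div_ofReal_sub_of_memLp hPH.1 hz)
          (integrable_div_ofReal_sub_of_memLp hNm hz)]
      rw [cauchyInt_const_mul, h z h0, hPH.cauchyInt_eq_zero h0, mul_zero, zero_add] at h1
      exact h1.symm
    · rw [cauchyInt_conj, hNH.cauchyInt_eq_zero (by simpa using h0), map_zero]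
  refine (hPH.const_mul 2⁻¹).congr ?_
  filter_upwards [hsum, hN0] with x h1 h2
  rw [h2, add_zero] at h1
  rw [← h1]
  ring

/-- A residue computation without contours: partial fractions through the conjugate of `ζ` leave a
Poisson integral, known from the arctangent, and a product of two `ℋ²` functions, which integrates
to zero. -/
theorem cauchyInt_inv_ofReal_sub {p ζ : ℂ} (hp : p.im < 0) (hζ : 0 < ζ.im) :
    cauchyInt (fun t : ℝ => ((t : ℂ) - p)⁻¹) ζ = 2 * Real.pi * Complex.I / (ζ - p) := by
  have hζ' : (starRingEnd ℂ ζ).im < 0 := by simpa using hζ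
  have hI1 := (memLp_inv_ofReal_sub hp.ne).integrable_mul (memLp_inv_ofReal_sub hζ.ne')
  have hI2 := (memLp_inv_ofReal_sub hζ'.ne).integrable_mul (memLp_inv_ofReal_sub hζ.ne')
  have hI3 := (memLp_inv_ofReal_sub hp.ne).integrable_mul (memLp_inv_ofReal_sub hζ'.ne)
  have h1 : ∫ t : ℝ, ((t : ℂ) - starRingEnd ℂ ζ)⁻¹ * ((t : ℂ) - ζ)⁻¹ = Real.pi / ζ.im := by
    rw [← Complex.ofReal_div, ← (integrable_inv_sq_add_sq hζ ζ.re).2, ← integral_complex_ofReal]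
    refine integral_congr_ae (Eventually.of_forall fun t => ?_)
    simp only
    rw [← mul_inv, Complex.ofReal_inv]
    congr 1
    have h2 : (t : ℂ) - starRingEnd ℂ ζ = starRingEnd ℂ (t - ζ) := by simp
    rw [h2, ← Complex.normSq_eq_conj_mul_self, Complex.normSq_apply]
    push_cast
    simp
    ring
  have h2 : ∫ t : ℝ, ((t : ℂ) - p)⁻¹ * ((t : ℂ) - starRingEnd ℂ ζ)⁻¹ = 0 :=
    (isH2_inv_ofReal_sub hp).integral_mul_eq_zero (isH2_inv_ofReal_sub hζ')
  have hne : ζ - p ≠ 0 := by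
    intro h0
    have := congrArg Complex.im h0
    simp at this
    linarith
  rw [eq_div_iff hne, mul_comm, cauchyInt, ← integral_const_mul]
  have h3 : ∀ t : ℝ, (ζ - p) * (((t : ℂ) - p)⁻¹ / (t - ζ)) =
      (ζ - starRingEnd ℂ ζ) * (((t : ℂ) - starRingEnd ℂ ζ)⁻¹ * ((t : ℂ) - ζ)⁻¹) +
      (starRingEnd ℂ ζ - p) * (((t : ℂ) - p)⁻¹ * ((t : ℂ) - starRingEnd ℂ ζ)⁻¹) := by
    intro t
    have e1 := ofReal_sub_ne_zero hp.ne t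
    have e2 := ofReal_sub_ne_zero hζ.ne' t
    have e3 := ofReal_sub_ne_zero hζ'.ne t
    field_simp
    ring
  simp_rw [h3]
  refine (integral_add (hI2.const_mul _) (hI3.const_mul _)).trans ?_
  simp only [Pi.mul_apply]
  rw [integral_const_mul, integral_const_mul, h1,
    h2, mul_zero, add_zero, Complex.sub_conj]
  have : (ζ.im : ℂ) ≠ 0 := by exact_mod_cast hζ.ne'
  push_cast
  field_simp

/-- Division by a zero in the upper half-plane. The resolvent identity expresses the Cauchy integral
of the quotient in the lower half-plane through two vanishing ones. -/
theorem IsH2.div_of_cauchyInt_eq_zero {G : ℝ → ℂ} (hG : IsH2 G) {z : ℂ} (hz : 0 < z.im)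
    (h : cauchyInt G z = 0) : IsH2 fun t => G t / ((t : ℂ) - z) := by
  refine isH2_of_cauchyInt_eq_zero (memLp_div_ofReal_sub hG.1 hz.ne') fun w hw => ?_
  have h1 := cauchyInt_sub_cauchyInt hz.ne' hw.ne
    (integrable_div_ofReal_sub_of_memLp hG.1 hz.ne') (integrable_div_ofReal_sub_of_memLp hG.1 hw.ne)
  rw [h, hG.cauchyInt_eq_zero hw, sub_zero] at h1
  have hne : z - w ≠ 0 := by
    intro h0
    have := congrArg Complex.im h0
    simp at this
    linarith
  rw [← (mul_eq_zero.mp h1.symm).resolve_left hne]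
  refine integral_congr_ae (Eventually.of_forall fun t => ?_)
  simp only
  rw [div_div]

/-- The Cauchy integral is multiplicative on `ℋ²`. -/
theorem IsH2.cauchyInt_mul {G K : ℝ → ℂ} (hG : IsH2 G) (hK : IsH2 K) {z : ℂ} (hz : 0 < z.im) :
    2 * Real.pi * Complex.I * cauchyInt (fun t => G t * K t) z = cauchyInt G z * cauchyInt K z := by
  have hz' : (starRingEnd ℂ z).im < 0 := by simpa using hz
  set k : ℝ → ℂ := fun t => ((t : ℂ) - starRingEnd ℂ z)⁻¹ with hk
  have hkH : IsH2 k := isH2_inv_ofReal_sub hz'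
  have hπ : (2 * Real.pi * Complex.I : ℂ) ≠ 0 := by simp [Real.pi_ne_zero]
  have hne : z - starRingEnd ℂ z ≠ 0 := by
    rw [Complex.sub_conj]
    simp [hz.ne']
  set c : ℂ := cauchyInt G z * (z - starRingEnd ℂ z) / (2 * Real.pi * Complex.I) with hc
  have hck : cauchyInt k z = 2 * Real.pi * Complex.I / (z - starRingEnd ℂ z) :=
    cauchyInt_inv_ofReal_sub hz' hz
  -- Subtracting a multiple of the reproducing kernel makes `G₀` vanish at `z`. Then `G₀ / (t - z)`
  -- is in `ℋ²` and its product with `K` integrates to zero, so only the kernel term remains to be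
  -- evaluated.
  set G₀ : ℝ → ℂ := fun t => G t + -c * k t with hG₀
  have hG₀H : IsH2 G₀ := hG.add (hkH.const_mul (-c))
  have h0 : cauchyInt G₀ z = 0 := by
    rw [hG₀, cauchyInt_add (integrable_div_ofReal_sub_of_memLp hG.1 hz.ne')
      (integrable_div_ofReal_sub_of_memLp (hkH.const_mul (-c)).1 hz.ne'), cauchyInt_const_mul, hck, hc]
    field_simp
    ring
  have h1 : cauchyInt (fun t => G₀ t * K t) z = 0 := by
    rw [← (hG₀H.div_of_cauchyInt_eq_zero hz h0).integral_mul_eq_zero hK]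
    refine integral_congr_ae (Eventually.of_forall fun t => ?_)
    simp only
    ring
  have h2 : (z - starRingEnd ℂ z) * cauchyInt (fun t => k t * K t) z = cauchyInt K z := by
    have h3 := cauchyInt_sub_cauchyInt hz.ne' hz'.ne
      (integrable_div_ofReal_sub_of_memLp hK.1 hz.ne') (integrable_div_ofReal_sub_of_memLp hK.1 hz'.ne)
    rw [hK.cauchyInt_eq_zero hz', sub_zero] at h3
    rw [h3]
    congr 1
    refine integral_congr_ae (Eventually.of_forall fun t => ?_)
    simp only [hk]
    field_simp
  have h4 : cauchyInt (fun t => G t * K t) z = cauchyInt (fun t => G₀ t * K t) z +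
      c * cauchyInt (fun t => k t * K t) z := by
    rw [← cauchyInt_const_mul, ← cauchyInt_add
      (integrable_div_ofReal_sub (hG₀H.integrable_mul hK) hz.ne')
      (integrable_div_ofReal_sub ((hkH.integrable_mul hK).const_mul c) hz.ne')]
    congr 1
    ext t
    simp only [hG₀]
    ring
  rw [h4, h1, zero_add, ← h2, hc]
  field_simp

end RealHardy

/-! ### Real parts, and identification of the two complex Hardy spaces. -/

namespace RealHardy

open Filter Topology

/-- Purely imaginary values mean `D = -conj D`, so vanishing of the Cauchy integral in the lower
half-plane reflects to the upper one. -/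
theorem IsH2.ae_eq_zero_of_re_eq_zero {D : ℝ → ℂ} (hD : IsH2 D) (h : ∀ᵐ x, (D x).re = 0) :
    ∀ᵐ x, D x = 0 := by
  refine ae_eq_zero_of_cauchyInt_eq_zero_of_memLp hD.1 fun z hz => ?_
  rcases lt_or_gt_of_ne hz with h0 | h0
  · exact hD.cauchyInt_eq_zero h0
  · have h1 : D =ᵐ[volume] fun x => -1 * starRingEnd ℂ (D x) := by
      filter_upwards [h] with x hx
      exact Complex.ext (by simp [hx]) (by simp)
    rw [cauchyInt_congr h1, cauchyInt_const_mul, cauchyInt_conj,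
      hD.cauchyInt_eq_zero (by simpa using h0), map_zero, mul_zero]

theorem ae_eq_zero_of_re_eq_zero {D : ℝ → ℂ} (hD : Integrable D)
    (hD0 : ∀ z : ℂ, z.im < 0 → cauchyInt D z = 0) (h : ∀ᵐ x, (D x).re = 0) :
    ∀ᵐ x, D x = 0 := by
  refine ae_eq_zero_of_cauchyInt_eq_zero hD fun z hz _ => ?_
  rcases lt_or_gt_of_ne hz with h0 | h0
  · exact hD0 z h0
  · have h1 : D =ᵐ[volume] fun x => -1 * starRingEnd ℂ (D x) := by
      filter_upwards [h] with x hx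
      exact Complex.ext (by simp [hx]) (by simp)
    rw [cauchyInt_congr h1, cauchyInt_const_mul, cauchyInt_conj,
      hD0 _ (by simpa using h0), map_zero, mul_zero]

theorem isH2_add_hilbert (g : Lp ℝ 2 (volume : Measure ℝ)) :
    IsH2 fun x => (g x : ℂ) + Complex.I * (hilbert g x : ℂ) := by
  refine (isH2_add_hilbertComplex (toComplex g)).congr ?_
  rw [← toComplex_hilbert]
  filter_upwards [Complex.ofRealCLM.coeFn_compLp g, Complex.ofRealCLM.coeFn_compLp (hilbert g)]
    with x h1 h2
  rw [toComplex, h1, toComplex, h2]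
  rfl

theorem IsH2.exists_hilbert {G : ℝ → ℂ} (hG : IsH2 G) : ∃ g : Lp ℝ 2 (volume : Measure ℝ),
    ∀ᵐ x, G x = (g x : ℂ) + Complex.I * (hilbert g x : ℂ) := by
  have hre : MemLp (fun x => (G x).re) 2 := hG.1.re
  refine ⟨hre.toLp _, ?_⟩
  have h1 := hG.add ((isH2_add_hilbert (hre.toLp _)).const_mul (-1))
  have h2 := h1.ae_eq_zero_of_re_eq_zero (by
    filter_upwards [hre.coeFn_toLp] with x hx
    simp [hx])
  filter_upwards [h2] with x hx
  linear_combination hx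

theorem coeFn_complexPair (g h : ℝ →ₘ[volume] ℝ) :
    complexPair g h =ᵐ[volume] fun x => (g x : ℂ) + Complex.I * (h x : ℂ) :=
  AEEqFun.coeFn_comp₂ _ _ _ _

theorem mem_hardyComplexTwo_iff (α : ℝ →ₘ[volume] ℂ) : α ∈ hardyComplexTwo ↔ IsH2 α := by
  constructor
  · rintro ⟨g, rfl⟩
    exact (isH2_add_hilbert g).congr (coeFn_complexPair _ _).symm
  · intro h
    obtain ⟨g, hg⟩ := h.exists_hilbert
    refine ⟨g, AEEqFun.ext ?_⟩
    exact EventuallyEq.trans hg (coeFn_complexPair _ _).symm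

theorem fourier_add_I_mul {g h : ℝ → ℝ} (hg : Integrable g) (hh : Integrable h) (ξ : ℝ) :
    𝓕 (fun x => (g x : ℂ) + Complex.I * (h x : ℂ)) ξ =
      𝓕 (fun x => (g x : ℂ)) ξ + Complex.I * 𝓕 (fun x => (h x : ℂ)) ξ := by
  have h1 : Integrable fun v : ℝ => Real.fourierChar (-(v * ξ)) • (g v : ℂ) :=
    by simpa [mul_comm] using (Real.fourierIntegral_convergent_iff (μ := volume) (f := fun v : ℝ => (g v : ℂ)) ξ).mpr hg.ofReal
  have h2 : Integrable fun v : ℝ => Real.fourierChar (-(v * ξ)) • (h v : ℂ) :=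
    by simpa [mul_comm] using (Real.fourierIntegral_convergent_iff (μ := volume) (f := fun v : ℝ => (h v : ℂ)) ξ).mpr hh.ofReal
  rw [Real.fourier_real_eq, Real.fourier_real_eq, Real.fourier_real_eq, ← integral_const_mul,
    ← integral_add h1 (h2.const_mul _)]
  refine integral_congr_ae (Eventually.of_forall fun x => ?_)
  simp only [smul_add, mul_smul_comm]

theorem continuous_fourier {g : ℝ → ℝ} (hg : Integrable g) :
    Continuous (𝓕 fun x => (g x : ℂ)) :=
  VectorFourier.fourierIntegral_continuous Real.continuous_fourierChar
    (by exact continuous_inner) hg.ofReal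

theorem conj_fourier_ofReal (g : ℝ → ℝ) (ξ : ℝ) :
    starRingEnd ℂ (𝓕 (fun x => (g x : ℂ)) ξ) = 𝓕 (fun x => (g x : ℂ)) (-ξ) := by
  rw [Real.fourier_real_eq_integral_exp_smul, Real.fourier_real_eq_integral_exp_smul,
    ← integral_conj]
  refine integral_congr_ae (Eventually.of_forall fun x => ?_)
  simp [← Complex.exp_conj, Complex.conj_ofNat]

theorem isH1_of_isHilbertOne {g h : Lp ℝ 1 (volume : Measure ℝ)} (hgh : IsHilbertOne g h) :
    IsH1 fun x => (g x : ℂ) + Complex.I * (h x : ℂ) := by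
  have hg : Integrable g := L1.integrable_coeFn g
  have hh : Integrable h := L1.integrable_coeFn h
  refine ⟨hg.ofReal.add (hh.ofReal.const_mul _), fun ξ hξ => ?_⟩
  rw [fourier_add_I_mul hg hh, hgh]
  rcases hξ.lt_or_eq with h0 | rfl
  · rw [symbol, Real.sign_of_neg h0]
    push_cast
    linear_combination (𝓕 (fun x => (g x : ℂ)) ξ) * Complex.I_sq
  -- At frequency zero the symbol vanishes, so `𝓕 h 0 = 0`; continuity from the right also gives `𝓕
  -- h 0 = -i 𝓕 g 0`, and therefore `𝓕 g 0 = 0`.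
  · have hc : Tendsto (𝓕 fun x => (h x : ℂ)) (𝓝[>] 0) (𝓝 (𝓕 (fun x => (h x : ℂ)) 0)) :=
      ((continuous_fourier hh).tendsto 0).mono_left nhdsWithin_le_nhds
    have hc' : Tendsto (fun ξ : ℝ => -Complex.I * 𝓕 (fun x => (g x : ℂ)) ξ) (𝓝[>] 0)
        (𝓝 (-Complex.I * 𝓕 (fun x => (g x : ℂ)) 0)) :=
      (((continuous_fourier hg).tendsto 0).mono_left nhdsWithin_le_nhds).const_mul _
    have h1 : 𝓕 (fun x => (h x : ℂ)) 0 = -Complex.I * 𝓕 (fun x => (g x : ℂ)) 0 := by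
      refine tendsto_nhds_unique hc (hc'.congr' ?_)
      filter_upwards [self_mem_nhdsWithin] with ξ hξ
      rw [hgh, symbol, Real.sign_of_pos hξ]
      simp
    have h2 : 𝓕 (fun x => (h x : ℂ)) 0 = 0 := by
      rw [hgh, symbol, Real.sign_zero]
      simp
    rw [h2] at h1
    have h3 := (mul_eq_zero.mp h1.symm).resolve_left (by simp)
    rw [h3, symbol, Real.sign_zero]
    simp

theorem isHilbertOne_of_isH1 {g h : Lp ℝ 1 (volume : Measure ℝ)}
    (hF : IsH1 fun x => (g x : ℂ) + Complex.I * (h x : ℂ)) : IsHilbertOne g h := by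
  have hg : Integrable g := L1.integrable_coeFn g
  have hh : Integrable h := L1.integrable_coeFn h
  have hneg : ∀ ξ ≤ 0, 𝓕 (fun x => (g x : ℂ)) ξ + Complex.I * 𝓕 (fun x => (h x : ℂ)) ξ = 0 :=
    fun ξ hξ => by rw [← fourier_add_I_mul hg hh]; exact hF.2 ξ hξ
  -- Since `g` and `h` are real, conjugation reflects the relation on the negative half-line to the
  -- positive one.
  have hpos : ∀ ξ, 0 ≤ ξ → 𝓕 (fun x => (g x : ℂ)) ξ - Complex.I * 𝓕 (fun x => (h x : ℂ)) ξ = 0 := by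
    intro ξ hξ
    have h1 := congrArg (starRingEnd ℂ) (hneg (-ξ) (by linarith))
    rw [map_add, map_mul, conj_fourier_ofReal, conj_fourier_ofReal, neg_neg, Complex.conj_I,
      map_zero] at h1
    rw [← h1]
    ring
  intro ξ
  rcases lt_trichotomy ξ 0 with h0 | rfl | h0
  · rw [symbol, Real.sign_of_neg h0]
    push_cast
    linear_combination (-Complex.I) * hneg ξ h0.le +
      (𝓕 (fun x => (h x : ℂ)) ξ) * Complex.I_sq
  · rw [symbol, Real.sign_zero]
    push_cast
    linear_combination (-Complex.I / 2) * (hneg 0 le_rfl - hpos 0 le_rfl) +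
      (𝓕 (fun x => (h x : ℂ)) 0) * Complex.I_sq
  · rw [symbol, Real.sign_of_pos h0]
    push_cast
    linear_combination Complex.I * hpos ξ h0.le + (𝓕 (fun x => (h x : ℂ)) ξ) * Complex.I_sq

theorem mem_hardyComplexOne_iff (δ : ℝ →ₘ[volume] ℂ) : δ ∈ hardyComplexOne ↔ IsH1 δ := by
  constructor
  · rintro ⟨g, h, hgh, rfl⟩
    exact (isH1_of_isHilbertOne hgh).congr (coeFn_complexPair _ _).symm
  · intro hδ
    have hg : Integrable fun x => (δ x).re := hδ.1.re
    have hh : Integrable fun x => (δ x).im := hδ.1.im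
    have heq : ∀ᵐ x, δ x = (hg.toL1 _ x : ℂ) + Complex.I * (hh.toL1 _ x : ℂ) := by
      filter_upwards [hg.coeFn_toL1, hh.coeFn_toL1] with x h1 h2
      rw [h1, h2, mul_comm, Complex.re_add_im]
    refine ⟨hg.toL1 _, hh.toL1 _, isHilbertOne_of_isH1 (hδ.congr heq), AEEqFun.ext ?_⟩
    exact EventuallyEq.trans heq (coeFn_complexPair _ _).symm

end RealHardy

/-! ### Powers of the Blaschke factor as the trigonometric system of the line. -/

namespace RealHardy

open Filter Topology

/-- The Blaschke factor `(t - i) / (t + i)` on the line. -/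
noncomputable def blaschke (t : ℝ) : ℂ := (t - Complex.I) / (t + Complex.I)

theorem ofReal_add_I_ne_zero (t : ℝ) : (t : ℂ) + Complex.I ≠ 0 := by
  have := ofReal_sub_ne_zero (z := -Complex.I) (by simp) t
  simpa using this

theorem ofReal_sub_I_ne_zero (t : ℝ) : (t : ℂ) - Complex.I ≠ 0 :=
  ofReal_sub_ne_zero (by simp) t

theorem continuous_blaschke : Continuous blaschke :=
  Continuous.div (by fun_prop) (by fun_prop) ofReal_add_I_ne_zero

theorem conj_blaschke_mul (t : ℝ) : starRingEnd ℂ (blaschke t) * blaschke t = 1 := by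
  have h1 := ofReal_add_I_ne_zero t
  have h2 := ofReal_sub_I_ne_zero t
  simp only [blaschke, map_div₀, map_sub, map_add, Complex.conj_ofReal, Complex.conj_I,
    sub_neg_eq_add, ← sub_eq_add_neg]
  field_simp

theorem norm_blaschke (t : ℝ) : ‖blaschke t‖ = 1 := by
  have h := congrArg norm (conj_blaschke_mul t)
  rw [norm_mul, RCLike.norm_conj, norm_one, ← sq] at h
  exact (pow_eq_one_iff_of_nonneg (norm_nonneg _) two_ne_zero).mp h

theorem blaschke_eq (t : ℝ) : blaschke t = 1 - 2 * Complex.I * ((t : ℂ) - -Complex.I)⁻¹ := by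
  have h1 := ofReal_add_I_ne_zero t
  rw [blaschke, sub_neg_eq_add]
  field_simp
  ring

theorem IsH2.blaschke_mul {G : ℝ → ℂ} (hG : IsH2 G) : IsH2 fun t => blaschke t * G t := by
  have h := hG.add ((hG.div (w := -Complex.I) (by simp)).const_mul (-(2 * Complex.I)))
  refine h.congr (Eventually.of_forall fun t => ?_)
  simp only
  rw [blaschke_eq]
  ring

theorem IsH2.blaschke_pow_mul {G : ℝ → ℂ} (hG : IsH2 G) (n : ℕ) :
    IsH2 fun t => blaschke t ^ n * G t := by
  induction n with
  | zero => simpa using hG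
  | succ n ih =>
    refine ih.blaschke_mul.congr (Eventually.of_forall fun t => ?_)
    simp only
    ring

theorem integrable_mul_blaschke_pow {F : ℝ → ℂ} (hF : Integrable F) (n : ℕ) :
    Integrable fun t => F t * blaschke t ^ n :=
  hF.mul_bdd (c := 1) (continuous_blaschke.pow n).aestronglyMeasurable
    (Eventually.of_forall fun t => by rw [norm_pow, norm_blaschke, one_pow])

theorem IsH1.integral_mul_blaschke_pow_eq_zero {F : ℝ → ℂ} (hF : IsH1 F) (n : ℕ) :
    ∫ t, F t * blaschke t ^ n = 0 := by
  induction n generalizing F with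
  | zero => simpa using hF.integral_eq_zero
  | succ n ih =>
    have h1 := ih (hF.div (w := -Complex.I) (by simp))
    have h2 : ∀ t, F t * blaschke t ^ (n + 1) = F t * blaschke t ^ n -
        2 * Complex.I * (F t / ((t : ℂ) - -Complex.I) * blaschke t ^ n) := by
      intro t
      rw [pow_succ]
      nth_rewrite 2 [blaschke_eq]
      ring
    simp_rw [h2]
    rw [integral_sub (integrable_mul_blaschke_pow hF.1 n)
      ((integrable_mul_blaschke_pow (hF.div (w := -Complex.I) (by simp)).1 n).const_mul _),
      integral_const_mul, h1, ih hF]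
    simp

theorem one_sub_mul_blaschke_ne_zero {a : ℂ} (ha : ‖a‖ < 1) (t : ℝ) : 1 - a * blaschke t ≠ 0 := by
  intro h
  have h1 : ‖a * blaschke t‖ = 1 := by rw [← sub_eq_zero.mp h, norm_one]
  rw [norm_mul, norm_blaschke, mul_one] at h1
  exact ha.ne h1

/-- Geometric series, summable in `L¹` because the Blaschke factor is unimodular. Together with
`inv_ofReal_sub_eq_blaschke` it turns vanishing moments into vanishing Cauchy integrals. -/
theorem integral_div_one_sub_mul_blaschke {F : ℝ → ℂ} (hF : Integrable F)
    (h : ∀ n : ℕ, ∫ t, F t * blaschke t ^ n = 0) {a : ℂ} (ha : ‖a‖ < 1) :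
    ∫ t, F t / (1 - a * blaschke t) = 0 := by
  have hint : ∀ n : ℕ, Integrable fun t => a ^ n * (F t * blaschke t ^ n) := fun n =>
    (integrable_mul_blaschke_pow hF n).const_mul _
  have hs := hasSum_integral_of_summable_integral_norm hint (by
    have h1 : ∀ n : ℕ, ∫ t, ‖a ^ n * (F t * blaschke t ^ n)‖ = ‖a‖ ^ n * ∫ t, ‖F t‖ := fun n => by
      rw [← integral_const_mul]
      refine integral_congr_ae (Eventually.of_forall fun t => ?_)
      simp only
      rw [norm_mul, norm_mul, norm_pow, norm_pow, norm_blaschke, one_pow, mul_one]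
    simp_rw [h1]
    exact (summable_geometric_of_lt_one (norm_nonneg _) ha).mul_right _)
  simp_rw [integral_const_mul, h, mul_zero] at hs
  rw [← hs.unique hasSum_zero]
  refine integral_congr_ae (Eventually.of_forall fun t => ?_)
  simp only
  have h2 : ∀ n : ℕ, a ^ n * (F t * blaschke t ^ n) = F t * (a * blaschke t) ^ n := fun n => by
    rw [mul_pow]; ring
  simp_rw [h2]
  rw [tsum_mul_left, tsum_geometric_of_norm_lt_one (by rwa [norm_mul, norm_blaschke, mul_one]),
    div_eq_mul_inv]

theorem norm_cayley_lt_one {z : ℂ} (hz : z.im < 0) :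
    Complex.I - z ≠ 0 ∧ ‖-(Complex.I + z) / (Complex.I - z)‖ < 1 := by
  have h1 : Complex.I - z ≠ 0 := by
    intro h0
    have := congrArg Complex.im h0
    simp at this
    linarith
  refine ⟨h1, ?_⟩
  rw [norm_div, norm_neg, div_lt_one (norm_pos_iff.mpr h1), Complex.norm_def, Complex.norm_def]
  refine Real.sqrt_lt_sqrt (Complex.normSq_nonneg _) ?_
  rw [Complex.normSq_apply, Complex.normSq_apply]
  simp
  nlinarith

theorem inv_ofReal_sub_eq_blaschke {z : ℂ} (hz : z.im < 0) (t : ℝ) :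
    ((t : ℂ) + Complex.I) / (t - z) = 2 * Complex.I / (Complex.I - z) *
      (1 - -(Complex.I + z) / (Complex.I - z) * blaschke t)⁻¹ := by
  obtain ⟨h1, h2⟩ := norm_cayley_lt_one hz
  have h3 := one_sub_mul_blaschke_ne_zero h2 t
  have h4 := ofReal_sub_ne_zero hz.ne t
  have h5 := ofReal_add_I_ne_zero t
  rw [eq_mul_inv_iff_mul_eq₀ h3, div_mul_eq_mul_div, div_eq_div_iff h4 h1, blaschke]
  field_simp
  ring

theorem cauchyInt_eq_zero_of_blaschke {F : ℝ → ℂ} (hF : Integrable F)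
    (h : ∀ n : ℕ, ∫ t, F t * blaschke t ^ n = 0) {z : ℂ} (hz : z.im < 0) : cauchyInt F z = 0 := by
  have hF' : Integrable fun t => F t * (1 - blaschke t) := by
    have h1 := hF.sub (integrable_mul_blaschke_pow hF 1)
    refine h1.congr (Eventually.of_forall fun t => ?_)
    simp only [Pi.sub_apply]
    ring
  have h1 := integral_div_one_sub_mul_blaschke hF' (fun n => by
    have h2 : ∀ t, F t * (1 - blaschke t) * blaschke t ^ n =
        F t * blaschke t ^ n - F t * blaschke t ^ (n + 1) := fun t => by ring
    simp_rw [h2]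
    rw [integral_sub (integrable_mul_blaschke_pow hF n) (integrable_mul_blaschke_pow hF (n + 1)),
      h n, h (n + 1), sub_zero]) (norm_cayley_lt_one hz).2
  have h2 : ∀ t : ℝ, F t / ((t : ℂ) - z) = (Complex.I - z)⁻¹ * (F t * (1 - blaschke t) /
      (1 - -(Complex.I + z) / (Complex.I - z) * blaschke t)) := by
    intro t
    have h3 := inv_ofReal_sub_eq_blaschke hz t
    have h5 := ofReal_add_I_ne_zero t
    have h4 : 1 - blaschke t = 2 * Complex.I / (t + Complex.I) := by
      rw [blaschke]
      field_simp
      ring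
    rw [h4, div_eq_mul_inv (F t * _)]
    have h6 : ((t : ℂ) - z)⁻¹ = (t + Complex.I) / (t - z) / (t + Complex.I) := by
      field_simp
    rw [div_eq_mul_inv, h6, h3]
    ring
  rw [cauchyInt]
  simp_rw [h2]
  rw [integral_const_mul, h1, mul_zero]

/-- The functions `(t + i)⁻¹ bⁿ` generate all Cauchy kernels with pole in the lower half-plane. The
factor `(t + i)⁻¹` also makes the `L²` function integrable. -/
theorem isH2_of_integral_blaschke_eq_zero {G : ℝ → ℂ} (hG : MemLp G 2)
    (h : ∀ n : ℕ, ∫ t, G t * ((t : ℂ) + Complex.I)⁻¹ * blaschke t ^ n = 0) : IsH2 G := by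
  refine isH2_of_cauchyInt_eq_zero hG fun z hz => ?_
  have hint : Integrable fun t : ℝ => G t * ((t : ℂ) + Complex.I)⁻¹ := by
    have := integrable_div_ofReal_sub_of_memLp hG (z := -Complex.I) (by simp)
    simpa [div_eq_mul_inv] using this
  have h1 := integral_div_one_sub_mul_blaschke hint h (norm_cayley_lt_one hz).2
  have h2 : ∀ t : ℝ, G t / ((t : ℂ) - z) = 2 * Complex.I / (Complex.I - z) *
      (G t * ((t : ℂ) + Complex.I)⁻¹ / (1 - -(Complex.I + z) / (Complex.I - z) * blaschke t)) := by
    intro t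
    have h5 := ofReal_add_I_ne_zero t
    have h6 : ((t : ℂ) - z)⁻¹ = (t + Complex.I) / (t - z) / (t + Complex.I) := by
      field_simp
    rw [div_eq_mul_inv, h6, inv_ofReal_sub_eq_blaschke hz t]
    ring
  rw [cauchyInt]
  simp_rw [h2]
  rw [integral_const_mul, h1, mul_zero]

theorem ae_eq_zero_of_integral_blaschke_eq_zero {F : ℝ → ℂ} (hF : Integrable F)
    (h1 : ∀ n : ℕ, ∫ t, F t * blaschke t ^ n = 0)
    (h2 : ∀ n : ℕ, ∫ t, F t * starRingEnd ℂ (blaschke t) ^ n = 0) : ∀ᵐ t, F t = 0 := by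
  refine ae_eq_zero_of_cauchyInt_eq_zero hF fun z hz _ => ?_
  rcases lt_or_gt_of_ne hz with h0 | h0
  · exact cauchyInt_eq_zero_of_blaschke hF h1 h0
  · have hFc : Integrable fun t => starRingEnd ℂ (F t) :=
      (Complex.conjCLE : ℂ →L[ℝ] ℂ).integrable_comp hF
    have h3 := cauchyInt_eq_zero_of_blaschke hFc (fun n => by
      have h4 := congrArg (starRingEnd ℂ) (h2 n)
      rw [← integral_conj, map_zero] at h4
      simpa using h4) (z := starRingEnd ℂ z) (by simpa using h0)
    rw [cauchyInt_conj, Complex.conj_conj] at h3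
    exact (map_eq_zero _).mp h3

/-- Multiplication by a bounded function on `L²`. -/
noncomputable def mulOp (g : ℝ → ℂ) (hg : MemLp g ∞ (volume : Measure ℝ)) :
    Lp ℂ 2 (volume : Measure ℝ) →L[ℂ] Lp ℂ 2 (volume : Measure ℝ) :=
  (ContinuousLinearMap.mul ℂ ℂ).holderL volume ∞ 2 2 (hg.toLp g)

theorem coeFn_mulOp (g : ℝ → ℂ) (hg : MemLp g ∞ (volume : Measure ℝ))
    (f : Lp ℂ 2 (volume : Measure ℝ)) : mulOp g hg f =ᵐ[volume] fun t => g t * f t := by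
  filter_upwards [(ContinuousLinearMap.mul ℂ ℂ).coeFn_holder (r := 2) (hg.toLp g) f,
    hg.coeFn_toLp] with t h1 h2
  have h3 : mulOp g hg f t = (ContinuousLinearMap.mul ℂ ℂ).holder 2 (hg.toLp g) f t := rfl
  rw [h3, h1, h2]
  rfl

theorem memLp_blaschke : MemLp blaschke ∞ (volume : Measure ℝ) :=
  memLp_top_of_bound continuous_blaschke.aestronglyMeasurable 1
    (Eventually.of_forall fun t => (norm_blaschke t).le)

theorem memLp_conj_blaschke : MemLp (fun t => starRingEnd ℂ (blaschke t)) ∞ (volume : Measure ℝ) :=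
  memLp_blaschke.star

theorem coeFn_mulOp_pow (g : ℝ → ℂ) (hg : MemLp g ∞ (volume : Measure ℝ)) (n : ℕ)
    (f : Lp ℂ 2 (volume : Measure ℝ)) : (mulOp g hg ^ n) f =ᵐ[volume] fun t => g t ^ n * f t := by
  induction n with
  | zero => exact Eventually.of_forall fun t => by simp
  | succ n ih =>
    rw [pow_succ']
    filter_upwards [coeFn_mulOp g hg ((mulOp g hg ^ n) f), ih] with t h1 h2
    rw [mul_apply_eq_comp, h1, h2]
    ring

theorem mulOp_conj_blaschke_mulOp (f : Lp ℂ 2 (volume : Measure ℝ)) :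
    mulOp _ memLp_conj_blaschke (mulOp _ memLp_blaschke f) = f := by
  apply Lp.ext
  filter_upwards [coeFn_mulOp _ memLp_conj_blaschke (mulOp _ memLp_blaschke f),
    coeFn_mulOp _ memLp_blaschke f] with t h1 h2
  rw [h1, h2, ← mul_assoc, conj_blaschke_mul, one_mul]

/-- One Blaschke factor converts `1 / (1 + t²)` into `(t + i)⁻²`, leaving a product of two `ℋ²`
functions. In the disc picture this says that nontrivial characters have mean zero. -/
theorem integral_blaschke_pow_div (n : ℕ) :
    ∫ t : ℝ, blaschke t ^ (n + 1) * ((1 + t ^ 2 : ℝ) : ℂ)⁻¹ = 0 := by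
  have hk : IsH2 fun t : ℝ => ((t : ℂ) - -Complex.I)⁻¹ := isH2_inv_ofReal_sub (by simp)
  rw [← (hk.blaschke_pow_mul n).integral_mul_eq_zero hk]
  refine integral_congr_ae (Eventually.of_forall fun t => ?_)
  have h1 := ofReal_add_I_ne_zero t
  have h2 := ofReal_sub_I_ne_zero t
  have h3 : ((1 + t ^ 2 : ℝ) : ℂ) = (t + Complex.I) * (t - Complex.I) := by
    push_cast
    linear_combination Complex.I_sq
  simp only
  rw [h3, pow_succ, blaschke, sub_neg_eq_add]
  field_simp

end RealHardy

/-! ### The wandering vector and factorization of analytic functions. -/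

namespace RealHardy

open Filter Topology

/-- The closed span of `bᵐ h`, `m ≥ n`, where `b` is the Blaschke factor. -/
noncomputable def shiftSpan (h : Lp ℂ 2 (volume : Measure ℝ)) (n : ℕ) :
    Submodule ℂ (Lp ℂ 2 (volume : Measure ℝ)) :=
  (Submodule.span ℂ (Set.range fun m : ℕ =>
    (mulOp _ memLp_blaschke ^ (n + m)) h)).topologicalClosure

theorem mem_shiftSpan (h : Lp ℂ 2 (volume : Measure ℝ)) {n m : ℕ} (hm : n ≤ m) :
    (mulOp _ memLp_blaschke ^ m) h ∈ shiftSpan h n := by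
  refine Submodule.le_topologicalClosure _ (Submodule.subset_span ⟨m - n, ?_⟩)
  simp only
  rw [Nat.add_sub_cancel' hm]

theorem shiftSpan_le {h : Lp ℂ 2 (volume : Measure ℝ)} {n : ℕ}
    {V : Submodule ℂ (Lp ℂ 2 (volume : Measure ℝ))} (hV : IsClosed (V : Set (Lp ℂ 2 (volume : Measure ℝ))))
    (hm : ∀ m, n ≤ m → (mulOp _ memLp_blaschke ^ m) h ∈ V) : shiftSpan h n ≤ V := by
  refine Submodule.topologicalClosure_minimal _ (Submodule.span_le.mpr ?_) hV
  rintro _ ⟨m, rfl⟩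
  exact hm _ (Nat.le_add_right n m)

theorem isClosed_shiftSpan (h : Lp ℂ 2 (volume : Measure ℝ)) (n : ℕ) :
    IsClosed (shiftSpan h n : Set (Lp ℂ 2 (volume : Measure ℝ))) :=
  Submodule.isClosed_topologicalClosure _

theorem isClosed_comap {V : Submodule ℂ (Lp ℂ 2 (volume : Measure ℝ))}
    (hV : IsClosed (V : Set (Lp ℂ 2 (volume : Measure ℝ))))
    (T : Lp ℂ 2 (volume : Measure ℝ) →L[ℂ] Lp ℂ 2 (volume : Measure ℝ)) :
    IsClosed (V.comap T.toLinearMap : Set (Lp ℂ 2 (volume : Measure ℝ))) :=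
  hV.preimage T.continuous

theorem mulOp_blaschke_mem_shiftSpan {h v : Lp ℂ 2 (volume : Measure ℝ)} {n : ℕ}
    (hv : v ∈ shiftSpan h n) : mulOp _ memLp_blaschke v ∈ shiftSpan h (n + 1) := by
  refine shiftSpan_le (V := (shiftSpan h (n + 1)).comap (mulOp _ memLp_blaschke).toLinearMap)
    (isClosed_comap (isClosed_shiftSpan _ _) _) (fun m hm => ?_) hv
  have := mem_shiftSpan h (n := n + 1) (m := m + 1) (by omega)
  rw [pow_succ'] at this
  exact this

theorem shiftSpan_anti (h : Lp ℂ 2 (volume : Measure ℝ)) (n : ℕ) :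
    shiftSpan h (n + 1) ≤ shiftSpan h n :=
  shiftSpan_le (isClosed_shiftSpan _ _) fun _ hm => mem_shiftSpan h (by omega)

/-- If `h` already lies in the span of its proper shifts, the two spans coincide and multiplication
by `conj b` maps the span into itself. This is the degenerate case of Beurling's dichotomy. -/
theorem conj_pow_mem_shiftSpan {h : Lp ℂ 2 (volume : Measure ℝ)} (hh : h ∈ shiftSpan h 1) (n : ℕ) :
    (mulOp _ memLp_conj_blaschke ^ n) h ∈ shiftSpan h 0 := by
  have h0 : shiftSpan h 0 ≤ shiftSpan h 1 := shiftSpan_le (isClosed_shiftSpan _ _) fun m _ => by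
    rcases Nat.eq_zero_or_pos m with rfl | hm
    · simpa using hh
    · exact mem_shiftSpan h hm
  have h1 : shiftSpan h 1 ≤
      (shiftSpan h 0).comap (mulOp _ memLp_conj_blaschke).toLinearMap := by
    refine shiftSpan_le (isClosed_comap (isClosed_shiftSpan _ _) _) fun m hm => ?_
    obtain ⟨m, rfl⟩ := Nat.exists_eq_add_of_le' hm
    rw [pow_succ']
    change mulOp _ memLp_conj_blaschke (mulOp _ memLp_blaschke
      ((mulOp _ memLp_blaschke ^ m) h)) ∈ shiftSpan h 0
    rw [mulOp_conj_blaschke_mulOp]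
    exact mem_shiftSpan h (Nat.zero_le m)
  induction n with
  | zero => simpa using mem_shiftSpan h (le_refl 0)
  | succ n ih =>
    rw [pow_succ']
    exact h1 (h0 ih)

theorem inner_eq_integral (f g : Lp ℂ 2 (volume : Measure ℝ)) :
    inner ℂ f g = ∫ t, starRingEnd ℂ (f t) * g t := by
  rw [L2.inner_def]
  refine integral_congr_ae (Eventually.of_forall fun t => ?_)
  simp only
  rw [RCLike.inner_apply, mul_comm]

/-- The defect of the shift: a function in `shiftSpan h 0` of squared modulus `c / (1 + t²)`,
orthogonal to `shiftSpan h 1`. -/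
theorem exists_wandering {h : Lp ℂ 2 (volume : Measure ℝ)} (hh : h ∉ shiftSpan h 1) :
    ∃ q ∈ shiftSpan h 0, (∀ v ∈ shiftSpan h 1, inner ℂ q v = 0) ∧ ∃ c : ℝ, 0 < c ∧
      ∀ᵐ t, starRingEnd ℂ (q t) * q t = c * ((1 + t ^ 2 : ℝ) : ℂ)⁻¹ := by
  have : CompleteSpace (shiftSpan h 1) := (isClosed_shiftSpan h 1).completeSpace_coe
  obtain ⟨v, hv, q, hq, hvq⟩ := (shiftSpan h 1).exists_add_mem_mem_orthogonal h
  have hq0 : q ∈ shiftSpan h 0 := by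
    have h1 : q = h - v := by rw [hvq]; abel
    rw [h1]
    refine Submodule.sub_mem _ ?_ (shiftSpan_anti h 0 hv)
    simpa using mem_shiftSpan h (le_refl 0)
  have hqne : q ≠ 0 := by
    rintro rfl
    rw [add_zero] at hvq
    exact hh (hvq ▸ hv)
  have hort : ∀ v ∈ shiftSpan h 1, inner ℂ q v = 0 := fun v hv =>
    (Submodule.mem_orthogonal' _ _).mp hq v hv
  have hpow : ∀ n, (mulOp _ memLp_blaschke ^ n) q ∈ shiftSpan h 0 := by
    intro n
    induction n with
    | zero => simpa using hq0
    | succ n ih =>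
      rw [pow_succ']
      exact shiftSpan_anti h 0 (mulOp_blaschke_mem_shiftSpan ih)
  -- Chosen so that `c / (1 + t²)` has the same integral as `|q|²`.
  set c : ℝ := ‖q‖ ^ 2 / Real.pi with hc
  refine ⟨q, hq0, hort, c, by have := norm_pos_iff.mpr hqne; positivity, ?_⟩
  -- All moments of `D` vanish: the zeroth by the choice of `c`, the positive ones because `bⁿ q`
  -- lies in `shiftSpan h 1`, orthogonal to `q`, and the negative ones because `D` is real.
  set D : ℝ → ℂ := fun t => starRingEnd ℂ (q t) * q t - c * ((1 + t ^ 2 : ℝ) : ℂ)⁻¹ with hD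
  have hi1 : Integrable fun t => starRingEnd ℂ (q t) * q t :=
    MemLp.integrable_mul (Lp.memLp q).star (Lp.memLp q)
  have hi2 : Integrable fun t : ℝ => (c : ℂ) * ((1 + t ^ 2 : ℝ) : ℂ)⁻¹ := by
    have h1 : Integrable fun t : ℝ => (((1 + t ^ 2)⁻¹ : ℝ) : ℂ) := integrable_inv_one_add_sq.ofReal
    simpa using h1.const_mul (c : ℂ)
  have hDi : Integrable D := hi1.sub hi2
  have hmom : ∀ n : ℕ, ∫ t, D t * blaschke t ^ n = 0 := by
    intro n
    have h1 : ∫ t, starRingEnd ℂ (q t) * q t * blaschke t ^ n =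
        inner ℂ q ((mulOp _ memLp_blaschke ^ n) q) := by
      rw [inner_eq_integral]
      refine integral_congr_ae ?_
      filter_upwards [coeFn_mulOp_pow _ memLp_blaschke n q] with t ht
      rw [ht]
      ring
    have h2 : ∫ t, D t * blaschke t ^ n = (∫ t, starRingEnd ℂ (q t) * q t * blaschke t ^ n) -
        ∫ t, (c : ℂ) * ((1 + t ^ 2 : ℝ) : ℂ)⁻¹ * blaschke t ^ n := by
      rw [← integral_sub (integrable_mul_blaschke_pow hi1 n) (integrable_mul_blaschke_pow hi2 n)]
      simp only [hD, sub_mul]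
    rw [h2, h1]
    rcases n with _ | n
    · simp only [pow_zero, mul_one]
      have h3 : inner ℂ q ((1 : Lp ℂ 2 (volume : Measure ℝ) →L[ℂ] _) q) = ((‖q‖ ^ 2 : ℝ) : ℂ) := by
        rw [one_apply_eq_self, inner_self_eq_norm_sq_to_K]
        norm_cast
      rw [h3, integral_const_mul]
      simp_rw [← Complex.ofReal_inv]
      rw [integral_complex_ofReal, integral_univ_inv_one_add_sq, hc]
      have : (Real.pi : ℂ) ≠ 0 := by exact_mod_cast Real.pi_ne_zero
      push_cast
      field_simp
      ring
    · rw [hort]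
      · have h4 := integral_blaschke_pow_div n
        simp_rw [mul_assoc, mul_comm _ (blaschke _ ^ _)]
        rw [integral_const_mul, h4, mul_zero, sub_zero]
      · rw [pow_succ']
        exact mulOp_blaschke_mem_shiftSpan (hpow n)
  have hDconj : ∀ t, starRingEnd ℂ (D t) = D t := fun t => by
    simp only [hD, map_sub, map_mul, Complex.conj_conj, Complex.conj_ofReal, map_inv₀]
    ring
  have hD0 := ae_eq_zero_of_integral_blaschke_eq_zero hDi hmom (fun n => by
    have h1 := congrArg (starRingEnd ℂ) (hmom n)
    rw [← integral_conj, map_zero] at h1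
    rw [← h1]
    refine integral_congr_ae (Eventually.of_forall fun t => ?_)
    simp only [map_mul, map_pow, hDconj])
  filter_upwards [hD0] with t ht
  exact sub_eq_zero.mp ht

theorem isH2_zero : IsH2 fun _ => 0 := ⟨MemLp.zero, fun φ _ => by simp⟩

/-- Factorization of a function with vanishing moments into factors in `ℋ²`. -/
theorem exists_factorization {F : ℝ → ℂ} (hF : Integrable F)
    (hm : ∀ n : ℕ, ∫ t, F t * blaschke t ^ n = 0) : ∃ G K : ℝ → ℂ, IsH2 G ∧ IsH2 K ∧
      (∀ᵐ t, F t = G t * K t) ∧ (∀ᵐ t, ‖G t‖ ^ 2 = ‖F t‖) ∧ ∀ᵐ t, ‖K t‖ ^ 2 = ‖F t‖ := by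
  -- The trivial splitting `F = h₀ h₁` has the right moduli but no analyticity. A unimodular `u` is
  -- sought with `conj u * h₀` and `u * h₁` both in `ℋ²`.
  set h₀ : ℝ → ℂ := fun t => (Real.sqrt ‖F t‖ : ℂ) with hh₀
  set h₁ : ℝ → ℂ := fun t => F t / (Real.sqrt ‖F t‖ : ℂ) with hh₁
  have hn0 : ∀ t, ‖h₀ t‖ = Real.sqrt ‖F t‖ := fun t => by
    rw [hh₀, Complex.norm_real, Real.norm_of_nonneg (Real.sqrt_nonneg _)]
  have hn1 : ∀ t, ‖h₁ t‖ = Real.sqrt ‖F t‖ := fun t => by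
    rw [hh₁, norm_div, Complex.norm_real, Real.norm_of_nonneg (Real.sqrt_nonneg _)]
    exact Real.div_sqrt
  have hprod : ∀ t, h₀ t * h₁ t = F t := fun t => by
    by_cases h0 : F t = 0
    · simp [hh₀, hh₁, h0]
    · have : (Real.sqrt ‖F t‖ : ℂ) ≠ 0 := by
        rw [Complex.ofReal_ne_zero]
        exact (Real.sqrt_pos.mpr (norm_pos_iff.mpr h0)).ne'
      simp only [hh₀, hh₁]
      field_simp
  have hsm : AEStronglyMeasurable (fun t => (Real.sqrt ‖F t‖ : ℂ)) volume :=
    Complex.continuous_ofReal.comp_aestronglyMeasurable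
      (Real.continuous_sqrt.comp_aestronglyMeasurable hF.aestronglyMeasurable.norm)
  have hmem : ∀ {g : ℝ → ℂ}, AEStronglyMeasurable g volume →
      (∀ᵐ t, ‖g t‖ = Real.sqrt ‖F t‖) → MemLp g 2 := by
    intro g hg hgn
    rw [memLp_two_iff_integrable_sq_norm hg]
    refine hF.norm.congr ?_
    filter_upwards [hgn] with t ht
    rw [ht, Real.sq_sqrt (norm_nonneg _)]
  have hm0 : MemLp h₀ 2 := hmem hsm (Eventually.of_forall hn0)
  have hm1' : AEStronglyMeasurable h₁ volume :=
    (hF.aestronglyMeasurable.aemeasurable.div hsm.aemeasurable).aestronglyMeasurable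
  have hm1 : MemLp h₁ 2 := hmem hm1' (Eventually.of_forall hn1)
  set h := hm0.toLp h₀ with hh
  set h' := hm1.toLp h₁ with hh'
  -- The vanishing moments of `F = h₀ h₁` say that `conj h₁` is orthogonal to every `bᵐ h₀`.
  have hΛ : ∀ v ∈ shiftSpan h 0, inner ℂ (conjL h') v = 0 := by
    intro v hv
    have hc : IsClosed ((innerSL ℂ (conjL h')).ker : Set (Lp ℂ 2 (volume : Measure ℝ))) :=
      (innerSL ℂ (conjL h')).isClosed_ker
    refine (shiftSpan_le hc (fun m _ => ?_) hv : v ∈ (innerSL ℂ (conjL h')).ker)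
    have h1 : inner ℂ (conjL h') ((mulOp _ memLp_blaschke ^ m) h) = 0 := by
      rw [inner_eq_integral, ← hm m]
      refine integral_congr_ae ?_
      filter_upwards [coeFn_conjL h', coeFn_mulOp_pow _ memLp_blaschke m h, hm0.coeFn_toLp,
        hm1.coeFn_toLp] with t e1 e2 e3 e4
      rw [e1, e2, hh, hh', e3, e4, Complex.conj_conj, ← hprod t]
      ring
    exact h1
  -- In the degenerate case the moments of `F` against negative powers of the Blaschke factor vanish
  -- too, so `F = 0`.
  by_cases hh1 : h ∈ shiftSpan h 1
  · have h0 : ∀ᵐ t, F t = 0 := by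
      refine ae_eq_zero_of_integral_blaschke_eq_zero hF hm fun n => ?_
      rw [← hΛ _ (conj_pow_mem_shiftSpan hh1 n), inner_eq_integral]
      refine integral_congr_ae ?_
      filter_upwards [coeFn_conjL h', coeFn_mulOp_pow _ memLp_conj_blaschke n h, hm0.coeFn_toLp,
        hm1.coeFn_toLp] with t e1 e2 e3 e4
      rw [e1, e2, hh, hh', e3, e4, Complex.conj_conj, ← hprod t]
      ring
    refine ⟨fun _ => 0, fun _ => 0, isH2_zero, isH2_zero, ?_, ?_, ?_⟩ <;>
    · filter_upwards [h0] with t ht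
      simp [ht]
  obtain ⟨q, hq0, hq1, c, hc, hqc⟩ := exists_wandering hh1
  -- Since `|q|² = c / (1 + t²)`, this normalization is unimodular.
  set u : ℝ → ℂ := fun t => q t * ((t + Complex.I) / (Real.sqrt c : ℂ)) with hu
  have hsc : (Real.sqrt c : ℂ) ≠ 0 := by
    rw [Complex.ofReal_ne_zero]
    exact (Real.sqrt_pos.mpr hc).ne'
  have hsc2 : (Real.sqrt c : ℂ) ^ 2 = c := by
    rw [← Complex.ofReal_pow, Real.sq_sqrt hc.le]
  have huu : ∀ᵐ t, starRingEnd ℂ (u t) * u t = 1 := by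
    filter_upwards [hqc] with t ht
    have h1 := ofReal_add_I_ne_zero t
    have h2 := ofReal_sub_I_ne_zero t
    have h3 : ((1 + t ^ 2 : ℝ) : ℂ) = (t + Complex.I) * (t - Complex.I) := by
      push_cast
      linear_combination Complex.I_sq
    have h4 : starRingEnd ℂ (u t) * u t = (starRingEnd ℂ (q t) * q t) *
        ((t - Complex.I) * (t + Complex.I) / (Real.sqrt c : ℂ) ^ 2) := by
      simp only [hu, map_mul, map_div₀, map_add, Complex.conj_ofReal, Complex.conj_I,
        ← sub_eq_add_neg]
      field_simp
    have hc' : (c : ℂ) ≠ 0 := by exact_mod_cast hc.ne'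
    rw [h4, ht, h3, hsc2]
    field_simp
  have hun : ∀ᵐ t, ‖u t‖ = 1 := by
    filter_upwards [huu] with t ht
    have := congrArg norm ht
    rw [norm_mul, RCLike.norm_conj, norm_one, ← sq] at this
    exact (pow_eq_one_iff_of_nonneg (norm_nonneg _) two_ne_zero).mp this
  have hum : AEStronglyMeasurable u volume :=
    (Lp.aestronglyMeasurable q).mul (by fun_prop : Continuous fun t : ℝ =>
      ((t : ℂ) + Complex.I) / (Real.sqrt c : ℂ)).aestronglyMeasurable
  have hGm : MemLp (fun t => starRingEnd ℂ (u t) * h₀ t) 2 := by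
    refine hmem (hum.star.mul hsm) ?_
    filter_upwards [hun] with t ht
    rw [norm_mul, RCLike.norm_conj, ht, one_mul, hn0]
  have hKm : MemLp (fun t => u t * h₁ t) 2 := by
    refine hmem (hum.mul hm1') ?_
    filter_upwards [hun] with t ht
    rw [norm_mul, ht, one_mul, hn1]
  have hqpow : ∀ n, (mulOp _ memLp_blaschke ^ n) q ∈ shiftSpan h 0 := by
    intro n
    induction n with
    | zero => simpa using hq0
    | succ n ih =>
      rw [pow_succ']
      exact shiftSpan_anti h 0 (mulOp_blaschke_mem_shiftSpan ih)
  refine ⟨_, _, isH2_of_integral_blaschke_eq_zero hGm fun n => ?_,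
    isH2_of_integral_blaschke_eq_zero hKm fun n => ?_, ?_, ?_, ?_⟩
  -- Conjugating `t + i` inside `u` and dividing by `t + i` produces one extra Blaschke factor,
  -- hence `n + 1`: the moment is that of `conj q * h₀` against a proper shift. For the other factor
  -- the `t + i` cancels, and `bⁿ q ∈ shiftSpan h 0` suffices.
  · have h1 := hq1 _ (mem_shiftSpan h (n := 1) (m := n + 1) (by omega))
    rw [inner_eq_integral] at h1
    rw [← mul_zero ((Real.sqrt c : ℂ)⁻¹), ← h1, ← integral_const_mul]
    refine integral_congr_ae ?_
    filter_upwards [coeFn_mulOp_pow _ memLp_blaschke (n + 1) h, hm0.coeFn_toLp] with t e1 e2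
    have h2 := ofReal_add_I_ne_zero t
    rw [e1, hh, e2, pow_succ]
    simp only [hu, map_mul, map_div₀, map_add, Complex.conj_ofReal, Complex.conj_I]
    nth_rewrite 3 [blaschke]
    field_simp
    ring
  · have h1 := hΛ _ (hqpow n)
    rw [inner_eq_integral] at h1
    rw [← mul_zero ((Real.sqrt c : ℂ)⁻¹), ← h1, ← integral_const_mul]
    refine integral_congr_ae ?_
    filter_upwards [coeFn_mulOp_pow _ memLp_blaschke n q, coeFn_conjL h', hm1.coeFn_toLp]
      with t e1 e2 e3
    have h2 := ofReal_add_I_ne_zero t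
    rw [e1, e2, hh', e3, Complex.conj_conj]
    simp only [hu]
    field_simp
  · filter_upwards [huu] with t ht
    rw [← hprod t]
    linear_combination (-(h₀ t * h₁ t)) * ht
  · filter_upwards [hun] with t ht
    rw [norm_mul, RCLike.norm_conj, ht, one_mul, hn0, Real.sq_sqrt (norm_nonneg _)]
  · filter_upwards [hun] with t ht
    rw [norm_mul, ht, one_mul, hn1, Real.sq_sqrt (norm_nonneg _)]

end RealHardy

namespace RealHardy

open Filter Topology

/-! ### Factorization of the real Hardy space -/

theorem integrable_cauchy_kernel {f : ℝ → ℝ} (hf : Integrable f) {η : ℝ} (hη : 0 < η) {ζ : ℂ}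
    (hζ : ζ.im ≠ 0) : Integrable (fun p : ℝ × ℝ => (f p.2 : ℂ) / ((p.2 : ℂ) - (p.1 + η * Complex.I)) /
      ((p.1 : ℂ) - ζ)) (volume.prod volume) := by
  have h1 : Integrable (fun p : ℝ × ℝ => ‖f p.2‖ * (η ^ 2 + (p.1 - p.2) ^ 2)⁻¹)
      (volume.prod volume) := by
    have h2 := (integrable_inv_sq_add_sq hη 0).1
    simp only [sub_zero] at h2
    exact hf.norm.convolution_integrand (ContinuousLinearMap.mul ℝ ℝ) h2
  have h2 : Integrable (fun p : ℝ × ℝ => ‖((p.1 : ℂ) - ζ)⁻¹‖ ^ 2 * ‖f p.2‖)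
      (volume.prod volume) :=
    ((memLp_two_iff_integrable_sq_norm
      (continuous_inv_ofReal_sub hζ).aestronglyMeasurable).mp (memLp_inv_ofReal_sub hζ)).mul_prod
      hf.norm
  have hz : ∀ p : ℝ × ℝ, ((p.2 : ℂ) - (p.1 + η * Complex.I)) ≠ 0 := fun p =>
    ofReal_sub_ne_zero (z := p.1 + η * Complex.I) (by simpa using hη.ne') p.2
  refine (h1.add h2).mono' ?_ (Eventually.of_forall fun p => ?_)
  · have hm : AEStronglyMeasurable (fun p : ℝ × ℝ => (f p.2 : ℂ)) (volume.prod volume) :=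
      Complex.continuous_ofReal.comp_aestronglyMeasurable hf.aestronglyMeasurable.comp_snd
    have hc1 : Continuous fun p : ℝ × ℝ => ((p.2 : ℂ) - (p.1 + η * Complex.I))⁻¹ :=
      Continuous.inv₀ (by fun_prop) hz
    have hc2 : Continuous fun p : ℝ × ℝ => ((p.1 : ℂ) - ζ)⁻¹ :=
      (continuous_inv_ofReal_sub hζ).comp continuous_fst
    simp_rw [div_eq_mul_inv]
    exact (hm.mul hc1.aestronglyMeasurable).mul hc2.aestronglyMeasurable
  · have h3 : ‖((p.2 : ℂ) - (p.1 + η * Complex.I))⁻¹‖ ^ 2 = (η ^ 2 + (p.1 - p.2) ^ 2)⁻¹ := by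
      rw [norm_inv, inv_pow, ← Complex.normSq_eq_norm_sq, Complex.normSq_apply]
      congr 1
      simp
      ring
    rw [Pi.add_apply, ← h3, div_eq_mul_inv, div_eq_mul_inv, norm_mul, norm_mul, Complex.norm_real]
    have h4 := two_mul_le_add_sq ‖((p.2 : ℂ) - (p.1 + η * Complex.I))⁻¹‖ ‖((p.1 : ℂ) - ζ)⁻¹‖
    have h5 := norm_nonneg (f p.2)
    have h6 := mul_nonneg (norm_nonneg ((p.2 : ℂ) - (p.1 + η * Complex.I))⁻¹)
      (norm_nonneg ((p.1 : ℂ) - ζ)⁻¹)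
    nlinarith [mul_le_mul_of_nonneg_left h4 h5, mul_nonneg h5 h6]

theorem cauchyInt_analyticExt_eq {f : ℝ → ℝ} (hf : Integrable f) {η : ℝ} (hη : 0 < η) {ζ : ℂ}
    (hζ : ζ.im ≠ 0) : cauchyInt (fun x => analyticExt f (x + η * Complex.I)) ζ =
      (Real.pi * Complex.I)⁻¹ * ∫ t, (f t : ℂ) *
        -cauchyInt (fun x : ℝ => ((x : ℂ) - (t - η * Complex.I))⁻¹) ζ := by
  have h1 : cauchyInt (fun x => analyticExt f (x + η * Complex.I)) ζ =
      (Real.pi * Complex.I)⁻¹ * ∫ x : ℝ, ∫ t : ℝ,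
        (f t : ℂ) / ((t : ℂ) - (x + η * Complex.I)) / ((x : ℂ) - ζ) := by
    simp only [analyticExt]
    rw [cauchyInt_const_mul, cauchyInt]
    congr 1
    refine integral_congr_ae (Eventually.of_forall fun x => ?_)
    simp only
    rw [cauchyInt, ← integral_div]
  rw [h1, integral_integral_swap (integrable_cauchy_kernel hf hη hζ)]
  congr 1
  refine integral_congr_ae (Eventually.of_forall fun t => ?_)
  simp only
  rw [cauchyInt, ← integral_neg, ← integral_const_mul]
  refine integral_congr_ae (Eventually.of_forall fun x => ?_)
  simp only
  have h2 : (t : ℂ) - (x + η * Complex.I) = -((x : ℂ) - (t - η * Complex.I)) := by ring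
  rw [h2, div_neg, neg_div, mul_neg, neg_inj, div_eq_mul_inv (f t : ℂ), mul_div_assoc]

theorem cauchyInt_analyticExt_of_im_neg {f : ℝ → ℝ} (hf : Integrable f) {η : ℝ} (hη : 0 < η)
    {ζ : ℂ} (hζ : ζ.im < 0) : cauchyInt (fun x => analyticExt f (x + η * Complex.I)) ζ = 0 := by
  rw [cauchyInt_analyticExt_eq hf hη hζ.ne]
  have h1 : ∀ t : ℝ, cauchyInt (fun x : ℝ => ((x : ℂ) - (t - η * Complex.I))⁻¹) ζ = 0 := fun t =>
    (isH2_inv_ofReal_sub (by simpa using hη)).cauchyInt_eq_zero hζ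
  simp [h1]

/-- Fubini and the residue value of `cauchyInt_inv_ofReal_sub`. The factor 2 compares the
normalization `π i` of `analyticExt` with the `2 π i` of Cauchy's formula. -/
theorem cauchyInt_analyticExt_of_im_pos {f : ℝ → ℝ} (hf : Integrable f) {η : ℝ} (hη : 0 < η)
    {ζ : ℂ} (hζ : 0 < ζ.im) : cauchyInt (fun x => analyticExt f (x + η * Complex.I)) ζ =
      2 * cauchyInt (fun t => (f t : ℂ)) (ζ + η * Complex.I) := by
  rw [cauchyInt_analyticExt_eq hf hη hζ.ne', cauchyInt, ← integral_const_mul, ← integral_const_mul]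
  refine integral_congr_ae (Eventually.of_forall fun t => ?_)
  simp only
  rw [cauchyInt_inv_ofReal_sub (by simpa using hη) hζ]
  have h1 : ζ - (t - η * Complex.I) = -((t : ℂ) - (ζ + η * Complex.I)) := by ring
  have h2 := ofReal_sub_ne_zero (z := ζ + η * Complex.I) (by simp; positivity) t
  have h3 : (Real.pi : ℂ) ≠ 0 := by exact_mod_cast Real.pi_ne_zero
  rw [h1]
  field_simp

theorem continuous_analyticExt_line {f : ℝ → ℝ} (hf : Integrable f) {η : ℝ} (hη : 0 < η) :
    Continuous fun x : ℝ => analyticExt f (x + η * Complex.I) := by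
  rw [continuous_iff_continuousAt]
  intro x
  exact (continuousAt_analyticExt hf (z := x + η * Complex.I) (by simpa using hη.ne')).comp
    (f := fun x : ℝ => (x : ℂ) + η * Complex.I) (by fun_prop)

theorem norm_analyticExt_le {f : ℝ → ℝ} (hf : Integrable f) {η : ℝ} (hη : 0 < η) (x : ℝ) :
    ‖analyticExt f (x + η * Complex.I)‖ ≤ ‖(Real.pi * Complex.I : ℂ)⁻¹‖ * (η⁻¹ * ∫ t, ‖f t‖) := by
  rw [analyticExt, norm_mul]
  refine mul_le_mul_of_nonneg_left ?_ (norm_nonneg _)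
  rw [cauchyInt, ← integral_const_mul]
  refine norm_integral_le_of_norm_le (hf.norm.const_mul _) (Eventually.of_forall fun t => ?_)
  have h1 := norm_inv_ofReal_sub_le (z := x + η * Complex.I) (by simpa using hη.ne') t
  have h2 : (x + η * Complex.I : ℂ).im = η := by simp
  rw [h2, abs_of_pos hη] at h1
  rw [div_eq_mul_inv, norm_mul, Complex.norm_real, mul_comm]
  exact mul_le_mul_of_nonneg_right h1 (norm_nonneg _)

/-- Multiplication by `R i / (t + R i)`, which is bounded by 1 and tends to 1 as `R → ∞`, reduces
the integral to Cauchy integrals in the lower half-plane. -/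
theorem IsH2.integral_eq_zero_of_integrable {F : ℝ → ℂ} (hF : IsH2 F) (hi : Integrable F) :
    ∫ t, F t = 0 := by
  have hR : ∀ n : ℕ, (-(((n : ℝ) + 1 : ℝ) : ℂ) * Complex.I).im < 0 := fun n => by
    simp
    linarith [n.cast_nonneg (α := ℝ)]
  have hlim : Tendsto (fun n : ℕ => ∫ t : ℝ, (((n : ℝ) + 1 : ℝ) : ℂ) * Complex.I *
      (F t / ((t : ℂ) - -(((n : ℝ) + 1 : ℝ) : ℂ) * Complex.I))) atTop (𝓝 (∫ t, F t)) := by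
    refine tendsto_integral_of_dominated_convergence (fun t => ‖F t‖) (fun n => ?_) hi.norm
      (fun n => Eventually.of_forall fun t => ?_) (Eventually.of_forall fun t => ?_)
    · exact ((integrable_div_ofReal_sub hi (hR n).ne).const_mul _).aestronglyMeasurable
    · have h1 := norm_inv_ofReal_sub_le (hR n).ne t
      have h2 : (-(((n : ℝ) + 1 : ℝ) : ℂ) * Complex.I).im = -((n : ℝ) + 1) := by simp
      have h3 : (0 : ℝ) < (n : ℝ) + 1 := by positivity
      rw [h2, abs_neg, abs_of_pos h3] at h1
      rw [norm_mul, norm_mul, Complex.norm_I, mul_one, Complex.norm_real,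
        Real.norm_of_nonneg h3.le, div_eq_mul_inv, norm_mul]
      calc _ ≤ ((n : ℝ) + 1) * (‖F t‖ * ((n : ℝ) + 1)⁻¹) := by gcongr
        _ = ‖F t‖ := by field_simp
    · have h4 : Tendsto (fun n : ℕ => F t * (((t : ℂ) * ((1 / ((n : ℝ) + 1) : ℝ) : ℂ) *
          -Complex.I) + 1)⁻¹) atTop (𝓝 (F t * (((t : ℂ) * ((0 : ℝ) : ℂ) * -Complex.I) + 1)⁻¹)) := by
        refine Tendsto.const_mul _ (Tendsto.inv₀ ?_ (by simp))
        refine Tendsto.add_const _ (Tendsto.mul_const _ (Tendsto.const_mul _ ?_))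
        exact (Complex.continuous_ofReal.tendsto 0).comp tendsto_one_div_add_atTop_nhds_zero_nat
      simp only [Complex.ofReal_zero, mul_zero, zero_mul, zero_add, inv_one, mul_one] at h4
      refine h4.congr fun n => ?_
      have h5 := ofReal_sub_ne_zero (hR n).ne t
      have h6 : (((n : ℝ) + 1 : ℝ) : ℂ) ≠ 0 := by
        rw [Complex.ofReal_ne_zero]; positivity
      have h7 : (t : ℂ) * ((1 / ((n : ℝ) + 1) : ℝ) : ℂ) * -Complex.I + 1 =
          ((t : ℂ) - -(((n : ℝ) + 1 : ℝ) : ℂ) * Complex.I) /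
            ((((n : ℝ) + 1 : ℝ) : ℂ) * Complex.I) := by
        rw [eq_div_iff (mul_ne_zero h6 Complex.I_ne_zero), Complex.ofReal_div]
        field_simp
        rw [Complex.ofReal_one]
        linear_combination (-(t : ℂ)) * Complex.I_sq
      rw [h7, inv_div]
      ring
  have h0 : ∀ n : ℕ, ∫ t : ℝ, (((n : ℝ) + 1 : ℝ) : ℂ) * Complex.I *
      (F t / ((t : ℂ) - -(((n : ℝ) + 1 : ℝ) : ℂ) * Complex.I)) = 0 := fun n => by
    have h1 := hF.cauchyInt_eq_zero (hR n)
    rw [cauchyInt] at h1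
    rw [integral_const_mul, h1, mul_zero]
  simp_rw [h0] at hlim
  exact (tendsto_nhds_unique hlim tendsto_const_nhds)

theorem IsH2.integral_mul_blaschke_pow_eq_zero {F : ℝ → ℂ} (hF : IsH2 F) (hi : Integrable F)
    (n : ℕ) : ∫ t, F t * blaschke t ^ n = 0 := by
  have h1 := integrable_mul_blaschke_pow hi n
  simp_rw [mul_comm (F _)] at h1 ⊢
  exact (hF.blaschke_pow_mul n).integral_eq_zero_of_integrable h1

/-- Bounded sequences in a Hilbert space converge weakly along an ultrafilter. -/
theorem exists_weak_limit {H : Type*} [NormedAddCommGroup H] [InnerProductSpace ℂ H]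
    [CompleteSpace H] (U : Ultrafilter ℕ) (g : ℕ → H) (R : ℝ) (hg : ∀ n, ‖g n‖ ≤ R) :
    ∃ g₀ : H, ∀ v : H, Tendsto (fun n => inner ℂ (g n) v) U (𝓝 (inner ℂ g₀ v)) := by
  let Φ : ℕ → WeakDual ℂ H := fun n =>
    StrongDual.toWeakDual (InnerProductSpace.toDual ℂ H (g n))
  have hK := WeakDual.isCompact_closedBall (0 : StrongDual ℂ H) R
  have hmem : ∀ n, Φ n ∈ WeakDual.toStrongDual ⁻¹' Metric.closedBall (0 : StrongDual ℂ H) R := by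
    intro n
    rw [Set.mem_preimage, mem_closedBall_zero_iff]
    refine le_trans (le_of_eq ?_) (hg n)
    exact (InnerProductSpace.toDual ℂ H).norm_map (g n)
  obtain ⟨Λ, -, hΛ⟩ := hK.ultrafilter_le_nhds (U.map Φ)
    (le_principal_iff.mpr (Ultrafilter.mem_map.mpr (Filter.univ_mem' hmem)))
  refine ⟨(InnerProductSpace.toDual ℂ H).symm (WeakDual.toStrongDual Λ), fun v => ?_⟩
  have h1 : Tendsto Φ U (𝓝 Λ) := hΛ
  have h2 := ((WeakDual.eval_continuous (𝕜 := ℂ) v).tendsto Λ).comp h1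
  rw [InnerProductSpace.toDual_symm_apply]
  exact h2

theorem cauchyInt_eq_conj_inner (a : Lp ℂ 2 (volume : Measure ℝ)) {z : ℂ} (hz : z.im ≠ 0) :
    cauchyInt a z = starRingEnd ℂ (inner ℂ a ((memLp_inv_ofReal_sub
      (w := starRingEnd ℂ z) (by simpa using hz)).toLp _)) := by
  rw [inner_eq_integral, ← integral_conj, cauchyInt]
  refine integral_congr_ae ?_
  filter_upwards [(memLp_inv_ofReal_sub (w := starRingEnd ℂ z) (by simpa using hz)).coeFn_toLp]
    with t ht
  rw [ht]
  simp [div_eq_mul_inv]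

theorem norm_toLp_le {G F : ℝ → ℂ} (hG : MemLp G 2) (h : ∀ᵐ t, ‖G t‖ ^ 2 = ‖F t‖) {C : ℝ}
    (hC : ∫ t, ‖F t‖ ≤ C) : ‖hG.toLp G‖ ≤ Real.sqrt C := by
  refine Real.le_sqrt_of_sq_le (le_trans (le_of_eq ?_) hC)
  have h1 := inner_self_eq_norm_sq_to_K (𝕜 := ℂ) (hG.toLp G)
  have h2 : inner ℂ (hG.toLp G) (hG.toLp G) = ((∫ t, ‖F t‖ : ℝ) : ℂ) := by
    rw [inner_eq_integral, ← integral_complex_ofReal]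
    refine integral_congr_ae ?_
    filter_upwards [hG.coeFn_toLp, h] with t e1 e2
    rw [e1, ← e2, ← Complex.normSq_eq_conj_mul_self, Complex.normSq_eq_norm_sq]
  rw [h2] at h1
  apply Complex.ofReal_injective
  rw [h1]
  push_cast
  rfl

/-- An integrable function whose analytic extension is bounded in `L¹` on horizontal lines is the
real part of a product of two functions in `ℋ²`. -/
theorem exists_re_factorization {f : ℝ → ℝ} (hf : Integrable f) {C : ℝ≥0∞} (hC : C ≠ ∞)
    (hfC : ∀ η : ℝ, 0 < η → ∫⁻ x : ℝ, ‖analyticExt f (x + η * Complex.I)‖ₑ ≤ C) :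
    ∃ G K : ℝ → ℂ, IsH2 G ∧ IsH2 K ∧ ∀ᵐ t, f t = (G t * K t).re := by
  set η : ℕ → ℝ := fun n => 1 / ((n : ℝ) + 1) with hη
  have hη0 : ∀ n, 0 < η n := fun n => Nat.one_div_pos_of_nat
  set F : ℕ → ℝ → ℂ := fun n x => analyticExt f (x + η n * Complex.I) with hF
  have hFc : ∀ n, Continuous (F n) := fun n => continuous_analyticExt_line hf (hη0 n)
  have hFi : ∀ n, Integrable (F n) := fun n =>
    ⟨(hFc n).aestronglyMeasurable, lt_of_le_of_lt (hfC _ (hη0 n)) hC.lt_top⟩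
  have hF2 : ∀ n, MemLp (F n) 2 := fun n => by
    rw [memLp_two_iff_integrable_sq_norm (hFc n).aestronglyMeasurable]
    have h1 := (hFi n).norm.mul_bdd (hFc n).norm.aestronglyMeasurable
      (Eventually.of_forall fun x => by
        rw [norm_norm]
        exact norm_analyticExt_le hf (hη0 n) x)
    simpa only [sq] using h1
  have hFH : ∀ n, IsH2 (F n) := fun n => isH2_of_cauchyInt_eq_zero (hF2 n) fun z hz =>
    cauchyInt_analyticExt_of_im_neg hf (hη0 n) hz
  have hFn : ∀ n, ∫ t, ‖F n t‖ ≤ C.toReal := fun n => by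
    rw [integral_norm_eq_lintegral_enorm (hFc n).aestronglyMeasurable]
    exact ENNReal.toReal_mono hC (hfC _ (hη0 n))
  choose G K hG hK hGK hGn hKn using fun n =>
    exists_factorization (hFi n) ((hFH n).integral_mul_blaschke_pow_eq_zero (hFi n))
  -- A single ultrafilter provides weak limits for both sequences of factors, with no extraction of
  -- subsequences.
  set U : Ultrafilter ℕ := hyperfilter ℕ with hU
  have hUle : (U : Filter ℕ) ≤ atTop := Nat.hyperfilter_le_atTop
  obtain ⟨g, hg⟩ := exists_weak_limit U (fun n => (hG n).1.toLp (G n)) _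
    fun n => norm_toLp_le (hG n).1 (hGn n) (hFn n)
  obtain ⟨k, hk⟩ := exists_weak_limit U (fun n => (hK n).1.toLp (K n)) _
    fun n => norm_toLp_le (hK n).1 (hKn n) (hFn n)
  have hgl : ∀ z : ℂ, z.im ≠ 0 → Tendsto (fun n => cauchyInt (G n) z) U (𝓝 (cauchyInt g z)) := by
    intro z hz
    rw [cauchyInt_eq_conj_inner g hz]
    refine ((Complex.continuous_conj.tendsto _).comp (hg _)).congr fun n => ?_
    rw [Function.comp_apply, ← cauchyInt_eq_conj_inner _ hz]
    exact cauchyInt_congr (hG n).1.coeFn_toLp z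
  have hkl : ∀ z : ℂ, z.im ≠ 0 → Tendsto (fun n => cauchyInt (K n) z) U (𝓝 (cauchyInt k z)) := by
    intro z hz
    rw [cauchyInt_eq_conj_inner k hz]
    refine ((Complex.continuous_conj.tendsto _).comp (hk _)).congr fun n => ?_
    rw [Function.comp_apply, ← cauchyInt_eq_conj_inner _ hz]
    exact cauchyInt_congr (hK n).1.coeFn_toLp z
  have hgH : IsH2 g := isH2_of_cauchyInt_eq_zero (Lp.memLp g) fun z hz => by
    refine tendsto_nhds_unique (hgl z hz.ne) (tendsto_const_nhds.congr fun n => ?_)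
    exact ((hG n).cauchyInt_eq_zero hz).symm
  have hkH : IsH2 k := isH2_of_cauchyInt_eq_zero (Lp.memLp k) fun z hz => by
    refine tendsto_nhds_unique (hkl z hz.ne) (tendsto_const_nhds.congr fun n => ?_)
    exact ((hK n).cauchyInt_eq_zero hz).symm
  have hπ : (2 * Real.pi * Complex.I : ℂ) ≠ 0 := by simp [Real.pi_ne_zero]
  have hfc : Integrable fun t => (f t : ℂ) := hf.ofReal
  -- Products do not pass to weak limits, but values in the upper half-plane do: Cauchy integrals
  -- converge pointwise and are multiplicative on `ℋ²`.
  have hmain : ∀ z : ℂ, 0 < z.im → cauchyInt (fun t => g t * k t) z =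
      2 * cauchyInt (fun t => (f t : ℂ)) z := by
    intro z hz
    rw [← mul_right_inj' hπ, hgH.cauchyInt_mul hkH hz]
    have h1 : Tendsto (fun n => 2 * Real.pi * Complex.I *
        (2 * cauchyInt (fun t => (f t : ℂ)) (z + η n * Complex.I))) U
        (𝓝 (2 * Real.pi * Complex.I * (2 * cauchyInt (fun t => (f t : ℂ)) z))) := by
      refine Tendsto.const_mul _ (Tendsto.const_mul _ ?_)
      refine (continuousAt_cauchyInt hfc hz.ne').tendsto.comp ?_
      have h2 : Tendsto (fun n => z + η n * Complex.I) atTop (𝓝 (z + ((0 : ℝ) : ℂ) * Complex.I)) :=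
        (((Complex.continuous_ofReal.tendsto 0).comp
          (tendsto_one_div_add_atTop_nhds_zero_nat (𝕜 := ℝ))).mul_const _).const_add _
      rw [Complex.ofReal_zero, zero_mul, add_zero] at h2
      exact h2.mono_left hUle
    refine tendsto_nhds_unique ((hgl z hz.ne').mul (hkl z hz.ne')) (h1.congr fun n => ?_)
    rw [← (hG n).cauchyInt_mul (hK n) hz, ← cauchyInt_analyticExt_of_im_pos hf (hη0 n) hz]
    exact congrArg _ (cauchyInt_congr (hGK n) z)
  have hP : IsH1 fun t => g t * k t := hgH.mul hkH
  have hPc : Integrable fun t => starRingEnd ℂ (g t * k t) :=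
    (Complex.conjCLE : ℂ →L[ℝ] ℂ).integrable_comp hP.1
  have hPP : Integrable fun t => g t * k t + starRingEnd ℂ (g t * k t) := hP.1.add hPc
  -- `D` is real, so it is enough that its Cauchy integral vanishes in the upper half-plane, where
  -- the conjugate term contributes nothing.
  set D : ℝ → ℂ := fun t => g t * k t + starRingEnd ℂ (g t * k t) - 2 * (f t : ℂ) with hD
  have hDi : Integrable D := hPP.sub (hfc.const_mul 2)
  have hDpos : ∀ z : ℂ, 0 < z.im → cauchyInt D z = 0 := by
    intro z hz
    rw [hD, cauchyInt_sub (integrable_div_ofReal_sub hPP hz.ne')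
      (integrable_div_ofReal_sub (hfc.const_mul 2) hz.ne'),
      cauchyInt_add (integrable_div_ofReal_sub hP.1 hz.ne') (integrable_div_ofReal_sub hPc hz.ne'),
      cauchyInt_const_mul, hmain z hz, cauchyInt_conj, hP.cauchyInt_eq_zero (by simpa using hz)]
    simp
  have hDconj : (fun t => starRingEnd ℂ (D t)) = D := by
    ext t
    simp only [hD, map_sub, map_add, map_mul, Complex.conj_conj, Complex.conj_ofReal,
      Complex.conj_ofNat]
    ring
  have hD0 := ae_eq_zero_of_cauchyInt_eq_zero hDi (fun z hz _ => by
    rcases lt_or_gt_of_ne hz with h0 | h0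
    · rw [← hDconj, cauchyInt_conj, hDpos _ (by simpa using h0), map_zero]
    · exact hDpos z h0)
  refine ⟨g, k, hgH, hkH, ?_⟩
  filter_upwards [hD0] with t ht
  have h1 := congrArg Complex.re ht
  simp only [hD, Complex.sub_re, Complex.add_re, Complex.conj_re, Complex.zero_re] at h1
  have h2 : (2 * (f t : ℂ)).re = 2 * f t := by simp
  rw [h2] at h1
  linarith

theorem exists_isFunction_hilbert {f : 𝓢'(ℝ, ℂ)} {χ : ℝ → ℂ}
    {hs : ContDiff ℝ (⊤ : ℕ∞) χ} {hc : HasCompactSupport χ} (hχ : (∫ x, χ x) ≠ 0)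
    (hf : f ∈ hardyOne χ hs hc) : ∃ ω γ : Lp ℝ 2 (volume : Measure ℝ),
      IsFunction f fun x => ω x * γ x - hilbert ω x * hilbert γ x := by
  obtain ⟨F, hF⟩ := exists_isFunction hχ hf
  obtain ⟨C, hC, hFC⟩ := exists_lintegral_analyticExt_le hχ hf hF
  obtain ⟨G, K, hG, hK, hGK⟩ := exists_re_factorization hF.1 hC hFC
  obtain ⟨ω, hω⟩ := hG.exists_hilbert
  obtain ⟨γ, hγ⟩ := hK.exists_hilbert
  have h1 : F =ᵐ[volume] fun x => ω x * γ x - hilbert ω x * hilbert γ x := by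
    filter_upwards [hGK, hω, hγ] with x e1 e2 e3
    rw [e1, e2, e3]
    simp
  refine ⟨ω, γ, hF.1.congr h1, fun φ => ?_⟩
  rw [hF.2]
  refine integral_congr_ae ?_
  filter_upwards [h1] with x hx
  rw [hx]

end RealHardy

namespace RealHardy

open Filter Topology

/-! ### An element of the Hardy space that is not a square -/

theorem integral_inv_mul_comp_sub_div (g : ℝ → ℝ) {t : ℝ} (ht : 0 < t) (x : ℝ) :
    ∫ y, t⁻¹ * g ((x - y) / t) = ∫ u, g u := by
  have h1 := integral_sub_left_eq_self (fun y : ℝ => g (y / t)) volume x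
  have h2 := Measure.integral_comp_div g t
  rw [integral_const_mul, h1, h2, abs_of_pos ht, smul_eq_mul, inv_mul_cancel_left₀ ht.ne']

theorem norm_cv_le_of_forall {χ f : ℝ → ℂ} (hχ : Integrable χ) {t x M : ℝ} (ht : 0 < t)
    (hM : ∀ y, χ ((x - y) / t) ≠ 0 → ‖f y‖ ≤ M) : ‖cv χ f t x‖ ≤ (∫ u, ‖χ u‖) * M := by
  have hi : Integrable fun y : ℝ => t⁻¹ * ‖χ ((x - y) / t)‖ :=
    ((hχ.norm.comp_div ht.ne').comp_sub_left x).const_mul _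
  rw [← integral_inv_mul_comp_sub_div (fun u => ‖χ u‖) ht x, ← integral_mul_const]
  refine norm_integral_le_of_norm_le (hi.mul_const M) (Eventually.of_forall fun y => ?_)
  rw [norm_mul, norm_mul, norm_inv, Complex.norm_real, Real.norm_of_nonneg ht.le]
  by_cases h : χ ((x - y) / t) = 0
  · simp [h]
  · exact mul_le_mul_of_nonneg_left (hM y h) (by positivity)

/-- Integration by parts moves the derivative to the dilated kernel, gaining `t⁻²`; this is the
cancellation at large scales. -/
theorem norm_cv_deriv_le {χ f q : ℝ → ℂ} (hs : ContDiff ℝ (⊤ : ℕ∞) χ) {K₀ K : ℝ}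
    (hK₀ : ∀ u, ‖χ u‖ ≤ K₀) (hK : ∀ u, ‖deriv χ u‖ ≤ K) (hf : Integrable f) (hq : Integrable q)
    (hqf : ∀ y, HasDerivAt q (f y) y) {t : ℝ} (ht : 0 < t) (x : ℝ) :
    ‖cv χ f t x‖ ≤ K * (t ^ 2)⁻¹ * ∫ y, ‖q y‖ := by
  have hχ' : Continuous (deriv χ) := hs.continuous_deriv (by simp)
  have hd : ∀ y, HasDerivAt (fun y : ℝ => (t : ℂ)⁻¹ * χ ((x - y) / t))
      (-((t : ℂ) ^ 2)⁻¹ * deriv χ ((x - y) / t)) y := fun y => by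
    have h1 : HasDerivAt (fun y : ℝ => (x - y) / t) (-1 / t) y :=
      ((hasDerivAt_id y).const_sub x).div_const t
    have h2 := ((hs.differentiable (by simp) ((x - y) / t)).hasDerivAt.scomp y h1).const_mul
      ((t : ℂ)⁻¹)
    refine h2.congr_deriv ?_
    rw [Complex.real_smul]
    push_cast
    ring
  have hb : ∀ y, ‖-((t : ℂ) ^ 2)⁻¹ * deriv χ ((x - y) / t)‖ ≤ K * (t ^ 2)⁻¹ := fun y => by
    rw [norm_mul, norm_neg, norm_inv, norm_pow, Complex.norm_real, Real.norm_of_nonneg ht.le,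
      mul_comm]
    exact mul_le_mul_of_nonneg_right (hK _) (by positivity)
  have hb' : ∀ y, ‖(t : ℂ)⁻¹ * χ ((x - y) / t)‖ ≤ t⁻¹ * K₀ := fun y => by
    rw [norm_mul, norm_inv, Complex.norm_real, Real.norm_of_nonneg ht.le]
    exact mul_le_mul_of_nonneg_left (hK₀ _) (by positivity)
  have hc1 : Continuous fun y : ℝ => (t : ℂ)⁻¹ * χ ((x - y) / t) :=
    continuous_const.mul (hs.continuous.comp (by fun_prop))
  have hc2 : Continuous fun y : ℝ => -((t : ℂ) ^ 2)⁻¹ * deriv χ ((x - y) / t) :=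
    continuous_const.mul (hχ'.comp (by fun_prop))
  have h3 := integral_mul_deriv_eq_deriv_mul_of_integrable (fun y _ => hd y) (fun y _ => hqf y)
    (hf.bdd_mul hc1.aestronglyMeasurable (Eventually.of_forall hb'))
    (hq.bdd_mul hc2.aestronglyMeasurable (Eventually.of_forall hb))
    (hq.bdd_mul hc1.aestronglyMeasurable (Eventually.of_forall hb'))
  rw [cv, h3, norm_neg, ← integral_const_mul]
  refine norm_integral_le_of_norm_le (hq.norm.const_mul _) (Eventually.of_forall fun y => ?_)
  rw [norm_mul]
  exact mul_le_mul_of_nonneg_right (hb y) (norm_nonneg _)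

/-- The maximal function of the derivative of a function decays quadratically as soon as both the
function and its derivative do. -/
theorem exists_vmax_le {χ f q : ℝ → ℂ} (hs : ContDiff ℝ (⊤ : ℕ∞) χ) (hc : HasCompactSupport χ)
    (hf : Integrable f) (hq : Integrable q) (hqf : ∀ y, HasDerivAt q (f y) y)
    (hfb : ∀ y, ‖f y‖ ≤ (1 + y ^ 2)⁻¹) :
    ∃ C : ℝ, ∀ x, vmax χ f x ≤ ENNReal.ofReal (C * (1 + x ^ 2)⁻¹) := by
  obtain ⟨R, hR0, hR⟩ := exists_support_bound hc
  obtain ⟨K₀, hK₀⟩ := hc.exists_bound_of_continuous hs.continuous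
  obtain ⟨K, hK⟩ := hc.deriv.exists_bound_of_continuous (hs.continuous_deriv (by simp))
  have hK0 : 0 ≤ K := (norm_nonneg _).trans (hK 0)
  have hχi : Integrable χ := hs.continuous.integrable_of_hasCompactSupport hc
  set A : ℝ := ∫ u, ‖χ u‖ with hA
  have hA0 : 0 ≤ A := integral_nonneg fun _ => norm_nonneg _
  set B : ℝ := ∫ y, ‖q y‖ with hB
  have hB0 : 0 ≤ B := integral_nonneg fun _ => norm_nonneg _
  refine ⟨4 * A + 8 * R ^ 2 * K * B, fun x => iSup_le fun ⟨t, ht⟩ => ?_⟩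
  rw [Set.mem_Ioi] at ht
  rw [← ofReal_norm]
  refine ENNReal.ofReal_le_ofReal ?_
  change ‖cv χ f t x‖ ≤ _
  have hx0 : 0 < 1 + x ^ 2 := by positivity
  have hS : 0 ≤ R ^ 2 * K * B := by positivity
  rw [← div_eq_mul_inv, le_div_iff₀ hx0]
  -- At small scales the kernel sees only `|y| ≥ |x| / 2`, where `f` itself decays. At large scales
  -- `t⁻²` is controlled by `x⁻²`, except for `|x| ≤ 1`, where boundedness of `f` suffices.
  rcases lt_or_ge (2 * R * t) |x| with h | h
  · have h1 := norm_cv_le_of_forall (f := f) (x := x) (M := 4 * (1 + x ^ 2)⁻¹) hχi ht fun y hy => by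
      refine (hfb y).trans ?_
      have h2 : |(x - y) / t| ≤ R := by
        by_contra! h3
        exact hy (hR _ h3)
      rw [abs_div, abs_of_pos ht, div_le_iff₀ ht] at h2
      have h3 := abs_sub_abs_le_abs_sub x y
      have h4 : |x| ≤ 2 * |y| := by linarith
      have h5 : x ^ 2 ≤ 4 * y ^ 2 := by
        rw [← sq_abs x, ← sq_abs y]
        nlinarith [abs_nonneg x, abs_nonneg y]
      rw [← div_eq_mul_inv, inv_eq_one_div, div_le_div_iff₀ (by positivity) hx0]
      linarith
    calc ‖cv χ f t x‖ * (1 + x ^ 2) ≤ A * (4 * (1 + x ^ 2)⁻¹) * (1 + x ^ 2) :=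
          mul_le_mul_of_nonneg_right h1 hx0.le
      _ = 4 * A := by field_simp
      _ ≤ _ := by linarith
  rcases le_or_gt |x| 1 with hx | hx
  · have h1 := norm_cv_le_of_forall (f := f) (x := x) (M := 1) hχi ht fun y _ =>
      (hfb y).trans (inv_le_one_of_one_le₀ (by nlinarith))
    have h2 : x ^ 2 ≤ 1 := (sq_le_one_iff_abs_le_one x).mpr hx
    nlinarith [norm_nonneg (cv χ f t x)]
  · have h1 := norm_cv_deriv_le hs hK₀ hK hf hq hqf ht x
    have h2 : 1 < x ^ 2 := (one_lt_sq_iff_one_lt_abs x).mpr hx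
    have h3 : x ^ 2 ≤ 4 * R ^ 2 * t ^ 2 := by
      rw [← sq_abs x]
      calc |x| ^ 2 ≤ (2 * R * t) ^ 2 := pow_le_pow_left₀ (abs_nonneg x) h 2
        _ = _ := by ring
    have h4 : (t ^ 2)⁻¹ * (1 + x ^ 2) ≤ 8 * R ^ 2 := by
      rw [inv_mul_le_iff₀ (by positivity)]
      linarith
    calc ‖cv χ f t x‖ * (1 + x ^ 2) ≤ K * (t ^ 2)⁻¹ * B * (1 + x ^ 2) :=
          mul_le_mul_of_nonneg_right h1 hx0.le
      _ = K * B * ((t ^ 2)⁻¹ * (1 + x ^ 2)) := by ring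
      _ ≤ K * B * (8 * R ^ 2) := mul_le_mul_of_nonneg_left h4 (by positivity)
      _ ≤ _ := by linarith

/-- The boundary values of `(z - i) / (z + i) ^ 4`. -/
noncomputable def nonsquare (t : ℝ) : ℂ := (t - Complex.I) / (t + Complex.I) ^ 4

theorem norm_ofReal_add_I_sq (t : ℝ) : ‖(t : ℂ) + Complex.I‖ ^ 2 = 1 + t ^ 2 := by
  rw [← Complex.normSq_eq_norm_sq, Complex.normSq_apply]
  simp
  ring

theorem norm_ofReal_add_I_inv_le (t : ℝ) : ‖((t : ℂ) + Complex.I)⁻¹‖ ≤ 1 := by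
  rw [norm_inv]
  refine inv_le_one_of_one_le₀ ?_
  nlinarith [norm_ofReal_add_I_sq t, norm_nonneg ((t : ℂ) + Complex.I)]

theorem norm_ofReal_add_I_inv_sq (t : ℝ) : ‖((t : ℂ) + Complex.I)⁻¹‖ ^ 2 = (1 + t ^ 2)⁻¹ := by
  rw [norm_inv, inv_pow, norm_ofReal_add_I_sq]

theorem nonsquare_eq (t : ℝ) : nonsquare t =
    blaschke t * ((t : ℂ) + Complex.I)⁻¹ * (((t : ℂ) + Complex.I)⁻¹ * ((t : ℂ) + Complex.I)⁻¹) := by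
  rw [nonsquare, blaschke]
  have := ofReal_add_I_ne_zero t
  field_simp

theorem norm_nonsquare_le (t : ℝ) : ‖nonsquare t‖ ≤ (1 + t ^ 2)⁻¹ := by
  rw [nonsquare_eq, norm_mul, norm_mul, norm_mul, norm_blaschke, ← sq, norm_ofReal_add_I_inv_sq,
    one_mul]
  exact mul_le_of_le_one_left (by positivity) (norm_ofReal_add_I_inv_le t)

/-- The inverse `(t + i)⁻¹` is in `ℋ²`. -/
theorem isH2_inv_ofReal_add_I : IsH2 fun t : ℝ => ((t : ℂ) + Complex.I)⁻¹ := by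
  simpa using isH2_inv_ofReal_sub (w := -Complex.I) (by simp)

theorem isH2_inv_ofReal_add_I_sq :
    IsH2 fun t : ℝ => ((t : ℂ) + Complex.I)⁻¹ * ((t : ℂ) + Complex.I)⁻¹ := by
  simpa [div_eq_mul_inv] using isH2_inv_ofReal_add_I.div (w := -Complex.I) (by simp)

theorem isH1_nonsquare : IsH1 nonsquare :=
  (isH2_inv_ofReal_add_I.blaschke_mul.mul isH2_inv_ofReal_add_I_sq).congr
    (Eventually.of_forall fun t => (nonsquare_eq t).symm)

/-- A primitive of `nonsquare`. -/
noncomputable def primitive (t : ℝ) : ℂ :=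
  -(1 / 2) * (((t : ℂ) + Complex.I)⁻¹) ^ 2 + 2 * Complex.I / 3 * (((t : ℂ) + Complex.I)⁻¹) ^ 3

theorem hasDerivAt_primitive (t : ℝ) : HasDerivAt primitive (nonsquare t) t := by
  have h0 := ofReal_add_I_ne_zero t
  have h1 : HasDerivAt (fun t : ℝ => (t : ℂ) + Complex.I) 1 t :=
    (Complex.ofRealCLM.hasDerivAt (x := t)).add_const Complex.I
  have h2 : HasDerivAt (fun t : ℝ => ((t : ℂ) + Complex.I)⁻¹) (-1 / ((t : ℂ) + Complex.I) ^ 2) t :=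
    h1.inv h0
  refine (((h2.pow 2).const_mul (-(1 / 2 : ℂ))).add
    ((h2.pow 3).const_mul (2 * Complex.I / 3))).congr_deriv ?_
  rw [nonsquare]
  push_cast
  field_simp
  ring

theorem norm_primitive_le (t : ℝ) : ‖primitive t‖ ≤ 2 * (1 + t ^ 2)⁻¹ := by
  have h1 := norm_ofReal_add_I_inv_le t
  have h2 : (0 : ℝ) ≤ (1 + t ^ 2)⁻¹ := by positivity
  refine (norm_add_le _ _).trans ?_
  rw [norm_mul, norm_mul, norm_pow, norm_pow, pow_succ _ 2, norm_ofReal_add_I_inv_sq]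
  have h3 : ‖-(1 / 2 : ℂ)‖ = 1 / 2 := by norm_num
  have h4 : ‖2 * Complex.I / 3‖ = 2 / 3 := by norm_num
  rw [h3, h4]
  nlinarith [mul_le_mul_of_nonneg_left h1 h2]

/-- The distribution `Re nonsquare`. -/
noncomputable def nonsquareRe : 𝓢'(ℝ, ℂ) :=
  functional (fun t => ((nonsquare t).re : ℂ)) isH1_nonsquare.1.re.ofReal

theorem isFunction_nonsquareRe : IsFunction nonsquareRe fun t => (nonsquare t).re :=
  ⟨isH1_nonsquare.1.re, fun φ => functional_apply _ φ⟩

theorem IsFunction.isReal {f : 𝓢'(ℝ, ℂ)} {F : ℝ → ℝ} (h : IsFunction f F) : IsReal f := by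
  intro φ hφ
  have h1 : ∫ x, φ x * (F x : ℂ) = ((∫ x, (φ x).re * F x : ℝ) : ℂ) := by
    rw [← integral_complex_ofReal]
    refine integral_congr_ae (Eventually.of_forall fun x => ?_)
    exact Complex.ext (by simp) (by simp [hφ x])
  rw [h.2, h1, Complex.ofReal_im]

theorem nonsquareRe_mem_hardyOne {χ : ℝ → ℂ} (hs : ContDiff ℝ (⊤ : ℕ∞) χ)
    (hc : HasCompactSupport χ) : nonsquareRe ∈ hardyOne χ hs hc := by
  refine ⟨isFunction_nonsquareRe.isReal, ?_⟩
  have hd : ∀ t, HasDerivAt (fun t => ((primitive t).re : ℂ)) ((nonsquare t).re : ℂ) t := fun t =>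
    ((Complex.reCLM.hasFDerivAt.comp_hasDerivAt t (hasDerivAt_primitive t))).ofReal_comp
  have hp : Integrable fun t => ((primitive t).re : ℂ) := by
    refine (integrable_inv_one_add_sq.const_mul 2).mono'
      (continuous_iff_continuousAt.mpr fun t => (hd t).continuousAt).aestronglyMeasurable
      (Eventually.of_forall fun t => ?_)
    rw [Complex.norm_real]
    exact (Complex.abs_re_le_norm _).trans (norm_primitive_le t)
  have hn : Integrable fun t => ((nonsquare t).re : ℂ) := isH1_nonsquare.1.re.ofReal
  obtain ⟨C, hC⟩ := exists_vmax_le hs hc hn hp hd fun t => by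
    rw [Complex.norm_real]
    exact (Complex.abs_re_le_norm _).trans (norm_nonsquare_le t)
  calc ∫⁻ x, maximal nonsquareRe χ hs hc x ≤ ∫⁻ x, ENNReal.ofReal (C * (1 + x ^ 2)⁻¹) :=
        lintegral_mono fun x => by
          rw [isFunction_nonsquareRe.maximal_eq]
          exact hC x
    _ < ∞ := (integrable_inv_one_add_sq.const_mul C).lintegral_lt_top

/-- The function `nonsquare` is not the square of a function in `ℋ²`. -/
theorem not_nonsquare_ae_eq_sq {α : ℝ → ℂ} (hα : IsH2 α) : ¬ ∀ᵐ t, nonsquare t = α t * α t := by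
  intro h
  have hI : (0 : ℝ) < Complex.I.im := by simp
  have hk := isH2_inv_ofReal_add_I
  have hk2 := isH2_inv_ofReal_add_I_sq
  have hk3 : IsH2 fun t : ℝ => ((t : ℂ) + Complex.I)⁻¹ * ((t : ℂ) + Complex.I)⁻¹ *
      ((t : ℂ) + Complex.I)⁻¹ := by
    simpa [div_eq_mul_inv] using hk2.div (w := -Complex.I) (by simp)
  have h1 : cauchyInt (fun t => α t * α t) Complex.I = 0 := by
    rw [← (hk.mul hk3).integral_eq_zero, cauchyInt]
    refine integral_congr_ae ?_
    filter_upwards [h] with t ht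
    rw [← ht, nonsquare]
    have e1 := ofReal_add_I_ne_zero t
    have e2 := ofReal_sub_I_ne_zero t
    field_simp
  have h2 : cauchyInt α Complex.I = 0 := by
    have := hα.cauchyInt_mul hα hI
    rw [h1, mul_zero] at this
    simpa using this.symm
  have hβ := hα.div_of_cauchyInt_eq_zero hI h2
  have hπ : (2 * Real.pi * Complex.I : ℂ) ≠ 0 := by simp [Real.pi_ne_zero]
  have h3 : cauchyInt (fun t : ℝ => ((t : ℂ) + Complex.I)⁻¹) Complex.I ≠ 0 := by
    have := cauchyInt_inv_ofReal_sub (p := -Complex.I) (by simp) hI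
    simp only [sub_neg_eq_add] at this
    rw [this]
    exact div_ne_zero hπ (by simp [← two_mul])
  have h4 : cauchyInt (fun t : ℝ => ((t : ℂ) + Complex.I)⁻¹ * ((t : ℂ) + Complex.I)⁻¹)
      Complex.I ≠ 0 := by
    rw [← mul_ne_zero_iff_left hπ, hk.cauchyInt_mul hk hI]
    exact mul_ne_zero h3 h3
  -- If `β = α / (t - i)` is in `ℋ²`, then `∫ β² = 0`. But `β² = (t + i)⁻⁴ / (t - i)`, whose
  -- integral is the Cauchy integral of `(t + i)⁻⁴` at `i`, nonzero by multiplicativity.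
  refine mul_ne_zero h4 h4 ?_
  rw [← hk2.cauchyInt_mul hk2 hI, ← mul_zero (2 * Real.pi * Complex.I : ℂ),
    ← hβ.integral_mul_eq_zero hβ, cauchyInt]
  congr 1
  refine integral_congr_ae ?_
  filter_upwards [h] with t ht
  have e1 := ofReal_add_I_ne_zero t
  have e2 := ofReal_sub_I_ne_zero t
  rw [div_mul_div_comm, ← ht, nonsquare]
  field_simp

theorem IsFunction.ae_eq {f : 𝓢'(ℝ, ℂ)} {F G : ℝ → ℝ} (hF : IsFunction f F)
    (hG : IsFunction f G) : ∀ᵐ x, F x = G x := by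
  refine ae_eq_of_integral_contDiff_smul_eq hF.1.locallyIntegrable hG.1.locallyIntegrable
    fun g hg hgc => ?_
  have hgc' : HasCompactSupport fun x => (g x : ℂ) := hgc.comp_left (g := Complex.ofReal) rfl
  let ψ : 𝓢(ℝ, ℂ) := HasCompactSupport.toSchwartzMap hgc' (Complex.ofRealCLM.contDiff.comp hg)
  have h1 : ∀ H : ℝ → ℝ, ∫ x, ψ x * (H x : ℂ) = ((∫ x, g x • H x : ℝ) : ℂ) := fun H => by
    rw [← integral_complex_ofReal]
    refine integral_congr_ae (Eventually.of_forall fun x => ?_)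
    change (g x : ℂ) * (H x : ℂ) = ((g x * H x : ℝ) : ℂ)
    push_cast
    rfl
  apply Complex.ofReal_injective
  rw [← h1, ← h1, ← hF.2, ← hG.2]

/-- The expression is the real part of `(ω + i Hω)²`, an element of `ℋ¹`. Elements of `ℋ¹` with
equal real parts coincide, so `nonsquare` would be a square. -/
theorem not_isFunction_nonsquareRe_sq (ω : Lp ℝ 2 (volume : Measure ℝ)) :
    ¬ IsFunction nonsquareRe fun x => ω x ^ 2 - hilbert ω x ^ 2 := by
  intro h
  have hα := isH2_add_hilbert ω
  have hD : Integrable fun x => nonsquare x - ((ω x : ℂ) + Complex.I * (hilbert ω x : ℂ)) *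
      ((ω x : ℂ) + Complex.I * (hilbert ω x : ℂ)) := isH1_nonsquare.1.sub (hα.mul hα).1
  refine not_nonsquare_ae_eq_sq hα ?_
  have h0 := ae_eq_zero_of_re_eq_zero hD (fun z hz => by
    rw [cauchyInt_sub (integrable_div_ofReal_sub isH1_nonsquare.1 hz.ne)
      (integrable_div_ofReal_sub (hα.mul hα).1 hz.ne), isH1_nonsquare.cauchyInt_eq_zero hz,
      (hα.mul hα).cauchyInt_eq_zero hz, sub_zero]) (by
    filter_upwards [isFunction_nonsquareRe.ae_eq h] with x hx
    rw [Complex.sub_re, hx]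
    simp
    ring)
  filter_upwards [h0] with x hx
  exact sub_eq_zero.mp hx

/-! ### The complex Hardy spaces -/

theorem setOf_mul_eq_hardyComplexOne :
    {δ | ∃ α ∈ hardyComplexTwo, ∃ β ∈ hardyComplexTwo, δ = α * β} = hardyComplexOne := by
  ext δ
  rw [mem_hardyComplexOne_iff]
  constructor
  · rintro ⟨α, hα, β, hβ, rfl⟩
    rw [mem_hardyComplexTwo_iff] at hα hβ
    exact (hα.mul hβ).congr (AEEqFun.coeFn_mul α β).symm
  · intro hδ
    obtain ⟨G, K, hG, hK, hGK, -⟩ := exists_factorization hδ.1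
      hδ.integral_mul_blaschke_pow_eq_zero
    refine ⟨AEEqFun.mk G hG.1.1, (mem_hardyComplexTwo_iff _).mpr
      (hG.congr (AEEqFun.coeFn_mk _ _).symm), AEEqFun.mk K hK.1.1, (mem_hardyComplexTwo_iff _).mpr
      (hK.congr (AEEqFun.coeFn_mk _ _).symm), AEEqFun.ext ?_⟩
    filter_upwards [hGK, AEEqFun.coeFn_mul (AEEqFun.mk G hG.1.1) (AEEqFun.mk K hK.1.1),
      AEEqFun.coeFn_mk G hG.1.1, AEEqFun.coeFn_mk K hK.1.1] with t e1 e2 e3 e4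
    rw [e1, e2, Pi.mul_apply, e3, e4]

theorem setOf_sq_ssubset : {β | ∃ α ∈ hardyComplexTwo, β = α ^ 2} ⊂
    {δ | ∃ α ∈ hardyComplexTwo, ∃ β ∈ hardyComplexTwo, δ = α * β} := by
  refine (Set.ssubset_iff_of_subset ?_).mpr ⟨AEEqFun.mk nonsquare isH1_nonsquare.1.1, ?_, ?_⟩
  · rintro β ⟨α, hα, rfl⟩
    exact ⟨α, hα, α, hα, sq α⟩
  · rw [setOf_mul_eq_hardyComplexOne, mem_hardyComplexOne_iff]
    exact isH1_nonsquare.congr (AEEqFun.coeFn_mk _ _).symm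
  · rintro ⟨α, hα, h⟩
    refine not_nonsquare_ae_eq_sq ((mem_hardyComplexTwo_iff α).mp hα) ?_
    filter_upwards [AEEqFun.coeFn_mk nonsquare isH1_nonsquare.1.1, AEEqFun.coeFn_mul α α]
      with t e1 e2
    rw [← e1, h, sq, e2, Pi.mul_apply]

end RealHardy

theorem propositionA1 (χ : ℝ → ℂ) (hs : ContDiff ℝ (⊤ : ℕ∞) χ) (hc : HasCompactSupport χ)
    (hχ : (∫ x, χ x) ≠ 0) :
    (∀ f ∈ RealHardy.hardyOne χ hs hc, ∃ ω γ : Lp ℝ 2 (volume : Measure ℝ),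
      RealHardy.IsFunction f
        (fun x => ω x * γ x - RealHardy.hilbert ω x * RealHardy.hilbert γ x)) ∧
    (∃ f ∈ RealHardy.hardyOne χ hs hc, ¬ ∃ ω : Lp ℝ 2 (volume : Measure ℝ),
      RealHardy.IsFunction f (fun x => ω x ^ 2 - RealHardy.hilbert ω x ^ 2)) ∧
    {β | ∃ α ∈ RealHardy.hardyComplexTwo, β = α ^ 2} ⊂
      {δ | ∃ α ∈ RealHardy.hardyComplexTwo, ∃ β ∈ RealHardy.hardyComplexTwo, δ = α * β} ∧
    {δ | ∃ α ∈ RealHardy.hardyComplexTwo, ∃ β ∈ RealHardy.hardyComplexTwo, δ = α * β} =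
      RealHardy.hardyComplexOne :=
  ⟨fun _ hf => RealHardy.exists_isFunction_hilbert hχ hf,
    ⟨RealHardy.nonsquareRe, RealHardy.nonsquareRe_mem_hardyOne hs hc,
      fun ⟨ω, hω⟩ => RealHardy.not_isFunction_nonsquareRe_sq ω hω⟩,
    RealHardy.setOf_sq_ssubset, RealHardy.setOf_mul_eq_hardyComplexOne⟩
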